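/- Let $n\ge 2$, $0<\lambda_0\le 1$ and $\Lambda_0>0$. Consider real $n\times n$ matrix functions $A$ on $\mathbb R^n$ with measurable symmetric part $A^s=\frac12(A+A^{\intercal})$ satisfying, for a.e. $x$, $\lambda_0|\xi|^2\le A^s(x)\xi\cdot\xi$ for all $\xi\in\mathbb R^n$ and $|a^s_{ij}(x)|\le\lambda_0^{-1}$ for all $i,j$, and with anti-symmetric part $A^a=\frac12(A-A^{\intercal})$ whose entries are locally integrable and satisfy $\sup_Q\frac1{|Q|}\int_Q|a^a_{ij}-(a^a_{ij})_Q|\,dx\le\Lambda_0$, the supremum being over all cubes $Q$ with sides parallel to the axes and $(\cdot)_Q$ denoting the mean over $Q$. For $u,v$ in the complex Sobolev space $W^{1,2}(\mathbb R^n)$ let $$t[u,v]=\int_{\mathbb R^n}A^s\nabla u\cdot\nabla\bar v+\int_{\mathbb R^n}A^a\nabla u\cdot\nabla\bar v ,$$ where the second integral is understood as $\frac12\sum_{i,j}\langle a^a_{ij},\ \partial_ju\,\partial_i\bar v-\partial_iu\,\partial_j\bar v\rangle$ with $\langle\cdot,\cdot\rangle$ the duality pairing between $BMO(\mathbb R^n)$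 and the Hardy space $\mathcal H^1(\mathbb R^n)$, i.e. $\langle b,h\rangle=\lim_{N\to\infty}\int\max(-N,\min(N,b))\,h\,dx$. Let $L=-\operatorname{div}(A\nabla)$ be the associated operator in $L^2(\mathbb R^n)$: $u\in D(L)$ and $Lu=w$ iff $u\in W^{1,2}(\mathbb R^n)$, $w\in L^2(\mathbb R^n)$ and $t[u,v]=(w,v)_{L^2}$ for all $v\in W^{1,2}(\mathbb R^n)$. Then there are $\theta_0\in(0,\frac\pi2)$, $c_l$ $(l=0,1,2,\dots)$ and $C$, depending only on $n,\lambda_0,\Lambda_0$ (and $c_l$ on $l$), such that for every such $A$ the following holds. The numerical range $\{t[u,u]:u\in W^{1,2},\|u\|_{L^2}=1\}$ lies in the sector $\{|\arg\xi|\le\theta_0\}$, and $-L$ generates a strongly continuous semigroup $(e^{-tL})_{t\ge0}$ on $L^2(\mathbb R^n)$. For $f\in L^2(\mathbb R^n)$ put $h(\cdot,t)=e^{-tL}f$. Then $h\in C((0,\infty),W^{1,2}(\mathbb R^n))$, and $\partial_t^lh\in C((0,\infty),L^2(\mathbb R^n))$ for every $l\ge 0$, the $t$-derivatives being those of an $L^2$-valued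 function. Moreover, let $0<\theta<\theta_1<\frac\pi2$ be such that the numerical range of $t$ lies in $\{|\arg\xi|\le\theta\}$ (for instance $\theta=\theta_0$). Then for every $\lambda\neq0$ with $|\arg\lambda|\le\pi-\theta_1$ the resolvent $(\lambda I+L)^{-1}$ exists as a bounded operator on $L^2(\mathbb R^n)$ and is bounded from $L^2(\mathbb R^n)$ to $W^{1,2}(\mathbb R^n)$. For every $R>0$ let $\Gamma$ be the path formed by the half-rays $\{re^{\pm i(\pi-\theta_1)}:r\ge R\}$ and the arc $\{Re^{i\theta'}:|\theta'|\le\pi-\theta_1\}$, oriented from $\infty e^{-i(\pi-\theta_1)}$ to $\infty e^{i(\pi-\theta_1)}$. Then for all $f\in L^2(\mathbb R^n)$, $t>0$, $l\ge0$ and $1\le j\le n$, $$\partial_t^lh(\cdot,t)=\frac1{2\pi i}\int_\Gamma\lambda^le^{\lambda t}(\lambda I+L)^{-1}f\,d\lambda,\qquad \partial_jh(\cdot,t)=\frac1{2\pi i}\int_\Gamma e^{\lambda t}\,\partial_j(\lambda I+L)^{-1}f\,d\lambda ,$$ the integrals converging absolutely in $L^2(\mathbb R^n)$. Finally, for all $t>0$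 and all $l\ge0$, $$\|\partial_t^le^{-tL}\|_{L^2\to L^2}\le c_l\,t^{-l},\qquad \|\nabla e^{-tL}\|_{L^2\to L^2}\le C\,t^{-1/2}.$$ -/

import Mathlib

open MeasureTheory Filter Topology Set
open scoped SchwartzMap TemperedDistribution LineDeriv ContDiff

noncomputable section

namespace BMOElliptic

/-- Euclidean space `ℝⁿ`. -/
abbrev E (n : ℕ) : Type := EuclideanSpace ℝ (Fin n)

/-- The complex Hilbert space `L²(ℝⁿ)`. -/
abbrev L2 (n : ℕ) : Type := Lp ℂ 2 (volume : Measure (E n))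

/-! ### The Sobolev space `W^{1,2}(ℝⁿ)` -/

/-- `HasWeakDeriv j u g`: the function `g ∈ L²` is the `j`-th distributional derivative of
`u ∈ L²`. -/
def HasWeakDeriv {n : ℕ} (j : Fin n) (u g : L2 n) : Prop :=
  (∂_{(EuclideanSpace.single j (1 : ℝ) : E n)} (u : 𝓢'(E n, ℂ)) : 𝓢'(E n, ℂ)) = (g : 𝓢'(E n, ℂ))

/-- The complex Sobolev space `W^{1,2}(ℝⁿ)`, realised as the space of all pairs `(u, ∇u)` with
`u ∈ L²` and weak gradient `∇u ∈ (L²)ⁿ`. The inherited norm is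
`(‖u‖² + ∑ⱼ ‖∂ⱼu‖²)^{1/2}`. -/
def W12 (n : ℕ) : Submodule ℂ (WithLp 2 (L2 n × PiLp 2 (fun _ : Fin n => L2 n))) where
  carrier := {p | ∀ j, HasWeakDeriv j p.fst (p.snd j)}
  add_mem' := by
    intro p q hp hq j
    have h1 := hp j
    have h2 := hq j
    simp only [HasWeakDeriv, ← Lp.toTemperedDistributionCLM_apply] at h1 h2 ⊢
    simp only [WithLp.add_fst, WithLp.add_snd, PiLp.add_apply, map_add,
      LineDeriv.lineDerivOp_add, h1, h2]
  zero_mem' := by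
    intro j
    simp only [HasWeakDeriv, ← Lp.toTemperedDistributionCLM_apply, WithLp.zero_fst,
      WithLp.zero_snd, PiLp.zero_apply, map_zero, LineDeriv.lineDerivOp_zero]
  smul_mem' := by
    intro c p hp j
    have h1 := hp j
    simp only [HasWeakDeriv, ← Lp.toTemperedDistributionCLM_apply] at h1 ⊢
    simp only [WithLp.smul_fst, WithLp.smul_snd, PiLp.smul_apply, map_smul,
      LineDeriv.lineDerivOp_smul, h1]

/-- The embedding `W^{1,2}(ℝⁿ) → L²(ℝⁿ)`. -/
def toL2 (n : ℕ) : W12 n →L[ℂ] L2 n :=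
  (WithLp.fstL 2 ℂ (L2 n) (PiLp 2 (fun _ : Fin n => L2 n))).comp (W12 n).subtypeL

/-- The gradient `∇ : W^{1,2}(ℝⁿ) → (L²(ℝⁿ))ⁿ`, the target having the norm
`‖∇u‖ = (∑ⱼ ‖∂ⱼu‖²)^{1/2}`. -/
def grad (n : ℕ) : W12 n →L[ℂ] PiLp 2 (fun _ : Fin n => L2 n) :=
  (WithLp.sndL 2 ℂ (L2 n) (PiLp 2 (fun _ : Fin n => L2 n))).comp (W12 n).subtypeL

/-! ### The coefficients -/

/-- The symmetric part `Aˢ = (A + Aᵀ)/2`. -/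
def symmPart {n : ℕ} (A : E n → Matrix (Fin n) (Fin n) ℝ) (x : E n) :
    Matrix (Fin n) (Fin n) ℝ :=
  (1 / 2 : ℝ) • (A x + (A x).transpose)

/-- The anti-symmetric part `Aᵃ = (A - Aᵀ)/2`. -/
def antiPart {n : ℕ} (A : E n → Matrix (Fin n) (Fin n) ℝ) (x : E n) :
    Matrix (Fin n) (Fin n) ℝ :=
  (1 / 2 : ℝ) • (A x - (A x).transpose)

/-- The closed cube with lower corner `a`, side length `r` and sides parallel to the axes. -/
def cube {n : ℕ} (a : E n) (r : ℝ) : Set (E n) := {y | ∀ i, y i ∈ Icc (a i) (a i + r)}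

/-- `b ∈ BMO(ℝⁿ)` with `‖b‖_BMO ≤ K`: the function `b` is locally integrable and its mean
oscillation over every cube is at most `K`. -/
def BMOBound {n : ℕ} (b : E n → ℝ) (K : ℝ) : Prop :=
  LocallyIntegrable b volume ∧
    ∀ (a : E n) (r : ℝ), 0 < r →
      ⨍ x in cube a r, |b x - ⨍ y in cube a r, b y| ≤ K

/-- The admissible real coefficient matrices: the symmetric part is bounded and elliptic with
ellipticity constant `lam`, and the entries of the anti-symmetric part have `BMO` semi-norm at
most `Lam`. -/
structure IsCoefficient {n : ℕ} (lam Lam : ℝ) (A : E n → Matrix (Fin n) (Fin n) ℝ) : Prop where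
  measurable : ∀ i j, AEStronglyMeasurable (fun x => symmPart A x i j) volume
  elliptic : ∀ᵐ x : E n, ∀ ξ : E n, lam * ‖ξ‖ ^ 2 ≤ ∑ i, ∑ j, symmPart A x i j * ξ i * ξ j
  bounded : ∀ i j, ∀ᵐ x : E n, |symmPart A x i j| ≤ lam⁻¹
  bmo : ∀ i j, BMOBound (fun x => antiPart A x i j) Lam

/-! ### The sesquilinear form and the operator `L` -/

/-- The truncation of the real number `s` at height `N`. -/
def truncate (N s : ℝ) : ℝ := max (-N) (min N s)

/-- The duality pairing `⟨b, h⟩` of `b ∈ BMO(ℝⁿ)` with `h` in the Hardy space `H¹(ℝⁿ)`, which is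
how "`∫ b h`" is to be read when `b h` is not integrable: `⟨b, h⟩ = lim_{N → ∞} ∫ T_N(b) h`, where
`T_N(b)` is the truncation of `b` at height `N`. The limit exists for all such `b` and `h`. -/
def bmoPairing {n : ℕ} (b : E n → ℝ) (h : E n → ℂ) : ℂ :=
  limUnder atTop (fun N : ℕ => ∫ x, (truncate N (b x) : ℂ) * h x)

/-- The sesquilinear form `t[u,v] = ∫ Aˢ∇u·∇v̄ + ∫ Aᵃ∇u·∇v̄` on `W^{1,2}(ℝⁿ)`. By anti-symmetry
the integrand of the second term is `½ ∑ᵢⱼ aᵃᵢⱼ (∂ⱼu ∂ᵢv̄ - ∂ᵢu ∂ⱼv̄)`, in which the functions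
`∂ⱼu ∂ᵢv̄ - ∂ᵢu ∂ⱼv̄` belong to the Hardy space; the integral is their pairing with
`aᵃᵢⱼ ∈ BMO`. -/
def form {n : ℕ} (A : E n → Matrix (Fin n) (Fin n) ℝ) (u v : W12 n) : ℂ :=
  (∫ x, ∑ i, ∑ j, (symmPart A x i j : ℂ) * grad n u j x * starRingEnd ℂ (grad n v i x)) +
  (1 / 2 : ℂ) * ∑ i, ∑ j, bmoPairing (fun x => antiPart A x i j)
    (fun x => grad n u j x * starRingEnd ℂ (grad n v i x) -
      grad n u i x * starRingEnd ℂ (grad n v j x))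

/-- The numerical range `Θ(t) = {t[u,u] : u ∈ W^{1,2}, ‖u‖_{L²} = 1}`. -/
def numericalRange {n : ℕ} (A : E n → Matrix (Fin n) (Fin n) ℝ) : Set ℂ :=
  {z | ∃ u : W12 n, ‖toL2 n u‖ = 1 ∧ z = form A u u}

/-- The numerical range of `t` lies in the sector `|arg ξ| ≤ θ`. -/
def NumericalRangeInSector {n : ℕ} (A : E n → Matrix (Fin n) (Fin n) ℝ) (θ : ℝ) : Prop :=
  ∀ ξ ∈ numericalRange A, |Complex.arg ξ| ≤ θ

/-- The graph of the operator `L = -div(A∇)` in `L²` associated with the form `t`: one has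
`u ∈ D(L)` and `Lu = w` iff `u ∈ W^{1,2}` and `t[u,v] = (w,v)_{L²}` for all `v ∈ W^{1,2}`. -/
def opGraph {n : ℕ} (A : E n → Matrix (Fin n) (Fin n) ℝ) : Set (L2 n × L2 n) :=
  {p | ∃ u : W12 n, toL2 n u = p.1 ∧ ∀ v : W12 n, form A u v = inner ℂ (toL2 n v) p.2}

/-! ### Resolvent and semigroup -/

/-- `T` is the resolvent `(z I + L)⁻¹`, where `G` is the graph of `L`: the bounded operator `T` is
a two-sided inverse of `z I + L : D(L) → L²`. -/
def IsResolvent {n : ℕ} (G : Set (L2 n × L2 n)) (z : ℂ) (T : L2 n →L[ℂ] L2 n) : Prop :=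
  (∀ f : L2 n, (T f, f - z • T f) ∈ G) ∧ ∀ u w : L2 n, (u, w) ∈ G → T (z • u + w) = u

/-- `S` is the strongly continuous semigroup `(e^{-tL})_{t ≥ 0}` on `L²`, i.e. the one whose
infinitesimal generator is `-L`, where `G` is the graph of `L`. The values of `S` at negative
times are irrelevant. -/
structure IsSemigroup {n : ℕ} (G : Set (L2 n × L2 n)) (S : ℝ → L2 n →L[ℂ] L2 n) : Prop where
  zero : S 0 = ContinuousLinearMap.id ℂ (L2 n)
  add : ∀ s t : ℝ, 0 ≤ s → 0 ≤ t → S (s + t) = (S s).comp (S t)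
  continuous : ∀ f : L2 n, ContinuousOn (fun t => S t f) (Ici 0)
  generator : ∀ u w : L2 n,
    Tendsto (fun t : ℝ => t⁻¹ • (S t u - u)) (𝓝[>] 0) (𝓝 (-w)) ↔ (u, w) ∈ G

/-! ### The contour -/

/-- The sector `{z : z ≠ 0, |arg z| ≤ φ}`. -/
def sector (φ : ℝ) : Set ℂ := {z | z ≠ 0 ∧ |Complex.arg z| ≤ φ}

/-- The contour integral `∫_Γ F(z) dz` exists as an absolutely convergent (Bochner) integral and
equals `I`. Here `Γ` consists of the rays `{r e^{±iφ} : r ≥ R}` and the arc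
`{R e^{iθ} : |θ| ≤ φ}`, and it is oriented from `∞ e^{-iφ}` to `∞ e^{iφ}`. -/
def HasContourIntegral {X : Type*} [NormedAddCommGroup X] [NormedSpace ℂ X]
    (φ R : ℝ) (F : ℂ → X) (I : X) : Prop :=
  IntegrableOn (fun r : ℝ => F (r * Complex.exp (φ * Complex.I))) (Ioi R) ∧
  IntegrableOn (fun r : ℝ => F (r * Complex.exp (-φ * Complex.I))) (Ioi R) ∧
  IntervalIntegrable (fun θ : ℝ => F (R * Complex.exp (θ * Complex.I))) volume (-φ) φ ∧
  I = (∫ r in Ioi R, Complex.exp (φ * Complex.I) • F (r * Complex.exp (φ * Complex.I)))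
    - (∫ r in Ioi R, Complex.exp (-φ * Complex.I) • F (r * Complex.exp (-φ * Complex.I)))
    + ∫ θ in (-φ)..φ, (Complex.I * R * Complex.exp (θ * Complex.I)) •
        F (R * Complex.exp (θ * Complex.I))

end BMOElliptic

end

open BMOElliptic

/-!
The analytic heart of the matter is that the anti-symmetric part of the coefficients, although
unbounded, contributes a bounded form: `|⟨b, ∂ⱼu ∂ᵢv̄ - ∂ᵢu ∂ⱼv̄⟩| ≤ C ‖b‖_BMO ‖∇u‖ ‖∇v‖`. Instead of
the duality of `H¹` and `BMO` the proof uses the heat flow. For smooth bounded `b` and real Schwartz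
functions `u`, `v` let `B`, `U`, `V` be the heat extensions. The space integral of
`B (∂ⱼU ∂ᵢV - ∂ᵢU ∂ⱼV)` is differentiated in time and integrated back from infinity. By the null
structure and an integration by parts, what remains are space-time integrals of products
`∂B · W · ∂Z`, where `W` and `Z` are heat extensions of first derivatives of `u` and `v`
(`integral_null_form`, `trilinear_term`). The factor `∂Z` is controlled by `energy_estimate`, the
factor `∂B · W` by the Carleson embedding `carleson_estimate`. The latter needs only that the
Gaussian variance of `b` is bounded at all scales, and it follows from the convexity of
`(W, M) ↦ W² (3 - M + M²/2)`, evaluated at the variance `M`. That the Gaussian variance of a `BMO`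
function is bounded is the John–Nirenberg inequality in `L²` form (`MeanOsc.meanSqOsc`), proved by
dyadic bisection. Mollification and truncation give the estimate for general `b`, uniformly in the
truncation height, for Schwartz functions.

Schwartz functions are dense in `W^{1,2}`: a function orthogonal to all of them is a distributional
solution of `Δp = p`, hence zero. So the form is everywhere the limit of its truncations, it is
bounded by the gradients, and its anti-symmetric part has real part zero on the diagonal; the
ellipticity of `Aˢ` then controls the gradient by the real part of the form
(`IsCoefficient.exists_form_operator`). Comparison of the two bounds gives the sector which
contains the numerical range.

The rest is operator theory for an abstract sectorial form (`IsSectorialForm`). A rotation makes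
the form of `z + L` coercive for `z` in the complementary sector, whence the resolvent, its bounds
and its holomorphy. The semigroup is defined as the contour integral of `e^{zt} (z + L)⁻¹`. Cauchy's
theorem in polar coordinates makes the integral independent of the radius of the arc, and the radius
`1 / t` gives the bounds in `t`. Differentiation under the integral shows that the integral solves
`h' = -Lh`, and the values of the contour integrals of `e^{zt} / z` and `e^{zt}` give the initial
condition. As `L` is accretive, solutions of `h' = -Lh` do not grow in norm; this gives the
semigroup law, the generator (`IsSectorialForm.isC0Semigroup`) and the uniqueness of the semigroup
(`IsC0Semigroup.eq_of_accretive`). By uniqueness one and the same semigroup is represented by the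
contours of all admissible angles.
-/

namespace BMOElliptic

variable {n : ℕ}

/-! ### The Gauss kernel -/

/-- The `k`-th vector of the standard basis of `ℝⁿ`. -/
noncomputable abbrev basisVec (k : Fin n) : E n := EuclideanSpace.single k (1 : ℝ)

/-- The `k`-th partial derivative. -/
noncomputable def pd (k : Fin n) (f : E n → ℝ) (x : E n) : ℝ := fderiv ℝ f x (basisVec k)

/-- The standard Gaussian density on `ℝⁿ`. -/
noncomputable def gauss (z : E n) : ℝ :=
  (2 * Real.pi) ^ (-(n : ℝ) / 2) * Real.exp (-(1 / 2) * ‖z‖ ^ 2)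

lemma gauss_nonneg (z : E n) : 0 ≤ gauss z := by unfold gauss; positivity

lemma contDiff_gauss : ContDiff ℝ ∞ (gauss (n := n)) := by
  unfold gauss
  exact contDiff_const.mul ((contDiff_const.mul (contDiff_norm_sq ℝ)).exp)

lemma continuous_gauss : Continuous (gauss (n := n)) := contDiff_gauss.continuous

lemma integrable_gauss : Integrable (gauss (n := n)) := by
  have h := (GaussianFourier.integrable_cexp_neg_mul_sq_norm_add (V := E n) (b := 1 / 2)
    (by norm_num) 0 0).re
  refine (h.const_mul ((2 * Real.pi) ^ (-(n : ℝ) / 2))).congr (Eventually.of_forall fun z => ?_)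
  simp only [gauss]
  congr 1
  have : (-(1 / 2 : ℂ) * (‖z‖ : ℂ) ^ 2 + 0 * (inner ℝ 0 z : ℝ)) =
      ((-(1 / 2) * ‖z‖ ^ 2 : ℝ) : ℂ) := by push_cast; ring
  change (Complex.exp _).re = _
  rw [this, ← Complex.ofReal_exp, Complex.ofReal_re]

lemma integral_gauss : ∫ z, gauss (n := n) z = 1 := by
  unfold gauss
  rw [integral_const_mul, GaussianFourier.integral_rexp_neg_mul_sq_norm (by norm_num)]
  rw [finrank_euclideanSpace_fin, show Real.pi / (1 / 2) = 2 * Real.pi by ring,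
    ← Real.rpow_add (by positivity), show -(n : ℝ) / 2 + n / 2 = 0 by ring, Real.rpow_zero]

lemma norm_mul_gauss_le (z : E n) :
    ‖z‖ * gauss z ≤ 2 * (2 * Real.pi) ^ (-(n : ℝ) / 2) * Real.exp (-(1 / 4) * ‖z‖ ^ 2) := by
  have h1 : ‖z‖ ≤ 2 * Real.exp (1 / 4 * ‖z‖ ^ 2) := by
    have := Real.add_one_le_exp (1 / 4 * ‖z‖ ^ 2)
    nlinarith [sq_nonneg (‖z‖ - 1)]
  have h2 : gauss z = (2 * Real.pi) ^ (-(n : ℝ) / 2) *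
      (Real.exp (-(1 / 4) * ‖z‖ ^ 2) * Real.exp (-(1 / 4) * ‖z‖ ^ 2)) := by
    rw [← Real.exp_add]; unfold gauss; ring_nf
  have h3 : Real.exp (1 / 4 * ‖z‖ ^ 2) * Real.exp (-(1 / 4) * ‖z‖ ^ 2) = 1 := by
    rw [← Real.exp_add]; ring_nf; exact Real.exp_zero
  rw [h2]
  set a := (2 * Real.pi) ^ (-(n : ℝ) / 2)
  have ha : 0 ≤ a := by positivity
  set w := Real.exp (-(1 / 4) * ‖z‖ ^ 2)
  have hw : 0 ≤ w := by positivity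
  calc ‖z‖ * (a * (w * w)) ≤ (2 * Real.exp (1 / 4 * ‖z‖ ^ 2)) * (a * (w * w)) := by gcongr
    _ = 2 * a * w * (Real.exp (1 / 4 * ‖z‖ ^ 2) * w) := by ring
    _ = _ := by rw [h3]; ring

lemma integrable_norm_mul_gauss : Integrable (fun z : E n => ‖z‖ * gauss z) := by
  have h := (GaussianFourier.integrable_cexp_neg_mul_sq_norm_add (V := E n) (b := 1 / 4)
    (by norm_num) 0 0).norm
  refine (h.const_mul (2 * (2 * Real.pi) ^ (-(n : ℝ) / 2))).mono'
    (by have := continuous_gauss (n := n); fun_prop) (Eventually.of_forall fun z => ?_)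
  rw [Real.norm_of_nonneg (mul_nonneg (norm_nonneg _) (gauss_nonneg _))]
  refine (norm_mul_gauss_le z).trans (le_of_eq ?_)
  congr 1
  have : (-(1 / 4 : ℂ) * (‖z‖ : ℂ) ^ 2 + 0 * (inner ℝ 0 z : ℝ)) =
      ((-(1 / 4) * ‖z‖ ^ 2 : ℝ) : ℂ) := by push_cast; ring
  rw [this, ← Complex.ofReal_exp, Complex.norm_real, Real.norm_of_nonneg (by positivity)]

lemma pd_gauss (k : Fin n) (z : E n) : pd k gauss z = -(z k * gauss z) := by
  have h : HasFDerivAt (gauss (n := n)) _ z :=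
    (((hasStrictFDerivAt_norm_sq z).hasFDerivAt.const_mul (-(1 / 2))).exp).const_mul
      ((2 * Real.pi) ^ (-(n : ℝ) / 2))
  unfold pd
  rw [h.fderiv]
  simp [gauss, EuclideanSpace.inner_single_right]
  ring

lemma abs_apply_le_norm (z : E n) (k : Fin n) : |z k| ≤ ‖z‖ := by
  simpa using PiLp.norm_apply_le z k

lemma apply_eq_sum_basisVec (L : E n →L[ℝ] ℝ) (z : E n) : L z = ∑ k, z k * L (basisVec k) := by
  conv_lhs => rw [← (EuclideanSpace.basisFun (Fin n) ℝ).sum_repr z]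
  simp [map_sum]

/-! ### The heat semigroup -/

/-- A smooth function all of whose partial derivatives of order at most `m` are bounded. -/
def BddDeriv : ℕ → (E n → ℝ) → Prop
  | 0, f => ContDiff ℝ ∞ f ∧ ∃ C, ∀ x, |f x| ≤ C
  | m + 1, f => (ContDiff ℝ ∞ f ∧ ∃ C, ∀ x, |f x| ≤ C) ∧ ∀ k, BddDeriv m (pd k f)

lemma BddDeriv.contDiff {m : ℕ} {f : E n → ℝ} (h : BddDeriv m f) : ContDiff ℝ ∞ f := by
  cases m with
  | zero => exact h.1
  | succ m => exact h.1.1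

lemma BddDeriv.bdd {m : ℕ} {f : E n → ℝ} (h : BddDeriv m f) : ∃ C, ∀ x, |f x| ≤ C := by
  cases m with
  | zero => exact h.2
  | succ m => exact h.1.2

lemma BddDeriv.pd {m : ℕ} {f : E n → ℝ} (h : BddDeriv (m + 1) f) (k : Fin n) :
    BddDeriv m (pd k f) := h.2 k

lemma BddDeriv.pred {m : ℕ} : ∀ {f : E n → ℝ}, BddDeriv (m + 1) f → BddDeriv m f := by
  induction m with
  | zero => intro f h; exact h.1
  | succ m ih => intro f h; exact ⟨h.1, fun k => ih (h.2 k)⟩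

lemma BddDeriv.differentiable {m : ℕ} {f : E n → ℝ} (h : BddDeriv m f) : Differentiable ℝ f :=
  h.contDiff.differentiable (by simp)

lemma BddDeriv.continuous {m : ℕ} {f : E n → ℝ} (h : BddDeriv m f) : Continuous f :=
  h.contDiff.continuous

lemma BddDeriv.add {m : ℕ} : ∀ {f g : E n → ℝ}, BddDeriv m f → BddDeriv m g →
    BddDeriv m (fun x => f x + g x) := by
  have key : ∀ f g : E n → ℝ, (∃ C, ∀ x, |f x| ≤ C) → (∃ C, ∀ x, |g x| ≤ C) →
      ∃ C, ∀ x, |f x + g x| ≤ C := by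
    rintro f g ⟨C, hC⟩ ⟨D, hD⟩
    exact ⟨C + D, fun x => (abs_add_le _ _).trans (add_le_add (hC x) (hD x))⟩
  induction m with
  | zero => intro f g hf hg; exact ⟨hf.1.add hg.1, key f g hf.2 hg.2⟩
  | succ m ih =>
    intro f g hf hg
    refine ⟨⟨hf.1.1.add hg.1.1, key f g hf.1.2 hg.1.2⟩, fun k => ?_⟩
    have : BMOElliptic.pd k (fun x => f x + g x) =
        fun x => BMOElliptic.pd k f x + BMOElliptic.pd k g x := by
      funext x
      simp only [BMOElliptic.pd]
      rw [fderiv_fun_add (hf.differentiable x) (hg.differentiable x)]; rfl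
    rw [this]; exact ih (hf.2 k) (hg.2 k)

lemma pd_mul {f g : E n → ℝ} (hf : Differentiable ℝ f) (hg : Differentiable ℝ g) (k : Fin n) :
    pd k (fun x => f x * g x) = fun x => f x * pd k g x + pd k f x * g x := by
  funext x
  simp only [pd]
  rw [fderiv_fun_mul (hf x) (hg x)]
  simp [mul_comm]

lemma BddDeriv.mul {m : ℕ} : ∀ {f g : E n → ℝ}, BddDeriv m f → BddDeriv m g →
    BddDeriv m (fun x => f x * g x) := by
  have key : ∀ f g : E n → ℝ, (∃ C, ∀ x, |f x| ≤ C) → (∃ C, ∀ x, |g x| ≤ C) →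
      ∃ C, ∀ x, |f x * g x| ≤ C := by
    rintro f g ⟨C, hC⟩ ⟨D, hD⟩
    refine ⟨C * D, fun x => ?_⟩
    rw [abs_mul]
    exact mul_le_mul (hC x) (hD x) (abs_nonneg _) ((abs_nonneg _).trans (hC x))
  induction m with
  | zero => intro f g hf hg; exact ⟨hf.1.mul hg.1, key f g hf.2 hg.2⟩
  | succ m ih =>
    intro f g hf hg
    refine ⟨⟨hf.1.1.mul hg.1.1, key f g hf.1.2 hg.1.2⟩, fun k => ?_⟩
    rw [pd_mul hf.differentiable hg.differentiable]
    exact (ih hf.pred (hg.2 k)).add (ih (hf.2 k) hg.pred)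

/-- The heat semigroup, with the time variable normalised so that
`∂ₜ (heat f t) = t Δ (heat f t)`; at `t = √(2s)` it is `e^{sΔ} f`. -/
noncomputable def heat (f : E n → ℝ) (t : ℝ) (x : E n) : ℝ := ∫ z, gauss z * f (x + t • z)

lemma integrable_gauss_mul {f : E n → ℝ} (hf : Continuous f) {C : ℝ} (hC : ∀ x, |f x| ≤ C) :
    Integrable (fun z => gauss z * f z) :=
  integrable_gauss.mul_bdd (c := C) hf.aestronglyMeasurable (Eventually.of_forall fun z => hC z)

lemma heat_abs_le {f : E n → ℝ} {C : ℝ} (hC : ∀ x, |f x| ≤ C) (t : ℝ) (x : E n) :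
    |heat f t x| ≤ C := by
  have : ‖heat f t x‖ ≤ ∫ z, gauss (n := n) z * C := by
    refine norm_integral_le_of_norm_le (integrable_gauss.mul_const C)
      (Eventually.of_forall fun z => ?_)
    rw [norm_mul, Real.norm_of_nonneg (gauss_nonneg z)]
    exact mul_le_mul_of_nonneg_left (hC _) (gauss_nonneg z)
  rwa [integral_mul_const, integral_gauss, one_mul] at this

lemma continuous_heat {f : E n → ℝ} (hf : Continuous f) {C : ℝ} (hC : ∀ x, |f x| ≤ C) :
    Continuous (fun p : ℝ × E n => heat f p.1 p.2) := by
  refine continuous_of_dominated (bound := fun z => gauss z * C) (fun p => ?_) (fun p => ?_)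
    (integrable_gauss.mul_const C) (Eventually.of_forall fun z => by fun_prop)
  · have := continuous_gauss (n := n)
    exact Continuous.aestronglyMeasurable (by fun_prop)
  · refine Eventually.of_forall fun z => ?_
    rw [norm_mul, Real.norm_of_nonneg (gauss_nonneg z)]
    exact mul_le_mul_of_nonneg_left (hC _) (gauss_nonneg z)

lemma heat_zero {f : E n → ℝ} : heat f 0 = f := by
  funext x
  simp [heat, integral_mul_const, integral_gauss]

lemma hasLineDerivAt_heat {f : E n → ℝ} (hf : BddDeriv 1 f) (t : ℝ) (x : E n) (k : Fin n) :
    HasLineDerivAt ℝ (heat f t) (heat (pd k f) t x) x (basisVec k) := by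
  obtain ⟨C, hC⟩ := hf.bdd
  obtain ⟨D, hD⟩ := (hf.pd k).bdd
  have hc := hf.continuous
  have hc' := (hf.pd k).continuous
  have hg := continuous_gauss (n := n)
  have := hasDerivAt_integral_of_dominated_loc_of_deriv_le (μ := (volume : Measure (E n)))
    (F := fun s z => gauss z * f (x + s • basisVec k + t • z))
    (F' := fun s z => gauss z * pd k f (x + s • basisVec k + t • z)) (x₀ := (0 : ℝ))
    (s := univ) (bound := fun z => gauss z * D) univ_mem
    (Eventually.of_forall fun s => Continuous.aestronglyMeasurable (by fun_prop))
    (integrable_gauss.mul_bdd (c := C) (Continuous.aestronglyMeasurable (by fun_prop))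
      (Eventually.of_forall fun z => hC _))
    (Continuous.aestronglyMeasurable (by fun_prop))
    (Eventually.of_forall fun z s _ => by
      rw [norm_mul, Real.norm_of_nonneg (gauss_nonneg z)]
      exact mul_le_mul_of_nonneg_left (hD _) (gauss_nonneg z))
    (integrable_gauss.mul_const D)
    (Eventually.of_forall fun z s _ => by
      refine HasDerivAt.const_mul _ ?_
      have h1 : HasDerivAt (fun s : ℝ => x + s • basisVec k + t • z) (basisVec k) s := by
        simpa using (((hasDerivAt_id s).smul_const (basisVec k)).const_add x).add_const (t • z)
      exact (hf.differentiable _).hasFDerivAt.comp_hasDerivAt s h1)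
  have h2 := this.2
  simp only [zero_smul, add_zero] at h2
  exact h2

/-- The heat equation; the Laplacian arises from an integration by parts against the Gaussian, whose
gradient is `-z` times itself. -/
lemma hasDerivAt_heat_time {f : E n → ℝ} (hf : BddDeriv 2 f) (t : ℝ) (x : E n) :
    HasDerivAt (fun s => heat f s x) (t * ∑ k, heat (pd k (pd k f)) t x) t := by
  obtain ⟨C, hC⟩ := hf.bdd
  choose D hD using fun k => (hf.pd k).bdd
  have hc := hf.continuous
  have hc' := fun k => (hf.pd k).continuous
  have hg := continuous_gauss (n := n)
  have hz : ∀ k, Continuous fun z : E n => z k := fun k => by fun_prop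
  have hint : ∀ k, Integrable (fun z : E n => z k * gauss z) := fun k =>
    integrable_norm_mul_gauss.mono' (by fun_prop) (Eventually.of_forall fun z => by
      rw [norm_mul, Real.norm_of_nonneg (gauss_nonneg z)]
      exact mul_le_mul_of_nonneg_right (abs_apply_le_norm z k) (gauss_nonneg z))
  have hder := hasDerivAt_integral_of_dominated_loc_of_deriv_le (μ := (volume : Measure (E n)))
    (F := fun s z => gauss z * f (x + s • z))
    (F' := fun s z => gauss z * ∑ k, z k * pd k f (x + s • z)) (x₀ := t)
    (s := univ) (bound := fun z => (‖z‖ * gauss z) * ∑ k, D k) univ_mem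
    (Eventually.of_forall fun s => Continuous.aestronglyMeasurable (by fun_prop))
    (integrable_gauss.mul_bdd (c := C) (Continuous.aestronglyMeasurable (by fun_prop))
      (Eventually.of_forall fun z => hC _))
    (Continuous.aestronglyMeasurable (by fun_prop))
    (Eventually.of_forall fun z s _ => by
      rw [norm_mul, Real.norm_of_nonneg (gauss_nonneg z), mul_comm ‖z‖, mul_assoc,
        Finset.mul_sum]
      refine mul_le_mul_of_nonneg_left ?_ (gauss_nonneg z)
      refine (norm_sum_le _ _).trans (Finset.sum_le_sum fun k _ => ?_)
      rw [norm_mul]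
      exact mul_le_mul (abs_apply_le_norm z k) (hD k _) (norm_nonneg _) (norm_nonneg _))
    (integrable_norm_mul_gauss.mul_const _)
    (Eventually.of_forall fun z s _ => by
      refine HasDerivAt.const_mul _ ?_
      have h1 : HasDerivAt (fun s : ℝ => x + s • z) z s := by
        simpa using ((hasDerivAt_id s).smul_const z).const_add x
      have h2 := (hf.differentiable _).hasFDerivAt.comp_hasDerivAt s h1
      refine h2.congr_deriv ?_
      exact apply_eq_sum_basisVec _ z)
  refine hder.2.congr_deriv ?_
  -- Gaussian integration by parts in each coordinate
  have hibp : ∀ k, ∫ z, z k * gauss z * pd k f (x + t • z) = t * heat (pd k (pd k f)) t x := by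
    intro k
    obtain ⟨D2, hD2⟩ := ((hf.pd k).pd k).bdd
    have hc2 := ((hf.pd k).pd k).continuous
    have hsh : ∀ z, HasFDerivAt (fun z : E n => pd k f (x + t • z))
        ((fderiv ℝ (pd k f) (x + t • z)).comp (t • ContinuousLinearMap.id ℝ (E n))) z := by
      intro z
      refine ((hf.pd k).differentiable _).hasFDerivAt.comp z ?_
      exact (((hasFDerivAt_id z).const_smul t).const_add x)
    have hpd : ∀ z, fderiv ℝ (fun z : E n => pd k f (x + t • z)) z (basisVec k) =
        t * pd k (pd k f) (x + t • z) := by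
      intro z; rw [(hsh z).fderiv]; simp [pd]
    have hgd : ∀ z, fderiv ℝ (gauss (n := n)) z (basisVec k) = -(z k * gauss z) :=
      fun z => pd_gauss k z
    have := integral_mul_fderiv_eq_neg_fderiv_mul_of_integrable (𝕜 := ℝ)
      (μ := (volume : Measure (E n))) (f := gauss) (g := fun z => pd k f (x + t • z))
      (v := basisVec k)
      (by
        simp only [hgd]
        exact (hint k).neg.mul_bdd (c := D k) (Continuous.aestronglyMeasurable (by fun_prop))
          (Eventually.of_forall fun z => hD k _))
      (by
        simp only [hpd]
        refine integrable_gauss.mul_bdd (c := |t| * D2)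
          (Continuous.aestronglyMeasurable (by fun_prop)) (Eventually.of_forall fun z => ?_)
        rw [norm_mul]
        exact mul_le_mul_of_nonneg_left (hD2 _) (abs_nonneg _))
      (integrable_gauss.mul_bdd (c := D k) (Continuous.aestronglyMeasurable (by fun_prop))
          (Eventually.of_forall fun z => hD k _))
      (fun z _ => (contDiff_gauss.differentiable (by simp)) z)
      (fun z _ => (hsh z).differentiableAt)
    simp only [hpd, hgd] at this
    have h3 : ∫ z, z k * gauss z * pd k f (x + t • z) =
        ∫ z, gauss z * (t * pd k (pd k f) (x + t • z)) := by
      rw [this, ← integral_neg]; congr 1; funext z; ring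
    rw [h3, heat, ← integral_const_mul]; congr 1; funext z; ring
  rw [Finset.mul_sum]
  simp_rw [← hibp, Finset.mul_sum]
  rw [integral_finsetSum]
  · refine Finset.sum_congr rfl fun k _ => ?_
    congr 1; funext z; ring
  · intro k _
    have := (hint k).mul_bdd (c := D k) (g := fun z => pd k f (x + t • z))
      (Continuous.aestronglyMeasurable (by fun_prop)) (Eventually.of_forall fun z => hD k _)
    exact this.congr (Eventually.of_forall fun z => by ring)

/-! ### Parabolic calculus -/

/-- A bounded continuous function of time and space. -/
def BddCont (Φ : ℝ → E n → ℝ) : Prop :=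
  Continuous (fun p : ℝ × E n => Φ p.1 p.2) ∧ ∃ C, ∀ t x, |Φ t x| ≤ C

/-- A continuous function of time and space which is integrable in space, uniformly in time. -/
def UnifInt (Φ : ℝ → E n → ℝ) : Prop :=
  Continuous (fun p : ℝ × E n => Φ p.1 p.2) ∧ ∃ C, ∀ t, Integrable (Φ t) ∧ ∫ x, |Φ t x| ≤ C

lemma BddCont.const (c : ℝ) : BddCont (n := n) (fun _ _ => c) :=
  ⟨continuous_const, |c|, fun _ _ => le_rfl⟩

lemma BddCont.add {Φ Ψ : ℝ → E n → ℝ} (h : BddCont Φ) (h' : BddCont Ψ) :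
    BddCont (fun t x => Φ t x + Ψ t x) := by
  obtain ⟨c, C, hC⟩ := h
  obtain ⟨d, D, hD⟩ := h'
  exact ⟨c.add d, C + D, fun t x => (abs_add_le _ _).trans (add_le_add (hC t x) (hD t x))⟩

lemma BddCont.mul {Φ Ψ : ℝ → E n → ℝ} (h : BddCont Φ) (h' : BddCont Ψ) :
    BddCont (fun t x => Φ t x * Ψ t x) := by
  obtain ⟨c, C, hC⟩ := h
  obtain ⟨d, D, hD⟩ := h'
  refine ⟨c.mul d, C * D, fun t x => ?_⟩
  rw [abs_mul]
  exact mul_le_mul (hC t x) (hD t x) (abs_nonneg _) ((abs_nonneg _).trans (hC t x))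

lemma BddCont.const_mul {Φ : ℝ → E n → ℝ} (a : ℝ) (h : BddCont Φ) :
    BddCont (fun t x => a * Φ t x) := (BddCont.const a).mul h

lemma BddCont.sum {ι : Type*} (s : Finset ι) {Φ : ι → ℝ → E n → ℝ} (h : ∀ i, BddCont (Φ i)) :
    BddCont (fun t x => ∑ i ∈ s, Φ i t x) := by
  choose c C hC using h
  exact ⟨continuous_finsetSum _ fun i _ => c i, ∑ i ∈ s, C i, fun t x =>
    (Finset.abs_sum_le_sum_abs _ _).trans (Finset.sum_le_sum fun i _ => hC i t x)⟩

lemma UnifInt.add {Φ Ψ : ℝ → E n → ℝ} (h : UnifInt Φ) (h' : UnifInt Ψ) :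
    UnifInt (fun t x => Φ t x + Ψ t x) := by
  obtain ⟨c, C, hC⟩ := h
  obtain ⟨d, D, hD⟩ := h'
  refine ⟨c.add d, C + D, fun t => ⟨(hC t).1.add (hD t).1, ?_⟩⟩
  calc ∫ x, |Φ t x + Ψ t x| ≤ ∫ x, (|Φ t x| + |Ψ t x|) :=
        integral_mono ((hC t).1.add (hD t).1).abs ((hC t).1.abs.add (hD t).1.abs)
          fun x => abs_add_le _ _
    _ = (∫ x, |Φ t x|) + ∫ x, |Ψ t x| := integral_add (hC t).1.abs (hD t).1.abs
    _ ≤ _ := add_le_add (hC t).2 (hD t).2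

lemma UnifInt.mul_bdd {Φ Ψ : ℝ → E n → ℝ} (h : UnifInt Φ) (h' : BddCont Ψ) :
    UnifInt (fun t x => Φ t x * Ψ t x) := by
  obtain ⟨c, C, hC⟩ := h
  obtain ⟨d, D, hD⟩ := h'
  have hi : ∀ t, Integrable (fun x => Φ t x * Ψ t x) := fun t =>
    (hC t).1.mul_bdd (c := D) (d.comp (Continuous.prodMk_right t)).aestronglyMeasurable
      (Eventually.of_forall fun x => hD t x)
  have hD0 : 0 ≤ D := (abs_nonneg _).trans (hD 0 0)
  refine ⟨c.mul d, C * D, fun t => ⟨hi t, ?_⟩⟩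
  calc ∫ x, |Φ t x * Ψ t x| ≤ ∫ x, |Φ t x| * D :=
        integral_mono (hi t).abs ((hC t).1.abs.mul_const D) fun x => by
          simp only [abs_mul]
          exact mul_le_mul_of_nonneg_left (hD t x) (abs_nonneg _)
    _ = (∫ x, |Φ t x|) * D := integral_mul_const _ _
    _ ≤ _ := mul_le_mul_of_nonneg_right (hC t).2 hD0

lemma UnifInt.bdd_mul {Φ Ψ : ℝ → E n → ℝ} (h : BddCont Φ) (h' : UnifInt Ψ) :
    UnifInt (fun t x => Φ t x * Ψ t x) := by
  simpa only [mul_comm] using h'.mul_bdd h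

lemma UnifInt.const_mul {Φ : ℝ → E n → ℝ} (a : ℝ) (h : UnifInt Φ) :
    UnifInt (fun t x => a * Φ t x) := UnifInt.bdd_mul (BddCont.const a) h

lemma UnifInt.zero : UnifInt (n := n) (fun _ _ => 0) :=
  ⟨continuous_const, 0, fun _ => ⟨integrable_zero _ _ _, by simp⟩⟩

lemma UnifInt.sum {ι : Type*} (s : Finset ι) {Φ : ι → ℝ → E n → ℝ} (h : ∀ i, UnifInt (Φ i)) :
    UnifInt (fun t x => ∑ i ∈ s, Φ i t x) := by
  classical
  induction s using Finset.induction_on with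
  | empty => simpa using UnifInt.zero
  | insert i s hi ih =>
    simp only [Finset.sum_insert hi]
    exact (h i).add ih

lemma UnifInt.integrable {Φ : ℝ → E n → ℝ} (h : UnifInt Φ) (t : ℝ) : Integrable (Φ t) :=
  (h.2.choose_spec t).1

lemma UnifInt.integrable_prod {Φ : ℝ → E n → ℝ} (h : UnifInt Φ) (T : ℝ) :
    Integrable (fun p : ℝ × E n => p.1 * Φ p.1 p.2)
      ((volume.restrict (Ioc 0 T)).prod volume) := by
  obtain ⟨c, C, hC⟩ := h
  have hm : AEStronglyMeasurable (fun p : ℝ × E n => p.1 * Φ p.1 p.2)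
      ((volume.restrict (Ioc 0 T)).prod volume) :=
    (continuous_fst.mul c).aestronglyMeasurable
  rw [integrable_prod_iff hm]
  refine ⟨Eventually.of_forall fun t => (hC t).1.const_mul t, ?_⟩
  refine (integrable_const (|T| * C)).mono' hm.norm.integral_prod_right' ?_
  filter_upwards [ae_restrict_mem measurableSet_Ioc] with t ht
  simp only [norm_mul, integral_const_mul, Real.norm_eq_abs, abs_abs]
  rw [abs_of_nonneg (integral_nonneg fun _ => abs_nonneg _)]
  have : |t| ≤ |T| := by
    rw [abs_of_pos ht.1]; exact ht.2.trans (le_abs_self T)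
  exact mul_le_mul this (hC t).2 (integral_nonneg fun _ => abs_nonneg _) (abs_nonneg _)

lemma UnifInt.intervalIntegrable {Φ : ℝ → E n → ℝ} (h : UnifInt Φ) {T : ℝ} (hT : 0 ≤ T) :
    IntervalIntegrable (fun t => t * ∫ x, Φ t x) volume 0 T := by
  rw [intervalIntegrable_iff_integrableOn_Ioc_of_le hT]
  have := (h.integrable_prod T).integral_prod_left
  simp only [integral_const_mul] at this
  exact this

lemma integral_lineDeriv_mul {f f' g g' : E n → ℝ} {v : E n}
    (hf'g : Integrable fun x => f' x * g x) (hfg' : Integrable fun x => f x * g' x)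
    (hfg : Integrable fun x => f x * g x) (hf : ∀ x, HasLineDerivAt ℝ f (f' x) x v)
    (hg : ∀ x, HasLineDerivAt ℝ g (g' x) x v) :
    ∫ x, f x * g' x = -∫ x, f' x * g x :=
  integral_bilinear_hasLineDerivAt_right_eq_neg_left_of_integrable
    (B := ContinuousLinearMap.mul ℝ ℝ) hf'g hfg' hfg (fun x _ => hf x) (fun x _ => hg x)

lemma integral_lineDeriv_eq_zero {g g' : E n → ℝ} {v : E n} (hg' : Integrable g')
    (hg : Integrable g) (h : ∀ x, HasLineDerivAt ℝ g (g' x) x v) : ∫ x, g' x = 0 := by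
  have := integral_lineDeriv_mul (f := fun _ => 1) (f' := fun _ => 0) (g := g) (g' := g') (v := v)
    (by simp) (by simpa using hg') (by simpa using hg)
    (fun x => by simpa [HasLineDerivAt] using hasDerivAt_const (0 : ℝ) (1 : ℝ)) h
  simpa using this

/-- A bounded function `val` of time and space together with its first partial derivatives `d`,
its pure second partial derivatives `dd` and its defect `src` from being a solution of the
heat equation: `∂ₜ val = t (Δ val - src)`. -/
structure Jet (n : ℕ) where
  val : ℝ → E n → ℝ
  d : Fin n → ℝ → E n → ℝ
  dd : Fin n → ℝ → E n → ℝ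
  src : ℝ → E n → ℝ
  bddCont_val : BddCont val
  bddCont_d : ∀ k, BddCont (d k)
  bddCont_dd : ∀ k, BddCont (dd k)
  bddCont_src : BddCont src
  hasLineDerivAt_val : ∀ t x k, HasLineDerivAt ℝ (val t) (d k t x) x (basisVec k)
  hasLineDerivAt_d : ∀ t x k, HasLineDerivAt ℝ (d k t) (dd k t x) x (basisVec k)
  hasDerivAt_time : ∀ t x, HasDerivAt (fun s => val s x) (t * (∑ k, dd k t x - src t x)) t

namespace Jet

/-- All components of the jet are integrable in space, uniformly in time. -/
structure Int (J : Jet n) : Prop where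
  val : UnifInt J.val
  d : ∀ k, UnifInt (J.d k)
  dd : ∀ k, UnifInt (J.dd k)
  src : UnifInt J.src

/-- Constant functions. -/
def const (n : ℕ) (c : ℝ) : Jet n where
  val _ _ := c
  d _ _ _ := 0
  dd _ _ _ := 0
  src _ _ := 0
  bddCont_val := BddCont.const c
  bddCont_d _ := BddCont.const 0
  bddCont_dd _ := BddCont.const 0
  bddCont_src := BddCont.const 0
  hasLineDerivAt_val _ _ _ := hasDerivAt_const _ _
  hasLineDerivAt_d _ _ _ := hasDerivAt_const _ _
  hasDerivAt_time t x := by simpa using hasDerivAt_const t c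

/-- The sum of two jets. -/
def add (J K : Jet n) : Jet n where
  val t x := J.val t x + K.val t x
  d k t x := J.d k t x + K.d k t x
  dd k t x := J.dd k t x + K.dd k t x
  src t x := J.src t x + K.src t x
  bddCont_val := J.bddCont_val.add K.bddCont_val
  bddCont_d k := (J.bddCont_d k).add (K.bddCont_d k)
  bddCont_dd k := (J.bddCont_dd k).add (K.bddCont_dd k)
  bddCont_src := J.bddCont_src.add K.bddCont_src
  hasLineDerivAt_val t x k := (J.hasLineDerivAt_val t x k).add (K.hasLineDerivAt_val t x k)
  hasLineDerivAt_d t x k := (J.hasLineDerivAt_d t x k).add (K.hasLineDerivAt_d t x k)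
  hasDerivAt_time t x := by
    refine ((J.hasDerivAt_time t x).add (K.hasDerivAt_time t x)).congr_deriv ?_
    rw [Finset.sum_add_distrib]; ring

lemma _root_.HasLineDerivAt.mul_real {f g : E n → ℝ} {f' g' : ℝ} {x v : E n}
    (hf : HasLineDerivAt ℝ f f' x v) (hg : HasLineDerivAt ℝ g g' x v) :
    HasLineDerivAt ℝ (fun y => f y * g y) (f' * g x + f x * g') x v := by
  have := HasDerivAt.mul hf hg
  simp only [zero_smul, add_zero] at this
  exact this

/-- The product of two jets; the defect obeys
`src (J K) = src J · K + J · src K + 2 ∇J · ∇K`. -/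
def mul (J K : Jet n) : Jet n where
  val t x := J.val t x * K.val t x
  d k t x := J.d k t x * K.val t x + J.val t x * K.d k t x
  dd k t x := J.dd k t x * K.val t x + 2 * (J.d k t x * K.d k t x) + J.val t x * K.dd k t x
  src t x := J.src t x * K.val t x + J.val t x * K.src t x + 2 * ∑ k, J.d k t x * K.d k t x
  bddCont_val := J.bddCont_val.mul K.bddCont_val
  bddCont_d k := ((J.bddCont_d k).mul K.bddCont_val).add (J.bddCont_val.mul (K.bddCont_d k))
  bddCont_dd k := (((J.bddCont_dd k).mul K.bddCont_val).add
    (((J.bddCont_d k).mul (K.bddCont_d k)).const_mul 2)).add (J.bddCont_val.mul (K.bddCont_dd k))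
  bddCont_src := ((J.bddCont_src.mul K.bddCont_val).add (J.bddCont_val.mul K.bddCont_src)).add
    ((BddCont.sum _ fun k => (J.bddCont_d k).mul (K.bddCont_d k)).const_mul 2)
  hasLineDerivAt_val t x k := (J.hasLineDerivAt_val t x k).mul_real (K.hasLineDerivAt_val t x k)
  hasLineDerivAt_d t x k := by
    have h := ((J.hasLineDerivAt_d t x k).mul_real (K.hasLineDerivAt_val t x k)).add
      ((J.hasLineDerivAt_val t x k).mul_real (K.hasLineDerivAt_d t x k))
    refine HasDerivAt.congr_deriv h ?_
    ring
  hasDerivAt_time t x := by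
    refine ((J.hasDerivAt_time t x).mul (K.hasDerivAt_time t x)).congr_deriv ?_
    simp only [Finset.sum_add_distrib, ← Finset.mul_sum, ← Finset.sum_mul]
    ring

lemma Int.add {J K : Jet n} (hJ : J.Int) (hK : K.Int) : (J.add K).Int where
  val := hJ.val.add hK.val
  d k := (hJ.d k).add (hK.d k)
  dd k := (hJ.dd k).add (hK.dd k)
  src := hJ.src.add hK.src

lemma Int.mul {J K : Jet n} (hJ : J.Int) : (J.mul K).Int where
  val := hJ.val.mul_bdd K.bddCont_val
  d k := ((hJ.d k).mul_bdd K.bddCont_val).add (hJ.val.mul_bdd (K.bddCont_d k))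
  dd k := (((hJ.dd k).mul_bdd K.bddCont_val).add (((hJ.d k).mul_bdd (K.bddCont_d k)).const_mul 2)).add
    (hJ.val.mul_bdd (K.bddCont_dd k))
  src := ((hJ.src.mul_bdd K.bddCont_val).add (hJ.val.mul_bdd K.bddCont_src)).add
    ((UnifInt.sum _ fun k => (hJ.d k).mul_bdd (K.bddCont_d k)).const_mul 2)

/-- The integrated form of `∂ₜ val = t (Δ val - src)`: the Laplacian integrates to zero. -/
theorem evolution {J : Jet n} (hJ : J.Int) {T : ℝ} (hT : 0 ≤ T) :
    (∫ x, J.val 0 x) - ∫ x, J.val T x = ∫ t in 0..T, t * ∫ x, J.src t x := by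
  have hslice : ∀ {Φ : ℝ → E n → ℝ}, BddCont Φ → ∀ x, Continuous fun t => Φ t x :=
    fun h x => h.1.comp (Continuous.prodMk_left x)
  have hsum : UnifInt fun t x => ∑ k, J.dd k t x - J.src t x := by
    simpa only [sub_eq_add_neg, neg_mul, one_mul] using
      (UnifInt.sum Finset.univ hJ.dd).add (hJ.src.const_mul (-1))
  have hftc : ∀ x, J.val T x - J.val 0 x =
      ∫ t in Ioc 0 T, t * (∑ k, J.dd k t x - J.src t x) := by
    intro x
    rw [← intervalIntegral.integral_of_le hT, intervalIntegral.integral_eq_sub_of_hasDerivAt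
      (fun t _ => J.hasDerivAt_time t x)]
    refine Continuous.intervalIntegrable ?_ _ _
    exact continuous_id.mul ((continuous_finsetSum _ fun k _ => hslice (J.bddCont_dd k) x).sub
      (hslice J.bddCont_src x))
  have hdd : ∀ t k, ∫ x, J.dd k t x = 0 := fun t k =>
    integral_lineDeriv_eq_zero ((hJ.dd k).integrable t) ((hJ.d k).integrable t)
      fun x => J.hasLineDerivAt_d t x k
  have hswap := integral_integral_swap (f := fun (t : ℝ) (x : E n) =>
    t * (∑ k, J.dd k t x - J.src t x)) (hsum.integrable_prod T)
  have h1 : (∫ x, J.val T x) - ∫ x, J.val 0 x =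
      ∫ t in Ioc 0 T, ∫ x, t * (∑ k, J.dd k t x - J.src t x) := by
    rw [hswap, ← integral_sub (hJ.val.integrable T) (hJ.val.integrable 0)]
    exact integral_congr_ae (Eventually.of_forall hftc)
  have h2 : ∀ t, ∫ x, t * (∑ k, J.dd k t x - J.src t x) = -(t * ∫ x, J.src t x) := by
    intro t
    rw [integral_const_mul, integral_sub (integrable_finsetSum _ fun k _ => (hJ.dd k).integrable t)
      (hJ.src.integrable t), integral_finsetSum _ fun k _ => (hJ.dd k).integrable t]
    simp [hdd]
  simp only [h2, integral_neg] at h1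
  rw [intervalIntegral.integral_of_le hT]
  linarith

/-- The heat extension of a function. -/
noncomputable def heat (f : E n → ℝ) (hf : BddDeriv 2 f) : Jet n where
  val := BMOElliptic.heat f
  d k := BMOElliptic.heat (pd k f)
  dd k := BMOElliptic.heat (pd k (pd k f))
  src _ _ := 0
  bddCont_val := by
    obtain ⟨C, hC⟩ := hf.bdd
    exact ⟨continuous_heat hf.continuous hC, C, fun t x => heat_abs_le hC t x⟩
  bddCont_d k := by
    obtain ⟨C, hC⟩ := (hf.pd k).bdd
    exact ⟨continuous_heat (hf.pd k).continuous hC, C, fun t x => heat_abs_le hC t x⟩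
  bddCont_dd k := by
    obtain ⟨C, hC⟩ := ((hf.pd k).pd k).bdd
    exact ⟨continuous_heat ((hf.pd k).pd k).continuous hC, C, fun t x => heat_abs_le hC t x⟩
  bddCont_src := BddCont.const 0
  hasLineDerivAt_val t x k := hasLineDerivAt_heat hf.pred t x k
  hasLineDerivAt_d t x k := hasLineDerivAt_heat (hf.pd k) t x k
  hasDerivAt_time t x := by simpa using hasDerivAt_heat_time hf t x

end Jet

lemma unifInt_heat {f : E n → ℝ} (hf : Integrable f) (hc : Continuous f) {C : ℝ}
    (hC : ∀ x, |f x| ≤ C) : UnifInt (heat f) := by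
  refine ⟨continuous_heat hc hC, ∫ x, |f x|, fun t => ?_⟩
  have hg := continuous_gauss (n := n)
  have hprod : Integrable (fun p : E n × E n => gauss p.2 * f (p.1 + t • p.2))
      (volume.prod volume) := by
    rw [integrable_prod_iff' (Continuous.aestronglyMeasurable (by fun_prop))]
    refine ⟨Eventually.of_forall fun z => (hf.comp_add_right (t • z)).const_mul (gauss z), ?_⟩
    simp only [norm_mul, integral_const_mul]
    simp only [integral_add_right_eq_self (fun x => ‖f x‖)]
    exact integrable_gauss.norm.mul_const _
  have h1 : Integrable (heat f t) := hprod.integral_prod_left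
  refine ⟨h1, ?_⟩
  have hprod' := hprod.norm
  calc ∫ x, |heat f t x| ≤ ∫ x, ∫ z, ‖gauss z * f (x + t • z)‖ :=
        integral_mono h1.abs hprod'.integral_prod_left fun x =>
          norm_integral_le_integral_norm fun z => gauss z * f (x + t • z)
    _ = ∫ z, ∫ x, ‖gauss z * f (x + t • z)‖ :=
        integral_integral_swap (f := fun x z => ‖gauss z * f (x + t • z)‖) hprod'
    _ = ∫ z, gauss z * ∫ x, |f x| := by
        congr 1; funext z
        simp only [norm_mul, integral_const_mul, Real.norm_eq_abs, abs_of_nonneg (gauss_nonneg z)]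
        rw [integral_add_right_eq_self (fun x => |f x|)]
    _ = ∫ x, |f x| := by rw [integral_mul_const, integral_gauss, one_mul]

lemma Jet.Int.heat {f : E n → ℝ} {hf : BddDeriv 2 f} (h0 : Integrable f)
    (h1 : ∀ k, Integrable (pd k f)) (h2 : ∀ k, Integrable (pd k (pd k f))) :
    (Jet.heat f hf).Int where
  val := unifInt_heat h0 hf.continuous hf.bdd.choose_spec
  d k := unifInt_heat (h1 k) (hf.pd k).continuous (hf.pd k).bdd.choose_spec
  dd k := unifInt_heat (h2 k) ((hf.pd k).pd k).continuous ((hf.pd k).pd k).bdd.choose_spec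
  src := UnifInt.zero

lemma pd_comm {f : E n → ℝ} (hf : ContDiff ℝ ∞ f) (j k : Fin n) :
    pd j (pd k f) = pd k (pd j f) := by
  funext x
  have hd : Differentiable ℝ (fderiv ℝ f) :=
    (hf.fderiv_right (m := 1) (by norm_cast)).differentiable (by simp)
  have key : ∀ a b : Fin n, pd a (pd b f) x =
      fderiv ℝ (fderiv ℝ f) x (basisVec a) (basisVec b) := by
    intro a b
    have : pd b f = fun y => fderiv ℝ f y (basisVec b) := rfl
    rw [this, pd, fderiv_clm_apply (hd x) (differentiableAt_const _)]
    simp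
  rw [key, key]
  exact (hf.contDiffAt.isSymmSndFDerivAt
    (by simpa using WithTop.coe_le_coe.2 (le_top : (2 : ℕ∞) ≤ ⊤))) _ _

lemma bddDeriv_schwartz (m : ℕ) : ∀ φ : 𝓢(E n, ℝ), BddDeriv m φ := by
  have h0 : ∀ φ : 𝓢(E n, ℝ), ContDiff ℝ ∞ φ ∧ ∃ C, ∀ x, |φ x| ≤ C := fun φ =>
    ⟨φ.smooth', _, fun x => φ.norm_le_seminorm ℝ x⟩
  induction m with
  | zero => exact h0
  | succ m ih => exact fun φ => ⟨h0 φ, fun k => ih (∂_{basisVec k} φ)⟩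

/-- The heat extension of a Schwartz function. -/
noncomputable def heatJet (φ : 𝓢(E n, ℝ)) : Jet n := Jet.heat φ (bddDeriv_schwartz 2 φ)

lemma heatJet_int (φ : 𝓢(E n, ℝ)) : (heatJet φ).Int :=
  Jet.Int.heat φ.integrable (fun k => (∂_{basisVec k} φ).integrable)
    (fun k => (∂_{basisVec k} (∂_{basisVec k} φ)).integrable)

/-! ### Square function and Carleson estimates -/

lemma intervalIntegral_mul_integral_mono {Φ Ψ : ℝ → E n → ℝ} (hΦ : UnifInt Φ) (hΨ : UnifInt Ψ)
    {T : ℝ} (hT : 0 ≤ T) (h : ∀ t, 0 ≤ t → ∀ x, Φ t x ≤ Ψ t x) :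
    ∫ t in 0..T, t * ∫ x, Φ t x ≤ ∫ t in 0..T, t * ∫ x, Ψ t x := by
  refine intervalIntegral.integral_mono_on hT (hΦ.intervalIntegrable hT)
    (hΨ.intervalIntegrable hT) fun t ht => ?_
  exact mul_le_mul_of_nonneg_left
    (integral_mono (hΦ.integrable t) (hΨ.integrable t) (h t ht.1)) ht.1

/-- The energy estimate `∫₀ᵀ t ∫ |∂ₖW|² ≤ ½ ∫ w²` for the heat extension `W` of `w`. -/
lemma energy_estimate (w : 𝓢(E n, ℝ)) (k : Fin n) {T : ℝ} (hT : 0 ≤ T) :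
    ∫ t in 0..T, t * ∫ x, (heatJet w).d k t x ^ 2 ≤ (1 / 2) * ∫ x, w x ^ 2 := by
  set W := heatJet w
  have hW : W.Int := heatJet_int w
  have hWW : (W.mul W).Int := hW.mul
  have hd2 : UnifInt fun t x => W.d k t x ^ 2 := by
    simpa only [sq] using (hW.d k).mul_bdd (W.bddCont_d k)
  have h1 := Jet.evolution hWW hT
  have h2 : 0 ≤ ∫ x, (W.mul W).val T x := integral_nonneg fun x => mul_self_nonneg _
  have h3 : ∫ x, (W.mul W).val 0 x = ∫ x, w x ^ 2 := by
    congr 1; funext x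
    simp [W, Jet.mul, heatJet, Jet.heat, heat_zero, sq]
  have h4 := intervalIntegral_mul_integral_mono (hd2.const_mul 2) hWW.src hT (fun t _ x => by
    have : (W.mul W).src t x = 2 * ∑ k, W.d k t x ^ 2 := by
      simp [W, Jet.mul, heatJet, Jet.heat, sq]
    rw [this]
    exact mul_le_mul_of_nonneg_left (Finset.single_le_sum
      (f := fun k => W.d k t x ^ 2) (fun i _ => sq_nonneg _) (Finset.mem_univ k)) zero_le_two)
  have h5 : ∫ t in 0..T, t * ∫ x, 2 * W.d k t x ^ 2 = 2 * ∫ t in 0..T, t * ∫ x, W.d k t x ^ 2 := by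
    rw [← intervalIntegral.integral_const_mul]
    congr 1; funext t; rw [integral_const_mul]; ring
  rw [h5] at h4
  linarith

lemma gaussian_variance {f : E n → ℝ} (hc : Continuous f) {C : ℝ} (hC : ∀ x, |f x| ≤ C) (t : ℝ)
    (x : E n) (c : ℝ) : ∫ z, gauss z * (f (x + t • z) - c) ^ 2 =
      heat (fun x => f x * f x) t x - heat f t x ^ 2 + (heat f t x - c) ^ 2 := by
  have h1 : Integrable fun z => gauss z * f (x + t • z) :=
    integrable_gauss_mul (f := fun z => f (x + t • z)) (by fun_prop) (fun z => hC _)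
  have h2 : Integrable fun z => gauss z * (f (x + t • z) * f (x + t • z)) :=
    integrable_gauss_mul (f := fun z => f (x + t • z) * f (x + t • z)) (C := C * C) (by fun_prop)
      (fun z => by
        rw [abs_mul]
        exact mul_le_mul (hC _) (hC _) (abs_nonneg _) ((abs_nonneg _).trans (hC x)))
  have : ∀ z, gauss z * (f (x + t • z) - c) ^ 2 = gauss z * (f (x + t • z) * f (x + t • z)) -
      2 * c * (gauss z * f (x + t • z)) + c ^ 2 * gauss z := fun z => by ring
  simp_rw [this]
  have h3 : Integrable fun z => gauss z * (f (x + t • z) * f (x + t • z)) -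
      2 * c * (gauss z * f (x + t • z)) := h2.sub (h1.const_mul _)
  rw [integral_add h3 (integrable_gauss.const_mul _),
    integral_sub h2 (h1.const_mul _), integral_const_mul, integral_const_mul, integral_gauss]
  unfold heat
  ring

/-- The Gaussian variance of `f` at scale `t` around `x`, that is `P(f²) - (P f)²`, is at most
`K`. This is the Garsia form of the condition `f ∈ BMO`. -/
def GarsiaBound (f : E n → ℝ) (K : ℝ) : Prop :=
  ∀ t, 0 ≤ t → ∀ x, heat (fun x => f x * f x) t x - heat f t x ^ 2 ≤ K

/-- The Carleson embedding for the measure `t |∇B|² dt dx`, where `B` is the heat extension of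
`b ∈ BMO`. With `M = P(b²) - B²`, which is a bounded supersolution, `∂ₜM = t (ΔM + 2|∇B|²)`, the
function `Φ = W² (3 - M + M²/2)` has defect at least `W² |∇B|²`, because
`(W, M) ↦ W² (3 - M + M²/2)` is convex for `0 ≤ M ≤ 1/2`. -/
lemma carleson_estimate {b : E n → ℝ} (hb : BddDeriv 2 b) (hG : GarsiaBound b (1 / 2))
    (w : 𝓢(E n, ℝ)) (k : Fin n) {T : ℝ} (hT : 0 ≤ T) :
    ∫ t in 0..T, t * ∫ x, ((heatJet w).val t x ^ 2 * (Jet.heat b hb).d k t x ^ 2) ≤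
      3 * ∫ x, w x ^ 2 := by
  set W := heatJet w with hWdef
  set B := Jet.heat b hb with hBdef
  set Q := Jet.heat (fun x => b x * b x) (hb.mul hb) with hQdef
  have hW : W.Int := heatJet_int w
  set M : Jet n := Q.add ((Jet.const n (-1)).mul (B.mul B)) with hM
  set q : Jet n := (Jet.const n 3).add (((Jet.const n (-1)).mul M).add
    ((Jet.const n (1 / 2)).mul (M.mul M))) with hq
  set Φ : Jet n := (W.mul W).mul q with hΦ
  have hΦi : Φ.Int := hW.mul.mul
  have hMval : ∀ t x, M.val t x = heat (fun x => b x * b x) t x - heat b t x ^ 2 := fun t x => by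
    simp [hM, hQdef, hBdef, Jet.add, Jet.mul, Jet.const, Jet.heat, sq, sub_eq_add_neg]
  have hM1 : ∀ t, 0 ≤ t → ∀ x, M.val t x ≤ 1 / 2 := fun t ht x => by
    rw [hMval]; exact hG t ht x
  have hM0 : ∀ t x, 0 ≤ M.val t x := fun t x => by
    rw [hMval]
    obtain ⟨C, hC⟩ := hb.bdd
    have := gaussian_variance hb.continuous hC t x (heat b t x)
    have h0 : 0 ≤ ∫ z, gauss z * (b (x + t • z) - heat b t x) ^ 2 :=
      integral_nonneg fun z => mul_nonneg (gauss_nonneg z) (sq_nonneg _)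
    rw [this] at h0
    linarith [sq_nonneg (heat b t x - heat b t x), sub_self (heat b t x),
      show (heat b t x - heat b t x) ^ 2 = 0 by rw [sub_self]; ring]
  have hMsrc : ∀ t x, M.src t x = -(2 * ∑ k, B.d k t x ^ 2) := fun t x => by
    simp [hM, hQdef, hBdef, Jet.add, Jet.mul, Jet.const, Jet.heat, sq]
  have hqval : ∀ t x, q.val t x = 3 - M.val t x + M.val t x ^ 2 / 2 := fun t x => by
    simp only [hq, Jet.add, Jet.mul, Jet.const]; ring
  have hqd : ∀ k t x, q.d k t x = -M.d k t x + M.val t x * M.d k t x := fun k t x => by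
    simp only [hq, Jet.add, Jet.mul, Jet.const]; ring
  have hqsrc : ∀ t x, q.src t x = 2 * (1 - M.val t x) * ∑ k, B.d k t x ^ 2 +
      ∑ k, M.d k t x ^ 2 := fun t x => by
    have : q.src t x = -M.src t x + M.val t x * M.src t x + ∑ k, M.d k t x ^ 2 := by
      simp only [hq, Jet.add, Jet.mul, Jet.const, zero_mul, Finset.sum_const_zero, ← sq]; ring
    rw [this, hMsrc]; ring
  have hWWsrc : ∀ t x, (W.mul W).src t x = 2 * ∑ k, W.d k t x ^ 2 := fun t x => by
    simp [hWdef, Jet.mul, heatJet, Jet.heat, sq]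
  have hWWd : ∀ k t x, (W.mul W).d k t x = 2 * (W.val t x * W.d k t x) := fun k t x => by
    simp only [Jet.mul]; ring
  have hsrc : ∀ t, 0 ≤ t → ∀ x, W.val t x ^ 2 * B.d k t x ^ 2 ≤ Φ.src t x := by
    intro t ht x
    have e1 : Φ.src t x = (W.mul W).src t x * q.val t x + W.val t x * W.val t x * q.src t x +
        2 * ∑ k, (W.mul W).d k t x * q.d k t x := rfl
    rw [e1, hWWsrc, hqval, hqsrc]
    simp only [hWWd, hqd]
    have m0 := hM0 t x
    have m1 := hM1 t ht x
    set m := M.val t x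
    set w := W.val t x
    have hsum : 0 ≤ ∑ k, (2 * W.d k t x ^ 2 * (3 - m + m ^ 2 / 2) + w * w * M.d k t x ^ 2 +
        2 * (2 * (w * W.d k t x) * (-M.d k t x + m * M.d k t x))) := by
      refine Finset.sum_nonneg fun k _ => ?_
      have : 2 * W.d k t x ^ 2 * (3 - m + m ^ 2 / 2) + w * w * M.d k t x ^ 2 +
        2 * (2 * (w * W.d k t x) * (-M.d k t x + m * M.d k t x)) =
        (2 * (1 - m) * W.d k t x - w * M.d k t x) ^ 2 +
          (2 + 6 * m - 3 * m ^ 2) * W.d k t x ^ 2 := by ring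
      rw [this]
      have : 0 ≤ 2 + 6 * m - 3 * m ^ 2 := by nlinarith
      positivity
    simp only [Finset.sum_add_distrib, ← Finset.mul_sum, ← Finset.sum_mul] at hsum
    have hB1 : B.d k t x ^ 2 ≤ ∑ k, B.d k t x ^ 2 :=
      Finset.single_le_sum (f := fun k => B.d k t x ^ 2) (fun i _ => sq_nonneg _)
        (Finset.mem_univ k)
    have hw2 : 0 ≤ w ^ 2 := sq_nonneg w
    have h1 : w ^ 2 * B.d k t x ^ 2 ≤ w ^ 2 * (2 * (1 - m) * ∑ k, B.d k t x ^ 2) := by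
      refine mul_le_mul_of_nonneg_left ?_ hw2
      nlinarith [sq_nonneg (B.d k t x)]
    nlinarith
  have hint : UnifInt fun t x => W.val t x ^ 2 * B.d k t x ^ 2 := by
    simpa only [sq] using (hW.val.mul_bdd W.bddCont_val).mul_bdd
      ((B.bddCont_d k).mul (B.bddCont_d k))
  have h1 := Jet.evolution hΦi hT
  have h2 : 0 ≤ ∫ x, Φ.val T x := by
    refine integral_nonneg fun x => ?_
    have e1 : Φ.val T x = W.val T x * W.val T x * q.val T x := rfl
    rw [e1, hqval]
    have := hM0 T x
    have := hM1 T hT x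
    exact mul_nonneg (mul_self_nonneg _) (by nlinarith)
  have h3 : ∫ x, Φ.val 0 x = 3 * ∫ x, w x ^ 2 := by
    rw [← integral_const_mul]
    congr 1; funext x
    have e1 : Φ.val 0 x = W.val 0 x * W.val 0 x * q.val 0 x := rfl
    have e2 : W.val 0 x = w x := by simp [hWdef, heatJet, Jet.heat, heat_zero]
    have e3 : M.val 0 x = 0 := by rw [hMval, heat_zero, heat_zero]; ring
    rw [e1, hqval, e2, e3]; ring
  have h4 := intervalIntegral_mul_integral_mono hint hΦi.src hT hsrc
  linarith

/-- The `k`-th partial derivative of a Schwartz function, as a Schwartz function. -/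
noncomputable abbrev dS (k : Fin n) (u : 𝓢(E n, ℝ)) : 𝓢(E n, ℝ) := ∂_{basisVec k} u

/-! ### The div-curl estimate for smooth bounded coefficients -/

lemma abs_integral_le_of_two_mul {Φ F G : ℝ → E n → ℝ} (hΦ : UnifInt Φ) (hF : UnifInt F)
    (hG : UnifInt G) {T : ℝ} (hT : 0 ≤ T) {a c : ℝ}
    (h : ∀ t x, |Φ t x| ≤ F t x + G t x)
    (hFa : ∫ t in 0..T, t * ∫ x, F t x ≤ a) (hGc : ∫ t in 0..T, t * ∫ x, G t x ≤ c) :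
    |∫ t in 0..T, t * ∫ x, Φ t x| ≤ a + c := by
  have hFG : ∫ t in 0..T, t * ∫ x, (F t x + G t x) =
      (∫ t in 0..T, t * ∫ x, F t x) + ∫ t in 0..T, t * ∫ x, G t x := by
    rw [← intervalIntegral.integral_add (hF.intervalIntegrable hT) (hG.intervalIntegrable hT)]
    congr 1; funext t
    rw [integral_add (hF.integrable t) (hG.integrable t)]; ring
  have hneg : ∫ t in 0..T, t * ∫ x, (-1) * Φ t x = -∫ t in 0..T, t * ∫ x, Φ t x := by
    rw [← intervalIntegral.integral_neg]
    congr 1; funext t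
    rw [integral_const_mul]; ring
  have h1 := intervalIntegral_mul_integral_mono hΦ (hF.add hG) hT
    fun t _ x => (le_abs_self _).trans (h t x)
  have h2 := intervalIntegral_mul_integral_mono (hΦ.const_mul (-1)) (hF.add hG) hT
    fun t _ x => (by have := (neg_abs_le (Φ t x)); linarith [h t x])
  rw [abs_le]
  constructor <;> linarith

/-- The trilinear expression `∂ₖB · W · ∂ₗZ` in the heat extensions of `b`, `w`, `z` is controlled
by the Carleson estimate for `(B, W)` and the energy estimate for `Z`. -/
lemma trilinear_term {b : E n → ℝ} (hb : BddDeriv 2 b) (hG : GarsiaBound b (1 / 2))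
    (w z : 𝓢(E n, ℝ)) (k l : Fin n) {T : ℝ} (hT : 0 ≤ T) :
    |∫ t in 0..T, t * ∫ x, 2 * ((Jet.heat b hb).d k t x * ((heatJet w).val t x *
      (heatJet z).d l t x))| ≤ 3 * (∫ x, w x ^ 2) + (1 / 2) * ∫ x, z x ^ 2 := by
  have hw := heatJet_int w
  have hz := heatJet_int z
  have hB := (Jet.heat b hb).bddCont_d k
  refine abs_integral_le_of_two_mul
    (F := fun t x => (heatJet w).val t x ^ 2 * (Jet.heat b hb).d k t x ^ 2)
    (G := fun t x => (heatJet z).d l t x ^ 2) ?_ ?_ ?_ hT (fun t x => ?_)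
    (carleson_estimate hb hG w k hT) (energy_estimate z l hT)
  · exact (UnifInt.bdd_mul hB (hw.val.mul_bdd ((heatJet z).bddCont_d l))).const_mul 2
  · simpa only [sq] using (hw.val.mul_bdd (heatJet w).bddCont_val).mul_bdd (hB.mul hB)
  · simpa only [sq] using (hz.d l).mul_bdd ((heatJet z).bddCont_d l)
  · rw [abs_le]
    constructor <;>
    nlinarith [sq_nonneg ((heatJet w).val t x * (Jet.heat b hb).d k t x - (heatJet z).d l t x),
      sq_nonneg ((heatJet w).val t x * (Jet.heat b hb).d k t x + (heatJet z).d l t x)]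

lemma heatJet_d_comm (u : 𝓢(E n, ℝ)) (j k : Fin n) :
    (heatJet (dS j u)).d k = (heatJet (dS k u)).d j := by
  change heat (pd k (pd j u)) = heat (pd j (pd k u))
  rw [pd_comm (u.smooth ⊤)]

/-- Integration by parts in the term `B {∂ₖU, ∂ₖV}`; the third derivatives of `V` cancel. -/
lemma integral_null_form {b : E n → ℝ} (hb : BddDeriv 2 b) (u v : 𝓢(E n, ℝ)) (i j : Fin n)
    (t : ℝ) :
    ∫ x, (Jet.heat b hb).val t x * ((heatJet u).d j t x * (heatJet v).d i t x -
      (heatJet u).d i t x * (heatJet v).d j t x) =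
    (∫ x, (Jet.heat b hb).d i t x * ((heatJet u).val t x * (heatJet v).d j t x)) -
      ∫ x, (Jet.heat b hb).d j t x * ((heatJet u).val t x * (heatJet v).d i t x) := by
  set B := Jet.heat b hb
  set U := heatJet u
  set V := heatJet v
  have hU : U.Int := heatJet_int u
  have hV : V.Int := heatJet_int v
  -- the parts formula with the derivative in direction `a` moved off `U`
  have key : ∀ a c : Fin n, ∫ x, B.val t x * (U.d a t x * V.d c t x) =
      -(∫ x, B.d a t x * (U.val t x * V.d c t x)) -
        ∫ x, U.val t x * (B.val t x * (heatJet (dS c v)).d a t x) := by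
    intro a c
    set Vc := heatJet (dS c v)
    have e : V.d c = Vc.val := rfl
    have i1 : Integrable fun x => U.d a t x * (B.val t x * Vc.val t x) :=
      ((hU.d a).mul_bdd (B.bddCont_val.mul Vc.bddCont_val)).integrable t
    have i2 : Integrable fun x => U.val t x * (B.d a t x * Vc.val t x) :=
      (hU.val.mul_bdd ((B.bddCont_d a).mul Vc.bddCont_val)).integrable t
    have i3 : Integrable fun x => U.val t x * (B.val t x * Vc.d a t x) :=
      (hU.val.mul_bdd (B.bddCont_val.mul (Vc.bddCont_d a))).integrable t
    have i4 : Integrable fun x => U.val t x * (B.val t x * Vc.val t x) :=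
      (hU.val.mul_bdd (B.bddCont_val.mul Vc.bddCont_val)).integrable t
    have i5 : Integrable fun x => U.val t x * (B.d a t x * Vc.val t x + B.val t x * Vc.d a t x) :=
      (i2.add i3).congr (Eventually.of_forall fun x => by simp only [Pi.add_apply]; ring)
    have h := integral_lineDeriv_mul (v := basisVec a) i1 i5 i4
      (fun x => U.hasLineDerivAt_val t x a)
      (fun x => (B.hasLineDerivAt_val t x a).mul_real (Vc.hasLineDerivAt_val t x a))
    have e1 : ∫ x, U.val t x * (B.d a t x * Vc.val t x + B.val t x * Vc.d a t x) =
        (∫ x, U.val t x * (B.d a t x * Vc.val t x)) +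
          ∫ x, U.val t x * (B.val t x * Vc.d a t x) := by
      rw [← integral_add i2 i3]; congr 1; funext x; ring
    have e2 : ∫ x, B.val t x * (U.d a t x * V.d c t x) =
        ∫ x, U.d a t x * (B.val t x * Vc.val t x) := by
      rw [e]; congr 1; funext x; ring
    have e3 : ∫ x, B.d a t x * (U.val t x * V.d c t x) =
        ∫ x, U.val t x * (B.d a t x * Vc.val t x) := by
      rw [e]; congr 1; funext x; ring
    rw [e2, e3]
    linarith
  have j1 : ∀ a c : Fin n, Integrable fun x => B.val t x * (U.d a t x * V.d c t x) := fun a c =>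
    (UnifInt.bdd_mul B.bddCont_val ((hU.d a).mul_bdd (V.bddCont_d c))).integrable t
  have : ∀ x, B.val t x * (U.d j t x * V.d i t x - U.d i t x * V.d j t x) =
      B.val t x * (U.d j t x * V.d i t x) - B.val t x * (U.d i t x * V.d j t x) :=
    fun x => by ring
  simp_rw [this]
  rw [integral_sub (j1 _ _) (j1 _ _), key, key, heatJet_d_comm v i j]
  ring

/-- The gradient energy decays along the heat flow, at least for a sequence of times. -/
lemma exists_small_energy (w : Fin 2 → 𝓢(E n, ℝ)) (k : Fin 2 → Fin 2 → Fin n) {ε : ℝ}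
    (hε : 0 < ε) :
    ∃ T, 0 ≤ T ∧ ∑ a, ∑ c, ∫ x, (heatJet (w a)).d (k a c) T x ^ 2 ≤ ε := by
  by_contra! hcon
  have hd2 : ∀ a c, UnifInt fun t x => (heatJet (w a)).d (k a c) t x ^ 2 := fun a c => by
    simpa only [sq] using ((heatJet_int (w a)).d (k a c)).mul_bdd ((heatJet (w a)).bddCont_d _)
  set K := ∑ a : Fin 2, ∑ c : Fin 2, (1 / 2) * ∫ x, w a x ^ 2 with hK
  have hup : ∀ T, 0 ≤ T → ε * (T ^ 2 / 2) ≤ K := by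
    intro T hT
    have h1 : ∫ t in 0..T, t * ∑ a, ∑ c, ∫ x, (heatJet (w a)).d (k a c) t x ^ 2 ≤ K := by
      simp_rw [Finset.mul_sum]
      rw [intervalIntegral.integral_finsetSum]
      · refine Finset.sum_le_sum fun a _ => ?_
        rw [intervalIntegral.integral_finsetSum]
        · exact Finset.sum_le_sum fun c _ => energy_estimate (w a) _ hT
        · exact fun c _ => (hd2 a c).intervalIntegrable hT
      · intro a _
        have := IntervalIntegrable.sum (μ := volume) (a := 0) (b := T) Finset.univ
          (f := fun (c : Fin 2) t => t * ∫ x, (heatJet (w a)).d (k a c) t x ^ 2)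
          fun c _ => (hd2 a c).intervalIntegrable hT
        simpa [Finset.sum_fn] using this
    have h2 : ∫ t in 0..T, t * ε ≤
        ∫ t in 0..T, t * ∑ a, ∑ c, ∫ x, (heatJet (w a)).d (k a c) t x ^ 2 := by
      refine intervalIntegral.integral_mono_on hT (by
        exact Continuous.intervalIntegrable (by fun_prop) _ _) ?_ fun t ht =>
          mul_le_mul_of_nonneg_left (hcon t ht.1).le ht.1
      have := (UnifInt.sum Finset.univ fun a => UnifInt.sum Finset.univ (hd2 a)).intervalIntegrable hT
      refine this.congr fun t _ => ?_
      rw [integral_finsetSum _ fun a _ => integrable_finsetSum _ fun c _ => (hd2 a c).integrable t]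
      congr 1
      refine Finset.sum_congr rfl fun a _ => ?_
      rw [integral_finsetSum _ fun c _ => (hd2 a c).integrable t]
    rw [intervalIntegral.integral_mul_const, integral_id] at h2
    linarith
  have hK0 : 0 ≤ K := (by simpa using hup 0 le_rfl)
  have := hup (2 * (K / ε) + 2) (by positivity)
  have e : ε * ((2 * (K / ε) + 2) ^ 2 / 2) = 2 * K * (K / ε) + 4 * K + 2 * ε := by
    field_simp; ring
  rw [e] at this
  have : 0 ≤ 2 * K * (K / ε) := by positivity
  linarith

/-- The squared norm `‖∇u‖²` of the gradient in `L²`. -/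
noncomputable def gradSq (u : 𝓢(E n, ℝ)) : ℝ := ∑ k, ∫ x, (dS k u) x ^ 2

lemma integral_pd_sq_le_gradSq (u : 𝓢(E n, ℝ)) (k : Fin n) :
    ∫ x, (dS k u) x ^ 2 ≤ gradSq u :=
  Finset.single_le_sum (f := fun k => ∫ x, (dS k u) x ^ 2)
    (fun _ _ => integral_nonneg fun _ => sq_nonneg _) (Finset.mem_univ k)

/-- The div-curl estimate for normalised smooth coefficients. Along the heat flow the quantity
`∫ B (∂ⱼU ∂ᵢV - ∂ᵢU ∂ⱼV)` tends to `0`, and its derivative is a sum of null forms. -/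
theorem div_curl_smooth {b : E n → ℝ} (hb : BddDeriv 2 b) (hG : GarsiaBound b (1 / 2))
    (u v : 𝓢(E n, ℝ)) (i j : Fin n) :
    |∫ x, b x * ((dS j u) x * (dS i v) x -
      (dS i u) x * (dS j v) x)| ≤ 21 * n * (gradSq u + gradSq v) := by
  set S := gradSq u + gradSq v with hS
  have hSu : ∀ k, ∫ x, (dS k u) x ^ 2 ≤ S := fun k => by
    have h1 := integral_pd_sq_le_gradSq u k
    have h2 : 0 ≤ gradSq v := Finset.sum_nonneg fun _ _ => integral_nonneg fun _ => sq_nonneg _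
    linarith
  have hSv : ∀ k, ∫ x, (dS k v) x ^ 2 ≤ S := fun k => by
    have h1 := integral_pd_sq_le_gradSq v k
    have h2 : 0 ≤ gradSq u := Finset.sum_nonneg fun _ _ => integral_nonneg fun _ => sq_nonneg _
    linarith
  set B := Jet.heat b hb with hB
  set U : Fin n → Jet n := fun k => heatJet (dS k u) with hU
  set V : Fin n → Jet n := fun k => heatJet (dS k v) with hV
  have hUi : ∀ k, (U k).Int := fun k => heatJet_int _
  have hVi : ∀ k, (V k).Int := fun k => heatJet_int _
  set Φ : Jet n := (((U j).mul (V i)).add (((U i).mul (V j)).mul (Jet.const n (-1)))).mul B with hΦ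
  have hΦi : Φ.Int := ((hUi j).mul.add (hUi i).mul.mul).mul
  have hterm : ∀ (w z : Jet n), w.Int → z.Int → ∀ k l,
      UnifInt fun t x => 2 * (B.d k t x * (w.val t x * z.d l t x)) := fun w z hw hz k l =>
    (UnifInt.bdd_mul (B.bddCont_d k) (hw.val.mul_bdd (z.bddCont_d l))).const_mul 2
  set N : (Jet n) → (Jet n) → Fin n → Fin n → ℝ → ℝ := fun w z k l t =>
    ∫ x, 2 * (B.d k t x * (w.val t x * z.d l t x)) with hN
  have hslice : ∀ t, ∫ x, Φ.src t x = ∑ k, (N (V i) (U j) k k t + N (U j) (V i) k k t -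
      N (V j) (U i) k k t - N (U i) (V j) k k t + N (U k) (V k) i j t - N (U k) (V k) j i t) := by
    intro t
    have e : ∀ x, Φ.src t x = ∑ k, (2 * (B.d k t x * ((V i).val t x * (U j).d k t x)) +
        2 * (B.d k t x * ((U j).val t x * (V i).d k t x)) -
        2 * (B.d k t x * ((V j).val t x * (U i).d k t x)) -
        2 * (B.d k t x * ((U i).val t x * (V j).d k t x)) +
        2 * (B.val t x * ((U j).d k t x * (V i).d k t x - (U i).d k t x * (V j).d k t x))) := by
      intro x
      have s0 : ∀ φ : 𝓢(E n, ℝ), (heatJet φ).src t x = 0 := fun φ => rfl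
      have s1 : B.src t x = 0 := rfl
      simp only [hΦ, Jet.mul, Jet.add, Jet.const, hU, hV, s0, s1]
      simp only [mul_zero, zero_mul, add_zero, zero_add, Finset.sum_const_zero]
      simp only [Finset.mul_sum, Finset.sum_mul, ← Finset.sum_add_distrib]
      refine Finset.sum_congr rfl fun k _ => ?_
      ring
    have hnull : ∀ k, ∫ x, 2 * (B.val t x * ((U j).d k t x * (V i).d k t x -
        (U i).d k t x * (V j).d k t x)) = N (U k) (V k) i j t - N (U k) (V k) j i t := by
      intro k
      have h := integral_null_form hb (dS k u) (dS k v) i j t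
      rw [heatJet_d_comm u k j, heatJet_d_comm u k i, heatJet_d_comm v k i,
        heatJet_d_comm v k j] at h
      simp only [hN, integral_const_mul, hU, hV]
      rw [heatJet_d_comm v k i, heatJet_d_comm v k j, h]
      ring
    have hm : ∀ k, Integrable fun x => 2 * (B.val t x * ((U j).d k t x * (V i).d k t x -
        (U i).d k t x * (V j).d k t x)) := fun k => by
      have := ((UnifInt.bdd_mul B.bddCont_val (((hUi j).d k).mul_bdd ((V i).bddCont_d k))).add
        ((UnifInt.bdd_mul B.bddCont_val (((hUi i).d k).mul_bdd
          ((V j).bddCont_d k))).const_mul (-1))).const_mul 2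
      refine (this.integrable t).congr (Eventually.of_forall fun x => ?_)
      simp only; ring
    have t1 := fun k => (hterm (V i) (U j) (hVi i) (hUi j) k k).integrable t
    have t2 := fun k => (hterm (U j) (V i) (hUi j) (hVi i) k k).integrable t
    have t3 := fun k => (hterm (V j) (U i) (hVi j) (hUi i) k k).integrable t
    have t4 := fun k => (hterm (U i) (V j) (hUi i) (hVi j) k k).integrable t
    simp_rw [e]
    refine (integral_finsetSum _ fun k _ =>
      ((((t1 k).add (t2 k)).sub (t3 k)).sub (t4 k)).add (hm k)).trans ?_
    refine Finset.sum_congr rfl fun k _ => ?_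
    have a1 := integral_add ((((t1 k).add (t2 k)).sub (t3 k)).sub (t4 k)) (hm k)
    have a2 := integral_sub (((t1 k).add (t2 k)).sub (t3 k)) (t4 k)
    have a3 := integral_sub ((t1 k).add (t2 k)) (t3 k)
    have a4 := integral_add (t1 k) (t2 k)
    simp only [Pi.add_apply, Pi.sub_apply] at a1 a2 a3 a4
    refine a1.trans ?_
    rw [a2, a3, a4, hnull]
    simp only [hN]
    ring
  have hbound : ∀ T, 0 ≤ T → |∫ t in 0..T, t * ∫ x, Φ.src t x| ≤ 21 * n * S := by
    intro T hT
    have hNi : ∀ (w z : Jet n), w.Int → z.Int → ∀ k l,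
        IntervalIntegrable (fun t => t * N w z k l t) volume 0 T :=
      fun w z hw hz k l => (hterm w z hw hz k l).intervalIntegrable hT
    have hNb : ∀ (w z : 𝓢(E n, ℝ)) (k l : Fin n), (∫ x, w x ^ 2) ≤ S → (∫ x, z x ^ 2) ≤ S →
        |∫ t in 0..T, t * N (heatJet w) (heatJet z) k l t| ≤ 7 / 2 * S := by
      intro w z k l h1 h2
      refine (trilinear_term hb hG w z k l hT).trans ?_
      linarith
    simp_rw [hslice, Finset.mul_sum]
    have r1 := fun k => hNi (V i) (U j) (hVi i) (hUi j) k k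
    have r2 := fun k => hNi (U j) (V i) (hUi j) (hVi i) k k
    have r3 := fun k => hNi (V j) (U i) (hVi j) (hUi i) k k
    have r4 := fun k => hNi (U i) (V j) (hUi i) (hVi j) k k
    have r5 := fun k => hNi (U k) (V k) (hUi k) (hVi k) i j
    have r6 := fun k => hNi (U k) (V k) (hUi k) (hVi k) j i
    have split : ∀ k, ∫ t in 0..T, t * (N (V i) (U j) k k t + N (U j) (V i) k k t -
        N (V j) (U i) k k t - N (U i) (V j) k k t + N (U k) (V k) i j t - N (U k) (V k) j i t) =
        (∫ t in 0..T, t * N (V i) (U j) k k t) + (∫ t in 0..T, t * N (U j) (V i) k k t) -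
        (∫ t in 0..T, t * N (V j) (U i) k k t) - (∫ t in 0..T, t * N (U i) (V j) k k t) +
        (∫ t in 0..T, t * N (U k) (V k) i j t) - (∫ t in 0..T, t * N (U k) (V k) j i t) := by
      intro k
      rw [← intervalIntegral.integral_add (r1 k) (r2 k),
        ← intervalIntegral.integral_sub ((r1 k).add (r2 k)) (r3 k),
        ← intervalIntegral.integral_sub (((r1 k).add (r2 k)).sub (r3 k)) (r4 k),
        ← intervalIntegral.integral_add ((((r1 k).add (r2 k)).sub (r3 k)).sub (r4 k)) (r5 k),
        ← intervalIntegral.integral_sub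
          (((((r1 k).add (r2 k)).sub (r3 k)).sub (r4 k)).add (r5 k)) (r6 k)]
      congr 1; funext t
      ring
    rw [intervalIntegral.integral_finsetSum]
    · refine (Finset.abs_sum_le_sum_abs _ _).trans ?_
      have : ∀ k ∈ (Finset.univ : Finset (Fin n)), |∫ t in 0..T, t * (N (V i) (U j) k k t +
          N (U j) (V i) k k t - N (V j) (U i) k k t - N (U i) (V j) k k t + N (U k) (V k) i j t -
          N (U k) (V k) j i t)| ≤ 21 * S := by
        intro k _
        rw [split k]
        have b1 := abs_le.1 (hNb (dS i v) (dS j u) k k (hSv i) (hSu j))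
        have b2 := abs_le.1 (hNb (dS j u) (dS i v) k k (hSu j) (hSv i))
        have b3 := abs_le.1 (hNb (dS j v) (dS i u) k k (hSv j) (hSu i))
        have b4 := abs_le.1 (hNb (dS i u) (dS j v) k k (hSu i) (hSv j))
        have b5 := abs_le.1 (hNb (dS k u) (dS k v) i j (hSu k) (hSv k))
        have b6 := abs_le.1 (hNb (dS k u) (dS k v) j i (hSu k) (hSv k))
        rw [abs_le]
        constructor <;> linarith [b1.1, b1.2, b2.1, b2.2, b3.1, b3.2, b4.1, b4.2, b5.1, b5.2,
          b6.1, b6.2]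
      refine (Finset.sum_le_sum this).trans (le_of_eq ?_)
      simp; ring
    · intro k _
      exact ((((((r1 k).add (r2 k)).sub (r3 k)).sub (r4 k)).add (r5 k)).sub (r6 k)).congr
        fun t _ => by ring
  obtain ⟨C, hC⟩ := hb.bdd
  have hC0 : 0 ≤ C := (abs_nonneg _).trans (hC 0)
  have h0 : ∫ x, Φ.val 0 x = ∫ x, b x * ((dS j u) x * (dS i v) x -
      (dS i u) x * (dS j v) x) := by
    congr 1; funext x
    simp only [hΦ, Jet.mul, Jet.add, Jet.const, hU, hV, hB, heatJet, Jet.heat, heat_zero]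
    ring
  rw [← h0]
  refine le_of_forall_pos_le_add fun ε hε => ?_
  obtain ⟨T, hT, hsmall⟩ := exists_small_energy ![u, v] (fun _ => ![i, j]) (ε := ε / (C + 1))
    (by positivity)
  have hevo := Jet.evolution hΦi hT
  have hTb : |∫ x, Φ.val T x| ≤ ε := by
    have q1 : ∀ (w : 𝓢(E n, ℝ)) k, Integrable fun x => (heatJet w).d k T x ^ 2 := fun w k => by
      simpa only [sq] using (((heatJet_int w).d k).mul_bdd ((heatJet w).bddCont_d k)).integrable T
    have q2 : |∫ x, Φ.val T x| ≤ ∫ x, C * ((heatJet u).d i T x ^ 2 + (heatJet u).d j T x ^ 2 +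
        ((heatJet v).d i T x ^ 2 + (heatJet v).d j T x ^ 2)) := by
      have qi : Integrable fun x => C * ((heatJet u).d i T x ^ 2 + (heatJet u).d j T x ^ 2 +
          ((heatJet v).d i T x ^ 2 + (heatJet v).d j T x ^ 2)) :=
        (((q1 u i).add (q1 u j)).add ((q1 v i).add (q1 v j))).const_mul C
      rw [← Real.norm_eq_abs]
      refine norm_integral_le_of_norm_le qi (Eventually.of_forall fun x => ?_)
      have e1 : Φ.val T x = ((heatJet u).d j T x * (heatJet v).d i T x -
        (heatJet u).d i T x * (heatJet v).d j T x) * B.val T x := by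
        have : Φ.val T x = ((U j).val T x * (V i).val T x +
          (U i).val T x * (V j).val T x * (-1)) * B.val T x := rfl
        rw [this]
        have g1 : (U j).val = (heatJet u).d j := rfl
        have g2 : (U i).val = (heatJet u).d i := rfl
        have g3 : (V j).val = (heatJet v).d j := rfl
        have g4 : (V i).val = (heatJet v).d i := rfl
        rw [g1, g2, g3, g4]; ring
      rw [e1, norm_mul, mul_comm]
      refine mul_le_mul (heat_abs_le hC T x) ?_ (norm_nonneg _) hC0
      rw [Real.norm_eq_abs, abs_le]
      set p := (heatJet u).d j T x
      set q := (heatJet u).d i T x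
      set r := (heatJet v).d j T x
      set s := (heatJet v).d i T x
      constructor <;>
      nlinarith [sq_nonneg (p + s), sq_nonneg (p - s), sq_nonneg (q + r), sq_nonneg (q - r)]
    rw [integral_const_mul] at q2
    have q3 : ∫ x, ((heatJet u).d i T x ^ 2 + (heatJet u).d j T x ^ 2 +
        ((heatJet v).d i T x ^ 2 + (heatJet v).d j T x ^ 2)) ≤ ε / (C + 1) := by
      have a1 := integral_add ((q1 u i).add (q1 u j)) ((q1 v i).add (q1 v j))
      have a2 := integral_add (q1 u i) (q1 u j)
      have a3 := integral_add (q1 v i) (q1 v j)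
      simp only [Pi.add_apply] at a1 a2 a3
      rw [a1, a2, a3]
      simpa [Fin.sum_univ_two] using hsmall
    calc |∫ x, Φ.val T x| ≤ C * (ε / (C + 1)) := q2.trans (mul_le_mul_of_nonneg_left q3 hC0)
      _ ≤ ε := by
        rw [mul_div_assoc', div_le_iff₀ (by positivity)]
        nlinarith
  have hb' := abs_le.1 (hbound T hT)
  have hT' := abs_le.1 hTb
  rw [← hevo] at hb'
  rw [abs_le]
  constructor <;> linarith [hb'.1, hb'.2, hT'.1, hT'.2]

/-! ### Cubes -/

lemma cube_eq_preimage (a : E n) (r : ℝ) :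
    cube a r = (fun y : E n => y.ofLp) ⁻¹' Icc (fun i => a i) (fun i => a i + r) := by
  ext y; simp [cube, Pi.le_def, forall_and]

lemma isClosed_cube (a : E n) (r : ℝ) : IsClosed (cube a r) := by
  rw [cube_eq_preimage]
  exact isClosed_Icc.preimage (PiLp.continuous_ofLp 2 _)

lemma isCompact_cube (a : E n) (r : ℝ) : IsCompact (cube a r) := by
  have h := (isCompact_Icc (a := fun i => a i) (b := fun i => a i + r)).image
    (PiLp.continuous_toLp 2 (fun _ : Fin n => ℝ))
  convert h using 1
  ext y
  simp only [cube, mem_ofPred_eq, mem_image, mem_Icc, Pi.le_def]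
  constructor
  · intro hy
    exact ⟨y.ofLp, ⟨fun i => (hy i).1, fun i => (hy i).2⟩, rfl⟩
  · rintro ⟨z, hz, rfl⟩ i
    exact ⟨hz.1 i, hz.2 i⟩

lemma measurableSet_cube (a : E n) (r : ℝ) : MeasurableSet (cube a r) :=
  (isClosed_cube a r).measurableSet

lemma volume_real_cube (a : E n) {r : ℝ} (hr : 0 ≤ r) :
    (volume : Measure (E n)).real (cube a r) = r ^ n := by
  rw [Measure.real, cube_eq_preimage, (PiLp.volume_preserving_ofLp (Fin n)).measure_preimage
    measurableSet_Icc.nullMeasurableSet, Real.volume_Icc_pi_toReal (fun i => by simp [hr])]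
  simp

lemma volume_cube_lt_top (a : E n) (r : ℝ) : (volume : Measure (E n)) (cube a r) < ⊤ :=
  (isCompact_cube a r).measure_lt_top

lemma integrableOn_cube {f : E n → ℝ} (hf : Continuous f) (a : E n) (r : ℝ) :
    IntegrableOn f (cube a r) := hf.continuousOn.integrableOn_compact (isCompact_cube a r)

lemma average_cube (f : E n → ℝ) (a : E n) {r : ℝ} (hr : 0 ≤ r) :
    ⨍ x in cube a r, f x = (r ^ n)⁻¹ * ∫ x in cube a r, f x := by
  rw [setAverage_eq, volume_real_cube a hr, smul_eq_mul]

/-- The half-open cube. -/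
def halfOpenCube (a : E n) (r : ℝ) : Set (E n) := {y | ∀ i, y i ∈ Ico (a i) (a i + r)}

lemma halfOpenCube_eq_preimage (a : E n) (r : ℝ) : halfOpenCube a r =
    (fun y : E n => y.ofLp) ⁻¹' (univ.pi fun i => Ico (a i) (a i + r)) := by
  ext y; simp [halfOpenCube]

lemma halfOpenCube_ae_eq (a : E n) (r : ℝ) : halfOpenCube a r =ᵐ[volume] cube a r := by
  rw [halfOpenCube_eq_preimage, cube_eq_preimage]
  exact (PiLp.volume_preserving_ofLp (Fin n)).quasiMeasurePreserving.preimage_ae_eq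
    Measure.univ_pi_Ico_ae_eq_Icc

lemma measurableSet_halfOpenCube (a : E n) (r : ℝ) : MeasurableSet (halfOpenCube a r) := by
  rw [halfOpenCube_eq_preimage]
  exact (MeasurableSet.univ_pi fun i => measurableSet_Ico).preimage
    (PiLp.continuous_ofLp 2 _).measurable

/-- The lower corners of the `2ⁿ` dyadic children of the cube with lower corner `a` and side
length `r`. -/
noncomputable def childCorner (a : E n) (r : ℝ) (σ : Fin n → Bool) : E n :=
  WithLp.toLp 2 fun i => a i + if σ i then r / 2 else 0

lemma childCube_subset (a : E n) {r : ℝ} (hr : 0 ≤ r) (σ : Fin n → Bool) :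
    cube (childCorner a r σ) (r / 2) ⊆ cube a r := by
  intro y hy i
  have := hy i
  simp only [childCorner] at this
  constructor
  · have h1 := this.1
    split_ifs at h1 <;> linarith
  · have h1 := this.2
    split_ifs at h1 <;> linarith

lemma integral_cube_eq_sum_children {f : E n → ℝ} (a : E n) {r : ℝ} (hr : 0 ≤ r)
    (hf : IntegrableOn f (cube a r)) :
    ∫ x in cube a r, f x = ∑ σ : Fin n → Bool, ∫ x in cube (childCorner a r σ) (r / 2), f x := by
  have hU : halfOpenCube a r = ⋃ σ, halfOpenCube (childCorner a r σ) (r / 2) := by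
    ext y
    simp only [halfOpenCube, mem_ofPred_eq, mem_iUnion, childCorner, mem_Ico]
    constructor
    · intro hy
      refine ⟨fun i => decide (a i + r / 2 ≤ y i), fun i => ?_⟩
      by_cases h : a i + r / 2 ≤ y i
      · simp only [h, decide_true, if_true, true_and]; linarith [(hy i).2]
      · simp only [h, decide_false, Bool.false_eq_true, if_false, add_zero]
        exact ⟨(hy i).1, by linarith⟩
    · rintro ⟨σ, hσ⟩ i
      have := hσ i
      split_ifs at this <;> constructor <;> linarith
  have hdisj : Pairwise (Function.onFun Disjoint fun σ =>
      halfOpenCube (childCorner a r σ) (r / 2)) := by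
    intro σ τ hne
    refine Set.disjoint_left.2 fun y hy hy' => hne ?_
    funext i
    have h1 := hy i
    have h2 := hy' i
    simp only [childCorner, mem_Ico] at h1 h2
    cases hs : σ i <;> cases ht : τ i <;> simp [hs, ht] at h1 h2 ⊢ <;> linarith
  rw [← setIntegral_congr_set (halfOpenCube_ae_eq a r), hU, integral_iUnion_fintype
    (fun σ => measurableSet_halfOpenCube _ _) hdisj]
  · exact Finset.sum_congr rfl fun σ _ => setIntegral_congr_set (halfOpenCube_ae_eq _ _)
  · intro σ
    exact (hf.mono_set (childCube_subset a hr σ)).congr_set_ae (halfOpenCube_ae_eq _ _)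

/-! ### The John–Nirenberg inequality in `L²` form -/

lemma integral_cube_const (a : E n) {r : ℝ} (hr : 0 ≤ r) (c : ℝ) :
    ∫ _ in cube a r, c = c * r ^ n := by
  rw [setIntegral_const, volume_real_cube a hr, smul_eq_mul, mul_comm]

lemma average_cube_mul (f : E n → ℝ) (a : E n) {r : ℝ} (hr : 0 < r) :
    (⨍ x in cube a r, f x) * r ^ n = ∫ x in cube a r, f x := by
  rw [average_cube f a hr.le]
  field_simp

lemma average_cube_sub {f : E n → ℝ} {a : E n} {r : ℝ} (hf : IntegrableOn f (cube a r))
    (hr : 0 < r) (c : ℝ) : (⨍ y in cube a r, (f y - c)) = (⨍ y in cube a r, f y) - c := by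
  rw [average_cube _ a hr.le, average_cube _ a hr.le, integral_sub hf
    (integrableOn_cube continuous_const a r), integral_cube_const a hr.le]
  field_simp

lemma integral_cube_sq_sub {f : E n → ℝ} (hf : Continuous f) (a : E n) {r : ℝ} (hr : 0 < r)
    (c : ℝ) : ∫ x in cube a r, (f x - c) ^ 2 =
      (∫ x in cube a r, (f x - ⨍ y in cube a r, f y) ^ 2) +
        (⨍ y in cube a r, (f y - c)) ^ 2 * r ^ n := by
  rw [average_cube_sub (integrableOn_cube hf a r) hr]
  have h0 := average_cube_mul f a hr
  set m := ⨍ y in cube a r, f y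
  have e : ∀ x, (f x - c) ^ 2 = (f x - m) ^ 2 + (2 * (m - c) * (f x - m) + (m - c) ^ 2) :=
    fun x => by ring
  simp_rw [e]
  rw [integral_add (integrableOn_cube (by fun_prop) a r) (integrableOn_cube (by fun_prop) a r),
    integral_add (integrableOn_cube (by fun_prop) a r) (integrableOn_cube (by fun_prop) a r),
    integral_const_mul, integral_sub (integrableOn_cube hf a r)
      (integrableOn_cube continuous_const a r), integral_cube_const a hr.le,
    integral_cube_const a hr.le, ← h0]
  ring

/-- The mean oscillation of `f` over every cube is at most `Λ`. -/
def MeanOsc (f : E n → ℝ) (Λ : ℝ) : Prop :=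
  ∀ (a : E n) (r : ℝ), 0 < r → ⨍ x in cube a r, |f x - ⨍ y in cube a r, f y| ≤ Λ

/-- The mean square oscillation of `f` over every cube is at most `K`. -/
def MeanSqOsc (f : E n → ℝ) (K : ℝ) : Prop :=
  ∀ (a : E n) (r : ℝ), 0 < r → ∫ x in cube a r, (f x - ⨍ y in cube a r, f y) ^ 2 ≤ K * r ^ n

/-- The inductive step of the John–Nirenberg inequality. A cube over which `|f - c|` has mean at
most `α` is halved; the bound passes from those children where the mean is still at most `α`, and
on the other ones the a priori bound `K` is paid for by the excess of the mean. -/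
lemma integral_sq_le_of_mean_le {f : E n → ℝ} (hf : Continuous f) {K : ℝ} (hK : MeanSqOsc f K)
    {α ε δ c : ℝ} (hα : 0 < α) (Q : Set (E n)) (hK0 : 0 ≤ K)
    (hδ : ∀ x ∈ Q, ∀ y ∈ Q, (∀ i, |x i - y i| ≤ δ) → |f x - f y| ≤ ε) (m : ℕ) :
    ∀ (a : E n) (r : ℝ), 0 < r → r ≤ 2 ^ m * δ → cube a r ⊆ Q →
      ∫ x in cube a r, |f x - c| ≤ α * r ^ n →
      ∫ x in cube a r, (f x - c) ^ 2 ≤ (α + ε) ^ 2 * r ^ n +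
        (K + 2 ^ n * α ^ 2) / α * ∫ x in cube a r, |f x - c| := by
  have hKα : 0 ≤ (K + 2 ^ n * α ^ 2) / α := by positivity
  induction m with
  | zero =>
    intro a r hr hrδ hQ hA
    have hpt : ∀ x ∈ cube a r, (f x - c) ^ 2 ≤ (α + ε) ^ 2 := by
      intro x hx
      have h1 : ∀ y ∈ cube a r, |f x - c| ≤ |f y - c| + ε := by
        intro y hy
        have := hδ x (hQ hx) y (hQ hy) fun i => by
          rw [abs_le]
          have h1 := hx i
          have h2 := hy i
          simp only [pow_zero, one_mul] at hrδ
          constructor <;> linarith [h1.1, h1.2, h2.1, h2.2]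
        have h3 : f x - c = (f x - f y) + (f y - c) := by ring
        rw [h3]
        linarith [abs_add_le (f x - f y) (f y - c)]
      have h2 : |f x - c| * r ^ n ≤ (α + ε) * r ^ n := by
        have := setIntegral_mono_on (μ := volume) (f := fun _ => |f x - c|)
          (g := fun y => |f y - c| + ε) (integrableOn_cube continuous_const a r)
          (integrableOn_cube (by fun_prop) a r) (measurableSet_cube a r) h1
        rw [integral_cube_const a hr.le, integral_add (integrableOn_cube (by fun_prop) a r)
          (integrableOn_cube continuous_const a r), integral_cube_const a hr.le] at this
        linarith
      have h3 : |f x - c| ≤ α + ε := le_of_mul_le_mul_right h2 (by positivity)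
      rw [← sq_abs]
      exact pow_le_pow_left₀ (abs_nonneg _) h3 2
    have h1 := setIntegral_mono_on (μ := volume) (integrableOn_cube (by fun_prop) a r)
      (integrableOn_cube continuous_const a r) (measurableSet_cube a r) hpt
    rw [integral_cube_const a hr.le] at h1
    have h2 : 0 ≤ ∫ x in cube a r, |f x - c| := integral_nonneg fun _ => abs_nonneg _
    have := mul_nonneg hKα h2
    linarith
  | succ m ih =>
    intro a r hr hrδ hQ hA
    have hr2 : 0 < r / 2 := by positivity
    rw [integral_cube_eq_sum_children a hr.le (integrableOn_cube (by fun_prop) a r),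
      integral_cube_eq_sum_children (f := fun x => |f x - c|) a hr.le
        (integrableOn_cube (by fun_prop) a r)]
    have hvol : ∑ _σ : Fin n → Bool, (r / 2) ^ n = r ^ n := by
      simp [div_pow]; field_simp
    rw [← hvol, Finset.mul_sum, Finset.mul_sum, ← Finset.sum_add_distrib]
    refine Finset.sum_le_sum fun σ _ => ?_
    set q := childCorner a r σ
    have hqQ : cube q (r / 2) ⊆ Q := (childCube_subset a hr.le σ).trans hQ
    rcases le_or_gt (∫ x in cube q (r / 2), |f x - c|) (α * (r / 2) ^ n) with hle | hgt
    · exact ih q (r / 2) hr2 (by rw [pow_succ] at hrδ; linarith) hqQ hle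
    · set A := ∫ x in cube q (r / 2), |f x - c| with hAdef
      have hA2 : A ≤ 2 ^ n * α * (r / 2) ^ n := by
        calc A ≤ ∫ x in cube a r, |f x - c| := setIntegral_mono_set
              (integrableOn_cube (by fun_prop) a r) (Eventually.of_forall fun _ => abs_nonneg _)
              (childCube_subset a hr.le σ).eventuallyLE
          _ ≤ α * r ^ n := hA
          _ = _ := by rw [div_pow]; field_simp
      have hV : 0 < (r / 2) ^ n := by positivity
      have hmean : |⨍ x in cube q (r / 2), (f x - c)| * (r / 2) ^ n ≤ A := by
        have h1 := average_cube_mul (fun x => f x - c) q hr2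
        have h2 : |∫ x in cube q (r / 2), (f x - c)| ≤ A := abs_integral_le_integral_abs
        rw [← h1, abs_mul, abs_of_pos hV] at h2
        exact h2
      rw [integral_cube_sq_sub hf q hr2 c]
      have h1 := hK q (r / 2) hr2
      set μ := ⨍ x in cube q (r / 2), (f x - c)
      set V := (r / 2) ^ n
      have h2 : K * V ≤ K / α * A := by
        rw [div_mul_eq_mul_div, le_div_iff₀ hα]
        nlinarith
      have h3 : μ ^ 2 * V ≤ 2 ^ n * α * A := by
        have : |μ| ≤ 2 ^ n * α := by
          refine le_of_mul_le_mul_right (hmean.trans hA2) hV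
        calc μ ^ 2 * V = |μ| * (|μ| * V) := by rw [← sq_abs]; ring
          _ ≤ (2 ^ n * α) * A := by gcongr
      have h4 : (K + 2 ^ n * α ^ 2) / α * A = K / α * A + 2 ^ n * α * A := by
        field_simp
      have h5 : 0 ≤ (α + ε) ^ 2 * V := by positivity
      rw [h4]
      linarith

/-- The John–Nirenberg inequality in `L²` form, for bounded continuous functions. -/
theorem MeanOsc.meanSqOsc {f : E n → ℝ} (hf : Continuous f) {C : ℝ} (hC : ∀ x, |f x| ≤ C)
    {Λ : ℝ} (hΛ : 0 < Λ) (h : MeanOsc f Λ) : MeanSqOsc f ((8 + 4 * 2 ^ n) * Λ ^ 2) := by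
  set S : Set ℝ := {s | ∃ (a : E n) (r : ℝ), 0 < r ∧
    s = (∫ x in cube a r, (f x - ⨍ y in cube a r, f y) ^ 2) / r ^ n} with hS
  have hC0 : 0 ≤ C := (abs_nonneg _).trans (hC 0)
  have hSbdd : BddAbove S := by
    refine ⟨C ^ 2, ?_⟩
    rintro s ⟨a, r, hr, rfl⟩
    rw [div_le_iff₀ (by positivity)]
    have h1 := integral_cube_sq_sub hf a hr 0
    have h2 : ∫ x in cube a r, (f x - 0) ^ 2 ≤ C ^ 2 * r ^ n := by
      rw [← integral_cube_const a hr.le]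
      refine integral_mono (integrableOn_cube (by fun_prop) a r)
        (integrableOn_cube continuous_const a r) fun x => ?_
      simp only [sub_zero, ← sq_abs (f x)]
      exact pow_le_pow_left₀ (abs_nonneg _) (hC x) 2
    have h3 : 0 ≤ (⨍ y in cube a r, f y - 0) ^ 2 * r ^ n := by positivity
    linarith
  have hSne : S.Nonempty := ⟨_, 0, 1, one_pos, rfl⟩
  set K := sSup S with hKdef
  have hKb : MeanSqOsc f K := fun a r hr => by
    rw [← div_le_iff₀ (by positivity)]
    exact le_csSup hSbdd ⟨a, r, hr, rfl⟩
  have hK0 : 0 ≤ K := by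
    refine le_csSup_of_le hSbdd ⟨0, 1, one_pos, rfl⟩ ?_
    have : 0 ≤ ∫ x in cube (0 : E n) 1, (f x - ⨍ y in cube (0 : E n) 1, f y) ^ 2 :=
      integral_nonneg fun _ => sq_nonneg _
    positivity
  have hKle : K ≤ 4 * Λ ^ 2 + (K + 2 ^ n * (2 * Λ) ^ 2) / 2 := by
    refine csSup_le hSne ?_
    rintro s ⟨a, r, hr, rfl⟩
    rw [div_le_iff₀ (by positivity)]
    set c := ⨍ y in cube a r, f y with hc
    have hA : ∫ x in cube a r, |f x - c| ≤ Λ * r ^ n := by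
      rw [← average_cube_mul _ a hr]
      exact mul_le_mul_of_nonneg_right (h a r hr) (by positivity)
    have hA0 : 0 ≤ ∫ x in cube a r, |f x - c| := integral_nonneg fun _ => abs_nonneg _
    have hkey : ∀ ε > 0, ∫ x in cube a r, (f x - c) ^ 2 ≤ (2 * Λ + ε) ^ 2 * r ^ n +
        (K + 2 ^ n * (2 * Λ) ^ 2) / (2 * Λ) * (Λ * r ^ n) := by
      intro ε hε
      have huc := (isCompact_cube a r).uniformContinuousOn_of_continuous hf.continuousOn
      rw [Metric.uniformContinuousOn_iff_le] at huc
      obtain ⟨η, hη, hη'⟩ := huc ε hε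
      set δ := η / (n + 1) with hδdef
      have hδ : 0 < δ := by positivity
      obtain ⟨m, hm⟩ := pow_unbounded_of_one_lt (r / δ) (one_lt_two : (1 : ℝ) < 2)
      have hosc : ∀ x ∈ cube a r, ∀ y ∈ cube a r, (∀ i, |x i - y i| ≤ δ) → |f x - f y| ≤ ε := by
        intro x hx y hy hxy
        refine hη' x hx y hy ?_
        rw [dist_eq_norm, EuclideanSpace.norm_eq]
        refine Real.sqrt_le_iff.2 ⟨hη.le, ?_⟩
        calc ∑ i, ‖(x - y) i‖ ^ 2 ≤ ∑ _i : Fin n, δ ^ 2 := by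
              refine Finset.sum_le_sum fun i _ => pow_le_pow_left₀ (norm_nonneg _) ?_ 2
              simpa using hxy i
          _ = n * δ ^ 2 := by simp
          _ ≤ (n + 1) ^ 2 * δ ^ 2 := by
              refine mul_le_mul_of_nonneg_right ?_ (sq_nonneg _)
              have : (0 : ℝ) ≤ n := Nat.cast_nonneg n
              nlinarith
          _ = η ^ 2 := by rw [hδdef]; field_simp
      have := integral_sq_le_of_mean_le hf hKb (α := 2 * Λ) (ε := ε) (δ := δ) (c := c)
        (by positivity) (cube a r) hK0 hosc m a r hr
        (by rw [div_lt_iff₀ hδ] at hm; exact hm.le) subset_rfl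
        (hA.trans (by nlinarith [pow_pos hr n, mul_pos hΛ (pow_pos hr n)]))
      refine this.trans ?_
      gcongr
    have hlim : Tendsto (fun ε : ℝ => (2 * Λ + ε) ^ 2 * r ^ n +
        (K + 2 ^ n * (2 * Λ) ^ 2) / (2 * Λ) * (Λ * r ^ n)) (𝓝[>] 0)
        (𝓝 ((2 * Λ + 0) ^ 2 * r ^ n + (K + 2 ^ n * (2 * Λ) ^ 2) / (2 * Λ) * (Λ * r ^ n))) := by
      refine (Continuous.tendsto ?_ 0).mono_left nhdsWithin_le_nhds
      fun_prop
    refine (ge_of_tendsto hlim (eventually_nhdsWithin_of_forall fun ε hε => hkey ε hε)).trans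
      (le_of_eq ?_)
    field_simp
    ring
  intro a r hr
  refine (hKb a r hr).trans (mul_le_mul_of_nonneg_right ?_ (by positivity))
  nlinarith

/-! ### Integrals against decaying weights -/

/-- The cube `[-(k+1), k+1]ⁿ`. -/
noncomputable def centeredCube (n k : ℕ) : Set (E n) :=
  cube (WithLp.toLp 2 fun _ => -((k : ℝ) + 1)) (2 * (k + 1))

lemma measurableSet_centeredCube (k : ℕ) : MeasurableSet (centeredCube n k) :=
  measurableSet_cube _ _

lemma mem_centeredCube_floor (z : E n) : z ∈ centeredCube n ⌊‖z‖⌋₊ := by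
  intro i
  have h1 := abs_le.1 ((abs_apply_le_norm z i).trans (Nat.lt_floor_add_one ‖z‖).le)
  simp only [mem_Icc]
  constructor <;> linarith [h1.1, h1.2]

lemma centeredCube_mono {k l : ℕ} (h : k ≤ l) : centeredCube n k ⊆ centeredCube n l := by
  have h' : (k : ℝ) ≤ l := by exact_mod_cast h
  intro z hz i
  have := hz i
  simp only [mem_Icc] at this ⊢
  constructor <;> linarith [this.1, this.2]

/-- A function dominated by `w ⌊‖z‖⌋ * g z` is integrable as soon as the weights `w k` compensate
for the growth of the integrals of `g` over the cubes `[-(k+1), k+1]ⁿ`. -/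
lemma integrable_of_cube_growth {w D : ℕ → ℝ} (hw : ∀ k, 0 ≤ w k) {g h : E n → ℝ}
    (hg : ∀ z, 0 ≤ g z) (hgi : ∀ k, IntegrableOn g (centeredCube n k))
    (hgm : AEStronglyMeasurable g volume)
    (hD : ∀ k, ∫ z in centeredCube n k, g z ≤ D k) (hsum : Summable fun k => w k * D k)
    (hm : AEStronglyMeasurable h volume) (hh : ∀ z, |h z| ≤ w ⌊‖z‖⌋₊ * g z) :
    Integrable h ∧ ∫ z, |h z| ≤ ∑' k, w k * D k := by
  have hD0 : ∀ k, 0 ≤ D k := fun k => (integral_nonneg fun z => hg z).trans (hD k)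
  have key : ∫⁻ z, ENNReal.ofReal |h z| ≤ ENNReal.ofReal (∑' k, w k * D k) := by
    calc ∫⁻ z, ENNReal.ofReal |h z|
        ≤ ∫⁻ z, ∑' k, ENNReal.ofReal (w k) *
            (centeredCube n k).indicator (fun z => ENNReal.ofReal (g z)) z := by
          refine lintegral_mono fun z => ?_
          refine le_trans ?_ (ENNReal.le_tsum ⌊‖z‖⌋₊)
          rw [indicator_of_mem (mem_centeredCube_floor z), ← ENNReal.ofReal_mul (hw _)]
          exact ENNReal.ofReal_le_ofReal (hh z)
      _ = ∑' k, ENNReal.ofReal (w k) * ∫⁻ z in centeredCube n k, ENNReal.ofReal (g z) := by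
          rw [lintegral_tsum]
          · refine tsum_congr fun k => ?_
            rw [lintegral_const_mul' _ _ ENNReal.ofReal_ne_top,
              lintegral_indicator (measurableSet_centeredCube k)]
          · exact fun k => ((hgm.aemeasurable.ennreal_ofReal).indicator
              (measurableSet_centeredCube k)).const_mul _
      _ ≤ ∑' k, ENNReal.ofReal (w k * D k) := by
          refine ENNReal.tsum_le_tsum fun k => ?_
          rw [ENNReal.ofReal_mul (hw k), ← ofReal_integral_eq_lintegral_ofReal (hgi k)
            (Eventually.of_forall hg)]
          gcongr
          exact hD k
      _ = ENNReal.ofReal (∑' k, w k * D k) :=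
          (ENNReal.ofReal_tsum_of_nonneg (fun k => mul_nonneg (hw k) (hD0 k)) hsum).symm
  have hint : Integrable h := by
    refine ⟨hm, ?_⟩
    rw [hasFiniteIntegral_iff_norm]
    exact key.trans_lt ENNReal.ofReal_lt_top
  refine ⟨hint, ?_⟩
  rw [integral_eq_lintegral_of_nonneg_ae (Eventually.of_forall fun z => abs_nonneg _)
    hint.abs.aestronglyMeasurable]
  exact ENNReal.toReal_le_of_le_ofReal
    (tsum_nonneg fun k => mul_nonneg (hw k) (hD0 k)) key

lemma centeredCube_side_pos (k : ℕ) : (0 : ℝ) < 2 * (k + 1) := by positivity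

/-- A function of bounded mean square oscillation grows at most polynomially in quadratic mean. -/
lemma MeanSqOsc.integral_centeredCube_le {f : E n → ℝ} (hf : Continuous f) {K : ℝ}
    (hK : MeanSqOsc f K) (k : ℕ) :
    ∫ z in centeredCube n k, (f z - ⨍ y in centeredCube n 0, f y) ^ 2 ≤
      2 * 2 ^ n * K * ((k : ℝ) + 1) ^ (2 * n) := by
  have hr := centeredCube_side_pos k
  have h0 := centeredCube_side_pos 0
  set V : ℝ := (2 * ((k : ℝ) + 1)) ^ n with hV
  have hVe : V = 2 ^ n * ((k : ℝ) + 1) ^ n := mul_pow _ _ _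
  set fk := ⨍ y in centeredCube n k, f y with hfk
  set c := ⨍ y in centeredCube n 0, f y with hc
  have e1 : ∫ z in centeredCube n k, (f z - c) ^ 2 =
      (∫ z in centeredCube n k, (f z - fk) ^ 2) + (fk - c) ^ 2 * V := by
    have h1 := integral_cube_sq_sub hf (WithLp.toLp 2 fun _ => -((k : ℝ) + 1)) hr c
    rwa [average_cube_sub (integrableOn_cube hf _ _) hr] at h1
  have e2 : ∫ z in centeredCube n 0, (f z - fk) ^ 2 =
      (∫ z in centeredCube n 0, (f z - c) ^ 2) + (c - fk) ^ 2 * 2 ^ n := by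
    have h1 := integral_cube_sq_sub hf (WithLp.toLp 2 fun _ => -(((0 : ℕ) : ℝ) + 1)) h0 fk
    rw [average_cube_sub (integrableOn_cube hf _ _) h0] at h1
    simpa [centeredCube, hc] using h1
  have h1 : ∫ z in centeredCube n k, (f z - fk) ^ 2 ≤ K * V := hK _ _ hr
  have h2 : ∫ z in centeredCube n 0, (f z - fk) ^ 2 ≤ ∫ z in centeredCube n k, (f z - fk) ^ 2 :=
    setIntegral_mono_set (integrableOn_cube (by fun_prop) _ _)
      (Eventually.of_forall fun _ => sq_nonneg _) (centeredCube_mono (Nat.zero_le k)).eventuallyLE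
  have h3 : 0 ≤ ∫ z in centeredCube n 0, (f z - c) ^ 2 := integral_nonneg fun _ => sq_nonneg _
  have h4 : 0 ≤ ∫ z in centeredCube n k, (f z - fk) ^ 2 := integral_nonneg fun _ => sq_nonneg _
  have hp : (0 : ℝ) < 2 ^ n := by positivity
  have hV0 : 0 < V := by positivity
  have hK0 : 0 ≤ K := by
    by_contra hneg
    have := mul_neg_of_neg_of_pos (not_le.1 hneg) hV0
    linarith
  have h5 : (fk - c) ^ 2 ≤ K * ((k : ℝ) + 1) ^ n := by
    have : (fk - c) ^ 2 * 2 ^ n ≤ K * ((k : ℝ) + 1) ^ n * 2 ^ n := by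
      have e : (c - fk) ^ 2 = (fk - c) ^ 2 := by ring
      rw [e] at e2
      calc (fk - c) ^ 2 * 2 ^ n ≤ K * V := by linarith
        _ = _ := by rw [hVe]; ring
    exact le_of_mul_le_mul_right this hp
  have h6 : (1 : ℝ) ≤ ((k : ℝ) + 1) ^ n := one_le_pow₀ (by linarith [Nat.cast_nonneg (α := ℝ) k])
  calc ∫ z in centeredCube n k, (f z - c) ^ 2 ≤ K * V + K * ((k : ℝ) + 1) ^ n * V := by
        rw [e1]; gcongr
    _ ≤ K * ((k : ℝ) + 1) ^ n * V + K * ((k : ℝ) + 1) ^ n * V := by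
        gcongr
        nlinarith
    _ = _ := by rw [hVe]; ring

/-- The weights `sup {gauss z : k ≤ ‖z‖}`. -/
noncomputable def gaussWeight (n k : ℕ) : ℝ :=
  (2 * Real.pi) ^ (-(n : ℝ) / 2) * Real.exp (-(1 / 2) * (k : ℝ) ^ 2)

lemma gauss_le_gaussWeight (z : E n) : gauss z ≤ gaussWeight n ⌊‖z‖⌋₊ := by
  unfold gauss gaussWeight
  have := Nat.floor_le (norm_nonneg z)
  gcongr _ * Real.exp ?_
  nlinarith [Nat.cast_nonneg (α := ℝ) ⌊‖z‖⌋₊]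

lemma summable_gaussWeight (n m : ℕ) :
    Summable fun k : ℕ => gaussWeight n k * ((k : ℝ) + 1) ^ m := by
  have h := ((summable_nat_add_iff 1).2 (Real.summable_pow_mul_exp_neg_nat_mul m one_pos)).mul_left
    ((2 * Real.pi) ^ (-(n : ℝ) / 2) * Real.exp (3 / 2))
  refine Summable.of_nonneg_of_le (fun k => by unfold gaussWeight; positivity) (fun k => ?_) h
  have : Real.exp (-(1 / 2) * (k : ℝ) ^ 2) ≤ Real.exp (3 / 2) * Real.exp (-1 * ((k + 1 : ℕ) : ℝ)) := by
    rw [← Real.exp_add]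
    refine Real.exp_le_exp.2 ?_
    push_cast
    nlinarith [sq_nonneg ((k : ℝ) - 1)]
  unfold gaussWeight
  calc _ ≤ (2 * Real.pi) ^ (-(n : ℝ) / 2) *
        (Real.exp (3 / 2) * Real.exp (-1 * ((k + 1 : ℕ) : ℝ))) * ((k : ℝ) + 1) ^ m := by gcongr
    _ = _ := by push_cast; ring

/-- The constant relating the Gaussian variance to the mean square oscillation over cubes. -/
noncomputable def garsiaConst (n : ℕ) : ℝ :=
  ∑' k : ℕ, gaussWeight n k * (2 * 2 ^ n * ((k : ℝ) + 1) ^ (2 * n))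

lemma summable_garsia (n : ℕ) :
    Summable fun k : ℕ => gaussWeight n k * (2 * 2 ^ n * ((k : ℝ) + 1) ^ (2 * n)) := by
  refine ((summable_gaussWeight n (2 * n)).mul_left (2 * 2 ^ n)).congr fun k => by ring

lemma garsiaConst_nonneg (n : ℕ) : 0 ≤ garsiaConst n :=
  tsum_nonneg fun k => by unfold gaussWeight; positivity

/-- The Gaussian weights sum up the square oscillations over the cubes `[-(k+1), k+1]ⁿ`, which grow
only polynomially in `k`. -/
lemma MeanSqOsc.integral_gauss_le {f : E n → ℝ} (hf : Continuous f) {K : ℝ}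
    (hK : MeanSqOsc f K) : ∃ c, ∫ z, gauss z * (f z - c) ^ 2 ≤ garsiaConst n * K := by
  refine ⟨⨍ y in centeredCube n 0, f y, ?_⟩
  set c := ⨍ y in centeredCube n 0, f y
  have hg := continuous_gauss (n := n)
  have h := integrable_of_cube_growth (w := gaussWeight n)
    (D := fun k => 2 * 2 ^ n * K * ((k : ℝ) + 1) ^ (2 * n))
    (g := fun z => (f z - c) ^ 2) (h := fun z => gauss z * (f z - c) ^ 2)
    (fun k => by unfold gaussWeight; positivity) (fun z => sq_nonneg _)
    (fun k => integrableOn_cube (by fun_prop) _ _)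
    (Continuous.aestronglyMeasurable (by fun_prop))
    (hK.integral_centeredCube_le hf)
    (((summable_garsia n).mul_right K).congr fun k => by ring)
    (Continuous.aestronglyMeasurable (by fun_prop))
    (fun z => by
      rw [abs_of_nonneg (mul_nonneg (gauss_nonneg z) (sq_nonneg _))]
      exact mul_le_mul_of_nonneg_right (gauss_le_gaussWeight z) (sq_nonneg _))
  refine (integral_mono_of_nonneg (Eventually.of_forall fun z =>
    mul_nonneg (gauss_nonneg z) (sq_nonneg _)) h.1.abs
    (Eventually.of_forall fun z => le_abs_self _)).trans (h.2.trans (le_of_eq ?_))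
  rw [garsiaConst, ← tsum_mul_right]
  exact tsum_congr fun k => by ring

/-! ### Invariance under translations and dilations -/

lemma integral_cube_comp (F : E n → ℝ) (x a : E n) {s : ℝ} (hs : 0 < s) (r : ℝ) :
    ∫ z in cube a r, F (x + s • z) = (s ^ n)⁻¹ * ∫ y in cube (x + s • a) (s * r), F y := by
  rw [← integral_indicator (measurableSet_cube _ _), ← integral_indicator (measurableSet_cube _ _)]
  have e : ∀ z, (cube a r).indicator (fun z => F (x + s • z)) z =
      (cube (x + s • a) (s * r)).indicator F (x + s • z) := by
    intro z
    by_cases hz : z ∈ cube a r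
    · rw [indicator_of_mem hz, indicator_of_mem]
      intro i
      have := hz i
      simp only [PiLp.add_apply, PiLp.smul_apply, smul_eq_mul, mem_Icc] at this ⊢
      constructor <;> nlinarith [this.1, this.2]
    · rw [indicator_of_notMem hz, indicator_of_notMem]
      intro h
      refine hz fun i => ?_
      have := h i
      simp only [PiLp.add_apply, PiLp.smul_apply, smul_eq_mul, mem_Icc] at this ⊢
      constructor <;> nlinarith [this.1, this.2]
  simp_rw [e]
  rw [Measure.integral_comp_smul volume
    (fun z => (cube (x + s • a) (s * r)).indicator F (x + z)) s,
    integral_add_left_eq_self ((cube (x + s • a) (s * r)).indicator F) x, smul_eq_mul,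
    finrank_euclideanSpace_fin, abs_of_pos (by positivity)]

lemma average_cube_comp (F : E n → ℝ) (x a : E n) {s : ℝ} (hs : 0 < s) {r : ℝ} (hr : 0 < r) :
    ⨍ z in cube a r, F (x + s • z) = ⨍ y in cube (x + s • a) (s * r), F y := by
  rw [average_cube _ _ hr.le, average_cube _ _ (by positivity), integral_cube_comp F x a hs, mul_pow]
  field_simp

lemma MeanSqOsc.comp {f : E n → ℝ} {K : ℝ} (h : MeanSqOsc f K) (x : E n) {s : ℝ} (hs : 0 < s) :
    MeanSqOsc (fun z => f (x + s • z)) K := by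
  intro a r hr
  rw [average_cube_comp f x a hs hr,
    integral_cube_comp (fun y => (f y - ⨍ y in cube (x + s • a) (s * r), f y) ^ 2) x a hs]
  have := h (x + s • a) (s * r) (by positivity)
  rw [inv_mul_le_iff₀ (by positivity)]
  refine this.trans (le_of_eq ?_)
  rw [mul_pow]; ring

lemma MeanSqOsc.garsiaBound {f : E n → ℝ} (hf : Continuous f) {C : ℝ} (hC : ∀ x, |f x| ≤ C) {K : ℝ}
    (h : MeanSqOsc f K) (hK : 0 ≤ K) : GarsiaBound f (garsiaConst n * K) := by
  intro t ht x
  rcases ht.eq_or_lt with rfl | ht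
  · rw [heat_zero, heat_zero]
    have := mul_nonneg (garsiaConst_nonneg n) hK
    linarith [show f x * f x - f x ^ 2 = 0 by ring]
  · obtain ⟨c, hc⟩ := (h.comp x ht).integral_gauss_le (by fun_prop)
    rw [gaussian_variance hf hC t x c] at hc
    linarith [sq_nonneg (heat f t x - c)]

lemma BddDeriv.const_mul {m : ℕ} {f : E n → ℝ} (h : BddDeriv m f) (κ : ℝ) :
    BddDeriv m (fun x => κ * f x) := by
  have hc : ∀ (m : ℕ) (κ : ℝ), BddDeriv m (fun _ : E n => κ) := by
    intro m
    induction m with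
    | zero => exact fun κ => ⟨contDiff_const, |κ|, fun _ => le_rfl⟩
    | succ m ih =>
      refine fun κ => ⟨⟨contDiff_const, |κ|, fun _ => le_rfl⟩, fun k => ?_⟩
      have : BMOElliptic.pd k (fun _ : E n => κ) = fun _ => 0 := by
        funext x; simp [BMOElliptic.pd]
      rw [this]; exact ih 0
  exact (hc m κ).mul h

/-- The constant of the div-curl estimate. -/
noncomputable def divCurlConst (n : ℕ) : ℝ :=
  21 * n * (Real.sqrt (2 * (garsiaConst n * (8 + 4 * 2 ^ n))) + 1)

lemma divCurlConst_nonneg (n : ℕ) : 0 ≤ divCurlConst n := by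
  unfold divCurlConst; positivity

lemma MeanOsc.const_mul {f : E n → ℝ} {Λ : ℝ} (h : MeanOsc f Λ) {κ : ℝ} (hκ : 0 ≤ κ) :
    MeanOsc (fun x => κ * f x) (κ * Λ) := by
  intro a r hr
  have e1 : (⨍ y in cube a r, κ * f y) = κ * ⨍ y in cube a r, f y := by
    rw [average_cube _ _ hr.le, average_cube _ _ hr.le, integral_const_mul]; ring
  have e2 : (⨍ x in cube a r, |κ * f x - κ * ⨍ y in cube a r, f y|) =
      κ * ⨍ x in cube a r, |f x - ⨍ y in cube a r, f y| := by
    generalize (⨍ y in cube a r, f y) = m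
    rw [average_cube _ _ hr.le, average_cube _ _ hr.le]
    simp_rw [← mul_sub, abs_mul, abs_of_nonneg hκ, integral_const_mul]
    ring
  rw [e1, e2]
  exact mul_le_mul_of_nonneg_left (h a r hr) hκ

/-- Scaling `b` to have Gaussian variance at most `1/2` makes the div-curl estimate homogeneous in
the `BMO` semi-norm. -/
theorem div_curl_smooth_of_meanOsc {b : E n → ℝ} (hb : BddDeriv 2 b) {Λ : ℝ} (hΛ : 0 < Λ)
    (h : MeanOsc b Λ) (u v : 𝓢(E n, ℝ)) (i j : Fin n) :
    |∫ x, b x * (dS j u x * dS i v x - dS i u x * dS j v x)| ≤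
      divCurlConst n * Λ * (gradSq u + gradSq v) := by
  set D := Real.sqrt (2 * (garsiaConst n * (8 + 4 * 2 ^ n))) + 1 with hD
  have hD0 : 0 < D := by positivity
  set κ := (Λ * D)⁻¹ with hκ
  have hκ0 : 0 < κ := by positivity
  have hb' := hb.const_mul κ
  obtain ⟨C, hC⟩ := hb'.bdd
  have hosc := h.const_mul hκ0.le
  have hκΛ : κ * Λ = D⁻¹ := by rw [hκ]; field_simp
  have hG := (hosc.meanSqOsc hb'.continuous hC (by positivity)).garsiaBound hb'.continuous hC
    (by positivity)
  have hle : garsiaConst n * ((8 + 4 * 2 ^ n) * (κ * Λ) ^ 2) ≤ 1 / 2 := by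
    rw [hκΛ, inv_pow, ← mul_assoc, mul_inv_le_iff₀ (by positivity)]
    have h0 : 0 ≤ 2 * (garsiaConst n * (8 + 4 * 2 ^ n)) := by
      have := garsiaConst_nonneg n; positivity
    have h1 := Real.sq_sqrt h0
    have h2 := Real.sqrt_nonneg (2 * (garsiaConst n * (8 + 4 * 2 ^ n)))
    rw [hD]
    nlinarith
  have := div_curl_smooth hb' (fun t ht x => (hG t ht x).trans hle) u v i j
  have e : ∫ x, κ * b x * (dS j u x * dS i v x - dS i u x * dS j v x) =
      κ * ∫ x, b x * (dS j u x * dS i v x - dS i u x * dS j v x) := by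
    rw [← integral_const_mul]; congr 1; funext x; ring
  rw [e, abs_mul, abs_of_pos hκ0, hκ, inv_mul_le_iff₀ (by positivity)] at this
  refine this.trans (le_of_eq ?_)
  rw [divCurlConst]; ring

/-! ### Mollification -/

/-- The convolution of `ψ` and `f`. -/
noncomputable def mollify (ψ f : E n → ℝ) (x : E n) : ℝ := ∫ t, ψ t * f (x - t)

lemma mollify_eq_convolution (ψ f : E n → ℝ) :
    mollify ψ f = convolution ψ f (ContinuousLinearMap.lsmul ℝ ℝ) volume := rfl

lemma locallyIntegrable_of_bdd {f : E n → ℝ} (hf : Measurable f) {C : ℝ} (hC : ∀ x, |f x| ≤ C) :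
    LocallyIntegrable f volume :=
  (locallyIntegrable_const C).mono hf.aestronglyMeasurable
    (Eventually.of_forall fun x => (hC x).trans (le_abs_self C))

/-- A mollification of a bounded function is smooth with bounded derivatives, since derivatives fall
on the kernel. -/
lemma bddDeriv_mollify {f : E n → ℝ} (hf : Measurable f) {C : ℝ} (hC : ∀ x, |f x| ≤ C) (m : ℕ) :
    ∀ {ψ : E n → ℝ}, ContDiff ℝ ∞ ψ → HasCompactSupport ψ → BddDeriv m (mollify ψ f) := by
  have hloc := locallyIntegrable_of_bdd hf hC
  have h0 : ∀ {ψ : E n → ℝ}, ContDiff ℝ ∞ ψ → HasCompactSupport ψ →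
      ContDiff ℝ ∞ (mollify ψ f) ∧ ∃ C, ∀ x, |mollify ψ f x| ≤ C := by
    intro ψ hψ hc
    refine ⟨by
      rw [mollify_eq_convolution]
      exact hc.contDiff_convolution_left _ hψ hloc, (∫ t, |ψ t| * C), fun x => ?_⟩
    have hi : Integrable ψ := hψ.continuous.integrable_of_hasCompactSupport hc
    rw [← Real.norm_eq_abs]
    refine norm_integral_le_of_norm_le (hi.abs.mul_const C) (Eventually.of_forall fun t => ?_)
    rw [norm_mul]
    exact mul_le_mul_of_nonneg_left (hC _) (norm_nonneg _)
  induction m with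
  | zero => exact h0
  | succ m ih =>
    intro ψ hψ hc
    refine ⟨h0 hψ hc, fun k => ?_⟩
    have hψ' : ContDiff ℝ ∞ (pd k ψ) :=
      (hψ.fderiv_right (m := ∞) (by simp)).clm_apply contDiff_const
    have hc' : HasCompactSupport (pd k ψ) := hc.fderiv_apply ℝ (basisVec k)
    have e : pd k (mollify ψ f) = mollify (pd k ψ) f := by
      funext x
      have h1 := hc.hasFDerivAt_convolution_left (ContinuousLinearMap.lsmul ℝ ℝ)
        (hψ.of_le (by simp)) hloc x
      have h2 : ConvolutionExists (fderiv ℝ ψ) f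
          ((ContinuousLinearMap.lsmul ℝ ℝ).precompL (E n)) volume :=
        (hc.fderiv ℝ).convolutionExists_left _ (hψ.continuous_fderiv (by simp)) hloc
      unfold pd
      rw [mollify_eq_convolution, h1.fderiv, convolution_def,
        ContinuousLinearMap.integral_apply (h2 x)]
      rfl
    rw [e]
    exact ih hψ' hc'

/-- Up to a factor of two, the mean oscillation is the distance to the nearest constant. -/
lemma integral_abs_sub_average_le {f : E n → ℝ} {a : E n} {r : ℝ} (hr : 0 < r)
    (hf : IntegrableOn f (cube a r)) (c : ℝ) :
    ⨍ x in cube a r, |f x - ⨍ y in cube a r, f y| ≤ 2 * ⨍ x in cube a r, |f x - c| := by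
  have hV : 0 < r ^ n := by positivity
  have hc : IntegrableOn (fun x => f x - c) (cube a r) :=
    hf.sub (integrableOn_cube continuous_const a r)
  have hm : |c - ⨍ y in cube a r, f y| ≤ ⨍ x in cube a r, |f x - c| := by
    rw [abs_sub_comm, ← average_cube_sub hf hr, average_cube _ _ hr.le, average_cube _ _ hr.le,
      abs_mul, abs_of_pos (inv_pos.2 hV)]
    exact mul_le_mul_of_nonneg_left abs_integral_le_integral_abs (by positivity)
  set m := ⨍ y in cube a r, f y
  have h1 : ∫ x in cube a r, |f x - m| ≤ ∫ x in cube a r, (|f x - c| + |c - m|) := by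
    refine integral_mono (hf.sub (integrableOn_cube continuous_const a r)).abs
      (hc.abs.add (integrableOn_cube continuous_const a r)) fun x => ?_
    have : f x - m = (f x - c) + (c - m) := by ring
    simp only [this]
    exact abs_add_le _ _
  rw [integral_add hc.abs (integrableOn_cube continuous_const a r), integral_cube_const a hr.le] at h1
  rw [average_cube _ _ hr.le] at hm ⊢
  rw [average_cube _ _ hr.le]
  set I := ∫ x in cube a r, |f x - c|
  rw [inv_mul_le_iff₀ hV]
  have h2 : |c - m| * r ^ n ≤ I := by
    calc |c - m| * r ^ n ≤ (r ^ n)⁻¹ * I * r ^ n := by gcongr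
      _ = I := by field_simp
  calc _ ≤ I + |c - m| * r ^ n := h1
    _ ≤ 2 * I := by linarith
    _ = _ := by field_simp

/-- Averaging over translates does not spoil the mean oscillation: over each cube the mollification
is compared with the average of the means of the translates. -/
lemma MeanOsc.mollify {f : E n → ℝ} (hf : Measurable f) {C : ℝ} (hC : ∀ x, |f x| ≤ C) {Λ : ℝ}
    (h : MeanOsc f Λ) {φ : E n → ℝ} (hφi : Integrable φ) (hφ0 : ∀ t, 0 ≤ φ t)
    (hφ1 : ∫ t, φ t = 1) (hmc : Continuous (mollify φ f)) :
    MeanOsc (mollify φ f) (2 * Λ) := by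
  intro a r hr
  have hV : 0 < r ^ n := by positivity
  have hfi : ∀ a' r', IntegrableOn f (cube a' r') := fun a' r' =>
    (locallyIntegrable_of_bdd hf hC).integrableOn_isCompact (isCompact_cube a' r')
  -- the mean of the translate `f (· - t)` over the cube
  set m : E n → ℝ := fun t => ⨍ x in cube (a - t) r, f x with hm
  have hshift : ∀ (F : E n → ℝ) t, ∫ x in cube a r, F (x - t) = ∫ x in cube (a - t) r, F x := by
    intro F t
    have := integral_cube_comp F (-t) a one_pos r
    simpa [neg_add_eq_sub] using this
  have hfin : IsFiniteMeasure ((volume : Measure (E n)).restrict (cube a r)) :=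
    ⟨by rw [Measure.restrict_apply_univ]; exact volume_cube_lt_top a r⟩
  have hF : Integrable (fun p : E n × E n => φ p.1 * f (p.2 - p.1))
      (volume.prod (volume.restrict (cube a r))) := by
    have h1 : Integrable (fun p : E n × E n => φ p.1) (volume.prod (volume.restrict (cube a r))) :=
      hφi.comp_fst _
    exact h1.mul_bdd (c := C) (hf.comp (measurable_snd.sub measurable_fst)).aestronglyMeasurable
      (Eventually.of_forall fun p => hC _)
  have hmφ : Integrable fun t => φ t * m t := by
    have h1 := hF.integral_prod_left
    refine (h1.const_mul ((r ^ n)⁻¹)).congr (Eventually.of_forall fun t => ?_)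
    simp only [integral_const_mul, hshift, hm]
    rw [average_cube _ _ hr.le]; ring
  have hG : Integrable (fun p : E n × E n => φ p.1 * |f (p.2 - p.1) - m p.1|)
      (volume.prod (volume.restrict (cube a r))) := by
    have h1 : Integrable (fun p : E n × E n => φ p.1 * m p.1)
        (volume.prod (volume.restrict (cube a r))) := hmφ.comp_fst _
    refine (hF.sub h1).abs.congr (Eventually.of_forall fun p => ?_)
    simp only [Pi.sub_apply]
    rw [← mul_sub, abs_mul, abs_of_nonneg (hφ0 _)]
  set c := ∫ t, φ t * m t with hc
  have hfx : ∀ x, Integrable fun t => φ t * f (x - t) := fun x =>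
    hφi.mul_bdd (c := C) (hf.comp (measurable_const.sub measurable_id)).aestronglyMeasurable
      (Eventually.of_forall fun t => hC _)
  have hpt : ∀ x, |BMOElliptic.mollify φ f x - c| ≤ ∫ t, φ t * |f (x - t) - m t| := by
    intro x
    have e : BMOElliptic.mollify φ f x - c = ∫ t, φ t * (f (x - t) - m t) := by
      rw [BMOElliptic.mollify, hc, ← integral_sub (hfx x) hmφ]
      congr 1; funext t; ring
    rw [e]
    refine abs_integral_le_integral_abs.trans (le_of_eq ?_)
    congr 1; funext t
    rw [abs_mul, abs_of_nonneg (hφ0 t)]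
  refine (integral_abs_sub_average_le hr (integrableOn_cube hmc a r) c).trans ?_
  refine mul_le_mul_of_nonneg_left ?_ zero_le_two
  rw [average_cube _ _ hr.le, inv_mul_le_iff₀ hV]
  calc ∫ x in cube a r, |BMOElliptic.mollify φ f x - c|
      ≤ ∫ x in cube a r, ∫ t, φ t * |f (x - t) - m t| :=
        integral_mono (integrableOn_cube (by fun_prop) a r) hG.integral_prod_right hpt
    _ = ∫ t, ∫ x in cube a r, φ t * |f (x - t) - m t| :=
        (integral_integral_swap (f := fun t x => φ t * |f (x - t) - m t|) hG).symm
    _ ≤ ∫ t, φ t * (r ^ n * Λ) := by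
        refine integral_mono hG.integral_prod_left (hφi.mul_const _) fun t => ?_
        simp only [integral_const_mul]
        refine mul_le_mul_of_nonneg_left ?_ (hφ0 t)
        rw [hshift (fun x => |f x - m t|) t, ← average_cube_mul _ _ hr, mul_comm]
        exact mul_le_mul_of_nonneg_left (h (a - t) r hr) hV.le
    _ = r ^ n * Λ := by rw [integral_mul_const, hφ1, one_mul]

lemma integrable_null_form (u v : 𝓢(E n, ℝ)) (i j : Fin n) :
    Integrable fun x => dS j u x * dS i v x - dS i u x * dS j v x := by
  have h : ∀ f g : 𝓢(E n, ℝ), Integrable fun x => f x * g x := fun f g =>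
    f.integrable.mul_bdd (c := SchwartzMap.seminorm ℝ 0 0 g) g.continuous.aestronglyMeasurable
      (Eventually.of_forall fun x => g.norm_le_seminorm ℝ x)
  exact (h _ _).sub (h _ _)

/-- The div-curl estimate for bounded coefficients; the bound depends on `f` only through its mean
oscillation. -/
theorem div_curl_bounded {f : E n → ℝ} (hf : Measurable f) {C : ℝ} (hC : ∀ x, |f x| ≤ C) {Λ : ℝ}
    (hΛ : 0 < Λ) (h : MeanOsc f Λ) (u v : 𝓢(E n, ℝ)) (i j : Fin n) :
    |∫ x, f x * (dS j u x * dS i v x - dS i u x * dS j v x)| ≤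
      divCurlConst n * (2 * Λ) * (gradSq u + gradSq v) := by
  let φ : ℕ → ContDiffBump (0 : E n) := fun N =>
    ⟨1 / ((N : ℝ) + 1), 2 / ((N : ℝ) + 1), by positivity, by gcongr; norm_num⟩
  have hlim : Tendsto (fun N => (φ N).rOut) atTop (𝓝 0) := by
    have : Tendsto (fun N : ℕ => 2 * (1 / ((N : ℝ) + 1))) atTop (𝓝 (2 * 0)) :=
      tendsto_one_div_add_atTop_nhds_zero_nat.const_mul 2
    simp only [mul_zero] at this
    refine this.congr fun N => ?_
    simp only [φ]; ring
  have hae := ContDiffBump.ae_convolution_tendsto_right_of_locallyIntegrable (K := 2)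
    (μ := (volume : Measure (E n))) hlim
    (Eventually.of_forall fun N => by simp only [φ]; apply le_of_eq; ring)
    (locallyIntegrable_of_bdd hf hC)
  set g : E n → ℝ := fun x => dS j u x * dS i v x - dS i u x * dS j v x
  have hg : Integrable g := integrable_null_form u v i j
  have hC0 : 0 ≤ C := (abs_nonneg _).trans (hC 0)
  have hsm : ∀ N, BddDeriv 2 (mollify ((φ N).normed volume) f) := fun N =>
    bddDeriv_mollify hf hC 2 (φ N).contDiff_normed (φ N).hasCompactSupport_normed
  have hφi : ∀ N, Integrable ((φ N).normed (volume : Measure (E n))) := fun N =>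
    (φ N).integrable_normed
  have hbd : ∀ N x, |mollify ((φ N).normed volume) f x| ≤ C := by
    intro N x
    rw [← Real.norm_eq_abs]
    have : ‖mollify ((φ N).normed volume) f x‖ ≤ ∫ t, (φ N).normed volume t * C := by
      refine norm_integral_le_of_norm_le ((hφi N).mul_const C) (Eventually.of_forall fun t => ?_)
      rw [norm_mul, Real.norm_of_nonneg ((φ N).nonneg_normed t)]
      exact mul_le_mul_of_nonneg_left (hC _) ((φ N).nonneg_normed t)
    rwa [integral_mul_const, (φ N).integral_normed, one_mul] at this
  have hconv : Tendsto (fun N => ∫ x, mollify ((φ N).normed volume) f x * g x) atTop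
      (𝓝 (∫ x, f x * g x)) := by
    refine tendsto_integral_of_dominated_convergence (fun x => C * |g x|)
      (fun N => ((hsm N).continuous.aestronglyMeasurable.mul hg.aestronglyMeasurable))
      (hg.abs.const_mul C) (fun N => Eventually.of_forall fun x => ?_) ?_
    · rw [norm_mul]
      exact mul_le_mul_of_nonneg_right (hbd N x) (abs_nonneg _)
    · filter_upwards [hae] with x hx
      exact hx.mul_const (g x)
  refine le_of_tendsto hconv.abs (Eventually.of_forall fun N => ?_)
  exact div_curl_smooth_of_meanOsc (hsm N) (by positivity)
    (h.mollify hf hC (hφi N) (fun t => (φ N).nonneg_normed t)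
      (φ N).integral_normed (hsm N).continuous) u v i j

/-! ### Truncation -/

lemma abs_truncate_le {N : ℝ} (hN : 0 ≤ N) (s : ℝ) : |truncate N s| ≤ N := by
  rw [abs_le]
  exact ⟨le_max_left _ _, max_le (by linarith) (min_le_left _ _)⟩

lemma abs_truncate_sub_le (N s t : ℝ) : |truncate N s - truncate N t| ≤ |s - t| := by
  unfold truncate
  refine (abs_max_sub_max_le_max _ _ _ _).trans ?_
  rw [sub_self, abs_zero, max_eq_right (abs_nonneg _)]
  refine (abs_min_sub_min_le_max _ _ _ _).trans ?_
  rw [sub_self, abs_zero, max_eq_right (abs_nonneg _)]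

lemma continuous_truncate (N : ℝ) : Continuous (truncate N) := by
  unfold truncate; fun_prop

lemma abs_truncate_le_abs {N : ℝ} (hN : 0 ≤ N) (s : ℝ) : |truncate N s| ≤ |s| := by
  have := abs_truncate_sub_le N s 0
  have h0 : truncate N 0 = 0 := by
    unfold truncate; rw [min_eq_right hN, max_eq_right (by linarith)]
  rwa [h0, sub_zero, sub_zero] at this

lemma tendsto_truncate (s : ℝ) : Tendsto (fun N : ℕ => truncate N s) atTop (𝓝 s) := by
  refine tendsto_const_nhds.congr' ?_
  obtain ⟨M, hM⟩ := exists_nat_ge |s|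
  filter_upwards [eventually_ge_atTop M] with N hN
  have h1 : |s| ≤ N := hM.trans (by exact_mod_cast hN)
  have h2 := abs_le.1 h1
  unfold truncate
  rw [min_eq_right h2.2, max_eq_right h2.1]

lemma MeanOsc.truncate {b : E n → ℝ} (hb : LocallyIntegrable b volume) {Λ : ℝ} (h : MeanOsc b Λ)
    (N : ℝ) : MeanOsc (fun x => truncate N (b x)) (2 * Λ) := by
  intro a r hr
  have hbi : IntegrableOn b (cube a r) := hb.integrableOn_isCompact (isCompact_cube a r)
  set m := ⨍ y in cube a r, b y with hm
  have hti : IntegrableOn (fun x => BMOElliptic.truncate N (b x)) (cube a r) := by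
    have h1 : IntegrableOn (fun x => |b x| + |BMOElliptic.truncate N 0|) (cube a r) :=
      hbi.abs.add (integrableOn_cube continuous_const a r)
    refine Integrable.mono' h1
      ((continuous_truncate N).comp_aestronglyMeasurable hbi.aestronglyMeasurable)
      (Eventually.of_forall fun x => ?_)
    have := abs_truncate_sub_le N (b x) 0
    rw [sub_zero] at this
    rw [Real.norm_eq_abs]
    have h3 := abs_sub_abs_le_abs_sub (BMOElliptic.truncate N (b x)) (BMOElliptic.truncate N 0)
    linarith
  refine (integral_abs_sub_average_le hr hti (BMOElliptic.truncate N m)).trans ?_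
  refine mul_le_mul_of_nonneg_left ?_ zero_le_two
  refine le_trans ?_ (h a r hr)
  rw [average_cube _ _ hr.le, average_cube _ _ hr.le]
  refine mul_le_mul_of_nonneg_left ?_ (by positivity)
  exact integral_mono (hti.sub (integrableOn_cube continuous_const a r)).abs
    (hbi.sub (integrableOn_cube continuous_const a r)).abs fun x => abs_truncate_sub_le N _ _

/-! ### The pairing with `BMO` for Schwartz functions -/

lemma BMOBound.meanOsc {b : E n → ℝ} {Λ : ℝ} (h : BMOBound b Λ) : MeanOsc b Λ := h.2

/-- The div-curl estimate for the truncations of a `BMO` function, uniformly in the height. The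
function is only measurable modulo null sets, so a measurable representative is used. -/
lemma BMOBound.div_curl_truncate {b : E n → ℝ} {Λ : ℝ} (hΛ : 0 < Λ) (h : BMOBound b Λ) (N : ℕ)
    (u v : 𝓢(E n, ℝ)) (i j : Fin n) :
    |∫ x, truncate N (b x) * (dS j u x * dS i v x - dS i u x * dS j v x)| ≤
      4 * divCurlConst n * Λ * (gradSq u + gradSq v) := by
  have hm := h.1.aestronglyMeasurable
  set b' := hm.mk b with hb'
  have hbb : b =ᵐ[volume] b' := hm.ae_eq_mk
  have hosc : MeanOsc (fun x => truncate N (b x)) (2 * Λ) := h.meanOsc.truncate h.1 N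
  have hosc' : MeanOsc (fun x => truncate N (b' x)) (2 * Λ) := by
    intro a r hr
    have e1 : (⨍ y in cube a r, truncate N (b' y)) = ⨍ y in cube a r, truncate N (b y) := by
      refine average_congr (ae_restrict_of_ae ?_)
      filter_upwards [hbb] with x hx
      rw [hx]
    rw [e1]
    refine le_trans (le_of_eq (average_congr (ae_restrict_of_ae ?_))) (hosc a r hr)
    filter_upwards [hbb] with x hx
    rw [hx]
  have hmeas : Measurable fun x => truncate N (b' x) :=
    (continuous_truncate N).measurable.comp hm.stronglyMeasurable_mk.measurable
  have := div_curl_bounded hmeas (fun x => abs_truncate_le (Nat.cast_nonneg N) _)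
    (by positivity) hosc' u v i j
  have e : ∫ x, truncate N (b x) * (dS j u x * dS i v x - dS i u x * dS j v x) =
      ∫ x, truncate N (b' x) * (dS j u x * dS i v x - dS i u x * dS j v x) := by
    refine integral_congr_ae ?_
    filter_upwards [hbb] with x hx
    rw [hx]
  rw [e]
  refine this.trans (le_of_eq ?_)
  ring

/-- A `BMO` function is integrable against every function with sufficient decay. -/
lemma BMOBound.integrable_mul {b : E n → ℝ} {Λ : ℝ} (h : BMOBound b Λ) {g : E n → ℂ}
    (hg : AEStronglyMeasurable g volume) {C : ℝ}
    (hC : ∀ x, (1 + ‖x‖) ^ (2 * n + 2) * ‖g x‖ ≤ C) :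
    Integrable fun x => (b x : ℂ) * g x := by
  have hbi : ∀ k, IntegrableOn b (centeredCube n k) := fun k =>
    h.1.integrableOn_isCompact (isCompact_cube _ _)
  set c := ⨍ y in centeredCube n 0, b y with hc
  have hC0 : 0 ≤ C := by
    have := hC 0
    have h2 : 0 ≤ (1 + ‖(0 : E n)‖) ^ (2 * n + 2) * ‖g 0‖ := by positivity
    linarith
  have hgrow : ∀ k : ℕ, ∫ z in centeredCube n k, (|b z - c| + |c|) ≤
      (2 * Λ + |c|) * 2 ^ n * ((k : ℝ) + 1) ^ (2 * n) := by
    intro k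
    have hr := centeredCube_side_pos k
    have h0 := centeredCube_side_pos 0
    set fk := ⨍ y in centeredCube n k, b y with hfk
    have hsub : ∀ c k, IntegrableOn (fun z => |b z - c|) (centeredCube n k) := fun c k =>
      ((hbi k).sub (integrableOn_cube continuous_const _ _)).abs
    have h1 : ∫ z in centeredCube n k, |b z - fk| ≤ Λ * (2 * ((k : ℝ) + 1)) ^ n := by
      have := h.2 (WithLp.toLp 2 fun _ => -((k : ℝ) + 1)) _ hr
      rw [average_cube _ _ hr.le, inv_mul_le_iff₀ (by positivity)] at this
      exact this.trans (le_of_eq (mul_comm _ _))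
    have h2 : |c - fk| * 2 ^ n ≤ Λ * (2 * ((k : ℝ) + 1)) ^ n := by
      have e := average_cube_mul (fun z => b z - fk)
        (WithLp.toLp 2 fun _ : Fin n => -(((0 : ℕ) : ℝ) + 1)) h0
      rw [average_cube_sub (hbi 0) h0] at e
      have e' : (c - fk) * 2 ^ n = ∫ z in centeredCube n 0, (b z - fk) := by
        rw [hc]
        simpa [centeredCube] using e
      calc |c - fk| * 2 ^ n = |∫ z in centeredCube n 0, (b z - fk)| := by
            rw [← e', abs_mul, abs_of_pos (by positivity : (0 : ℝ) < 2 ^ n)]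
        _ ≤ ∫ z in centeredCube n 0, |b z - fk| := abs_integral_le_integral_abs
        _ ≤ ∫ z in centeredCube n k, |b z - fk| := setIntegral_mono_set (hsub _ _)
            (Eventually.of_forall fun _ => abs_nonneg _)
            (centeredCube_mono (Nat.zero_le k)).eventuallyLE
        _ ≤ _ := h1
    set q : ℝ := ((k : ℝ) + 1) ^ n with hq
    have hq1 : 1 ≤ q := one_le_pow₀ (by linarith [Nat.cast_nonneg (α := ℝ) k])
    have hV : (2 * ((k : ℝ) + 1)) ^ n = 2 ^ n * q := mul_pow _ _ _
    have hp : (0 : ℝ) < 2 ^ n := by positivity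
    have hΛ : 0 ≤ Λ := by
      have h3 : 0 ≤ ∫ z in centeredCube n k, |b z - fk| := integral_nonneg fun _ => abs_nonneg _
      by_contra hneg
      have := mul_neg_of_neg_of_pos (not_le.1 hneg) (by positivity : 0 < (2 * ((k : ℝ) + 1)) ^ n)
      linarith
    have h3 : |c - fk| ≤ Λ * q := by
      rw [hV] at h2
      exact le_of_mul_le_mul_right (h2.trans (le_of_eq (by ring))) hp
    have h4 : ∫ z in centeredCube n k, (|b z - c| + |c|) ≤
        ∫ z in centeredCube n k, (|b z - fk| + (|c - fk| + |c|)) := by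
      refine integral_mono ((hsub _ _).add (integrableOn_cube continuous_const _ _))
        ((hsub _ _).add (integrableOn_cube continuous_const _ _)) fun z => ?_
      have : b z - c = (b z - fk) + (fk - c) := by ring
      have h5 := abs_add_le (b z - fk) (fk - c)
      rw [← this, abs_sub_comm fk c] at h5
      simp only
      linarith
    have h5 : ∫ z in centeredCube n k, (|b z - fk| + (|c - fk| + |c|)) =
        (∫ z in centeredCube n k, |b z - fk|) + (|c - fk| + |c|) * (2 ^ n * q) := by
      rw [integral_add (hsub _ _) (integrableOn_cube continuous_const _ _), ← hV]
      congr 1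
      exact integral_cube_const _ hr.le _
    have h6 : ((k : ℝ) + 1) ^ (2 * n) = q * q := by rw [hq, ← pow_add, two_mul]
    rw [h6]
    rw [hV] at h1
    have hc0 := abs_nonneg c
    calc _ ≤ Λ * (2 ^ n * q) + (Λ * q + |c|) * (2 ^ n * q) := by
          refine h4.trans (h5.le.trans ?_); gcongr
      _ = 2 ^ n * q * (Λ + Λ * q + |c|) := by ring
      _ ≤ 2 ^ n * q * (Λ * q + Λ * q + |c| * q) := by
          gcongr <;> nlinarith
      _ = _ := by ring
  have hsum : Summable fun k : ℕ => C * (((k : ℝ) + 1) ^ (2 * n + 2))⁻¹ *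
      ((2 * Λ + |c|) * 2 ^ n * ((k : ℝ) + 1) ^ (2 * n)) := by
    have h1 : Summable fun k : ℕ => (1 : ℝ) / (((k + 1 : ℕ) : ℝ)) ^ 2 :=
      (summable_nat_add_iff 1).2 (Real.summable_one_div_nat_pow.2 one_lt_two)
    refine (h1.mul_left (C * ((2 * Λ + |c|) * 2 ^ n))).congr fun k => ?_
    push_cast
    field_simp
    ring
  have hnorm := integrable_of_cube_growth
    (w := fun k => C * (((k : ℝ) + 1) ^ (2 * n + 2))⁻¹) (g := fun z => |b z - c| + |c|)
    (h := fun z => ‖(b z : ℂ) * g z‖) (fun k => by positivity) (fun z => by positivity)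
    (fun k => ((hbi k).sub (integrableOn_cube continuous_const _ _)).abs.add
      (integrableOn_cube continuous_const _ _))
    (((h.1.aestronglyMeasurable.sub aestronglyMeasurable_const).norm).add
      aestronglyMeasurable_const)
    hgrow hsum
    ((Complex.continuous_ofReal.comp_aestronglyMeasurable h.1.aestronglyMeasurable).mul hg).norm
    (fun z => by
      rw [abs_of_nonneg (norm_nonneg _), norm_mul, Complex.norm_real, mul_comm]
      have h1 : ((⌊‖z‖⌋₊ : ℝ) + 1) ^ (2 * n + 2) ≤ (1 + ‖z‖) ^ (2 * n + 2) := by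
        have := Nat.floor_le (norm_nonneg z)
        exact pow_le_pow_left₀ (by positivity) (by linarith) _
      have h2 : ‖g z‖ ≤ C * (((⌊‖z‖⌋₊ : ℝ) + 1) ^ (2 * n + 2))⁻¹ := by
        rw [le_mul_inv_iff₀ (by positivity), mul_comm]
        exact (mul_le_mul_of_nonneg_right h1 (norm_nonneg _)).trans (hC z)
      have h3 : ‖b z‖ ≤ |b z - c| + |c| := by
        have := abs_add_le (b z - c) c
        rwa [sub_add_cancel] at this
      exact mul_le_mul h2 h3 (norm_nonneg _) (by positivity))
  exact (integrable_norm_iff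
    ((Complex.continuous_ofReal.comp_aestronglyMeasurable h.1.aestronglyMeasurable).mul hg)).1
    hnorm.1

lemma BMOBound.tendsto_truncate_integral {b : E n → ℝ} {Λ : ℝ} (h : BMOBound b Λ) {g : E n → ℂ}
    (hg : AEStronglyMeasurable g volume) {C : ℝ}
    (hC : ∀ x, (1 + ‖x‖) ^ (2 * n + 2) * ‖g x‖ ≤ C) :
    Tendsto (fun N : ℕ => ∫ x, (truncate N (b x) : ℂ) * g x) atTop (𝓝 (∫ x, (b x : ℂ) * g x)) := by
  have hi := h.integrable_mul hg hC
  refine tendsto_integral_of_dominated_convergence (fun x => ‖(b x : ℂ) * g x‖) (fun N => ?_)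
    hi.norm (fun N => Eventually.of_forall fun x => ?_) (Eventually.of_forall fun x => ?_)
  · exact (Complex.continuous_ofReal.comp_aestronglyMeasurable
      ((continuous_truncate N).comp_aestronglyMeasurable h.1.aestronglyMeasurable)).mul hg
  · rw [norm_mul, norm_mul, Complex.norm_real, Complex.norm_real]
    exact mul_le_mul_of_nonneg_right (abs_truncate_le_abs (Nat.cast_nonneg N) _) (norm_nonneg _)
  · exact ((Complex.continuous_ofReal.tendsto _).comp (tendsto_truncate (b x))).mul_const _

lemma schwartz_decay (m : ℕ) (u : 𝓢(E n, ℂ)) :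
    ∃ C, ∀ x, (1 + ‖x‖) ^ m * ‖u x‖ ≤ C := by
  refine ⟨2 ^ m * (Finset.Iic (m, 0)).sup (fun q => SchwartzMap.seminorm ℝ q.1 q.2) u,
    fun x => ?_⟩
  have := SchwartzMap.one_add_le_sup_seminorm_apply (𝕜 := ℝ) (m := (m, 0)) (k := m) (n := 0)
    le_rfl le_rfl u x
  simpa using this

/-- The `k`-th partial derivative of a complex Schwartz function. -/
noncomputable abbrev dC (k : Fin n) (u : 𝓢(E n, ℂ)) : 𝓢(E n, ℂ) := ∂_{basisVec k} u

/-- The null form `∂ⱼu ∂ᵢv̄ - ∂ᵢu ∂ⱼv̄`. -/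
noncomputable def nullForm (i j : Fin n) (u v : 𝓢(E n, ℂ)) (x : E n) : ℂ :=
  dC j u x * starRingEnd ℂ (dC i v x) - dC i u x * starRingEnd ℂ (dC j v x)

lemma continuous_nullForm (i j : Fin n) (u v : 𝓢(E n, ℂ)) : Continuous (nullForm i j u v) := by
  unfold nullForm
  have := fun (k : Fin n) (w : 𝓢(E n, ℂ)) => (dC k w).continuous
  have h2 := Complex.continuous_conj
  fun_prop

lemma nullForm_decay (m : ℕ) (i j : Fin n) (u v : 𝓢(E n, ℂ)) :
    ∃ C, ∀ x, (1 + ‖x‖) ^ m * ‖nullForm i j u v x‖ ≤ C := by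
  obtain ⟨C1, h1⟩ := schwartz_decay m (dC j u)
  obtain ⟨C2, h2⟩ := schwartz_decay m (dC i u)
  obtain ⟨D1, k1⟩ := schwartz_decay 0 (dC i v)
  obtain ⟨D2, k2⟩ := schwartz_decay 0 (dC j v)
  simp only [pow_zero, one_mul] at k1 k2
  refine ⟨C1 * D1 + C2 * D2, fun x => ?_⟩
  have hp : 0 ≤ (1 + ‖x‖) ^ m := by positivity
  calc (1 + ‖x‖) ^ m * ‖nullForm i j u v x‖
      ≤ (1 + ‖x‖) ^ m * (‖dC j u x‖ * ‖dC i v x‖ + ‖dC i u x‖ * ‖dC j v x‖) := by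
        refine mul_le_mul_of_nonneg_left ((norm_sub_le _ _).trans (le_of_eq ?_)) hp
        simp
    _ = ((1 + ‖x‖) ^ m * ‖dC j u x‖) * ‖dC i v x‖ + ((1 + ‖x‖) ^ m * ‖dC i u x‖) * ‖dC j v x‖ := by
        ring
    _ ≤ _ := by
        have a1 := h1 x
        have a2 := h2 x
        exact add_le_add
          (mul_le_mul a1 (k1 x) (norm_nonneg _)
            ((by positivity : (0 : ℝ) ≤ (1 + ‖x‖) ^ m * ‖dC j u x‖).trans a1))
          (mul_le_mul a2 (k2 x) (norm_nonneg _)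
            ((by positivity : (0 : ℝ) ≤ (1 + ‖x‖) ^ m * ‖dC i u x‖).trans a2))

/-- The real part of a Schwartz function. -/
noncomputable def reS (u : 𝓢(E n, ℂ)) : 𝓢(E n, ℝ) := u.postcompCLM Complex.reCLM

/-- The imaginary part of a Schwartz function. -/
noncomputable def imS (u : 𝓢(E n, ℂ)) : 𝓢(E n, ℝ) := u.postcompCLM Complex.imCLM

lemma dS_reS (k : Fin n) (u : 𝓢(E n, ℂ)) (x : E n) : dS k (reS u) x = (dC k u x).re := by
  change fderiv ℝ (fun y => Complex.reCLM (u y)) x (basisVec k) = _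
  have h : HasFDerivAt (fun y => Complex.reCLM (u y)) (Complex.reCLM.comp (fderiv ℝ u x)) x :=
    Complex.reCLM.hasFDerivAt.comp x (u.hasFDerivAt x)
  rw [h.fderiv]
  rfl

lemma dS_imS (k : Fin n) (u : 𝓢(E n, ℂ)) (x : E n) : dS k (imS u) x = (dC k u x).im := by
  change fderiv ℝ (fun y => Complex.imCLM (u y)) x (basisVec k) = _
  have h : HasFDerivAt (fun y => Complex.imCLM (u y)) (Complex.imCLM.comp (fderiv ℝ u x)) x :=
    Complex.imCLM.hasFDerivAt.comp x (u.hasFDerivAt x)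
  rw [h.fderiv]
  rfl

lemma gradSq_re_add_im (u : 𝓢(E n, ℂ)) :
    gradSq (reS u) + gradSq (imS u) = ∑ k, ∫ x, ‖dC k u x‖ ^ 2 := by
  have hi : ∀ w : 𝓢(E n, ℝ), Integrable fun x => w x ^ 2 := fun w => by
    simp only [sq]
    exact w.integrable.mul_bdd (c := SchwartzMap.seminorm ℝ 0 0 w)
      w.continuous.aestronglyMeasurable (Eventually.of_forall fun x => w.norm_le_seminorm ℝ x)
  unfold gradSq
  rw [← Finset.sum_add_distrib]
  refine Finset.sum_congr rfl fun k _ => ?_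
  rw [← integral_add (hi _) (hi _)]
  congr 1; funext x
  have h1 := dS_reS k u x
  have h2 := dS_imS k u x
  rw [h1, h2, ← Complex.normSq_eq_norm_sq, Complex.normSq_apply]
  ring

/-- The div-curl estimate for complex Schwartz functions. -/
theorem BMOBound.norm_integral_truncate_nullForm_le {b : E n → ℝ} {Λ : ℝ} (hΛ : 0 < Λ)
    (h : BMOBound b Λ) (N : ℕ) (u v : 𝓢(E n, ℂ)) (i j : Fin n) :
    ‖∫ x, (truncate N (b x) : ℂ) * nullForm i j u v x‖ ≤
      8 * divCurlConst n * Λ * ((∑ k, ∫ x, ‖dC k u x‖ ^ 2) + ∑ k, ∫ x, ‖dC k v x‖ ^ 2) := by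
  set R : 𝓢(E n, ℝ) → 𝓢(E n, ℝ) → E n → ℝ :=
    fun u v x => dS j u x * dS i v x - dS i u x * dS j v x with hR
  set J : 𝓢(E n, ℝ) → 𝓢(E n, ℝ) → ℝ := fun u v => ∫ x, truncate N (b x) * R u v x with hJ
  have hJi : ∀ u v, Integrable fun x => truncate N (b x) * R u v x := fun u v =>
    (integrable_null_form u v i j).bdd_mul (c := N)
      ((continuous_truncate N).comp_aestronglyMeasurable h.1.aestronglyMeasurable)
      (Eventually.of_forall fun x => abs_truncate_le (Nat.cast_nonneg N) _)
  have hb : ∀ u v, |J u v| ≤ 4 * divCurlConst n * Λ * (gradSq u + gradSq v) := fun u v =>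
    h.div_curl_truncate hΛ N u v i j
  have e : ∫ x, (truncate N (b x) : ℂ) * nullForm i j u v x =
      ((J (reS u) (reS v) + J (imS u) (imS v) : ℝ) : ℂ) +
        ((J (imS u) (reS v) - J (reS u) (imS v) : ℝ) : ℂ) * Complex.I := by
    have hpt : ∀ x, (truncate N (b x) : ℂ) * nullForm i j u v x =
        ((truncate N (b x) * R (reS u) (reS v) x + truncate N (b x) * R (imS u) (imS v) x : ℝ) : ℂ) +
        ((truncate N (b x) * R (imS u) (reS v) x - truncate N (b x) * R (reS u) (imS v) x : ℝ) : ℂ)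
          * Complex.I := by
      intro x
      simp only [hR, nullForm, dS_reS, dS_imS]
      apply Complex.ext <;> simp <;> ring
    simp_rw [hpt]
    rw [integral_add, integral_mul_const, integral_complex_ofReal, integral_complex_ofReal,
      integral_add (hJi _ _) (hJi _ _), integral_sub (hJi _ _) (hJi _ _)]
    · exact ((hJi _ _).add (hJi _ _)).ofReal
    · exact ((hJi _ _).sub (hJi _ _)).ofReal.mul_const _
  rw [e]
  refine (norm_add_le _ _).trans ?_
  rw [norm_mul, Complex.norm_I, mul_one, Complex.norm_real, Complex.norm_real]
  have h1 := (abs_add_le (J (reS u) (reS v)) (J (imS u) (imS v)))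
  have h2 := (abs_sub (J (imS u) (reS v)) (J (reS u) (imS v)))
  rw [← gradSq_re_add_im u, ← gradSq_re_add_im v]
  simp only [Real.norm_eq_abs]
  have b1 := hb (reS u) (reS v)
  have b2 := hb (imS u) (imS v)
  have b3 := hb (imS u) (reS v)
  have b4 := hb (reS u) (imS v)
  linarith

/-! ### Completeness of the Sobolev space and density of Schwartz functions -/

lemma toTemperedDistribution_injective {u v : L2 n}
    (h : (u : 𝓢'(E n, ℂ)) = (v : 𝓢'(E n, ℂ))) : u = v := by
  have := LinearMap.ker_eq_bot.1
    (Lp.ker_toTemperedDistributionCLM_eq_bot (F := ℂ) (μ := (volume : Measure (E n))) (p := 2))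
  exact this (by simpa using h)

lemma grad_apply_hasWeakDeriv (p : W12 n) (j : Fin n) : HasWeakDeriv j (toL2 n p) (grad n p j) :=
  p.2 j

lemma norm_sq_eq_toL2_grad (p : W12 n) : ‖p‖ ^ 2 = ‖toL2 n p‖ ^ 2 + ‖grad n p‖ ^ 2 := by
  have := WithLp.prod_norm_sq_eq_of_L2 (p : WithLp 2 (L2 n × PiLp 2 (fun _ : Fin n => L2 n)))
  exact this

lemma inner_eq_toL2_grad (p q : W12 n) :
    inner ℂ p q = inner ℂ (toL2 n p) (toL2 n q) + ∑ j, inner ℂ (grad n p j) (grad n q j) := by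
  rw [Submodule.coe_inner, WithLp.prod_inner_apply, PiLp.inner_apply]
  rfl

lemma toL2_injective : Function.Injective (toL2 n) := by
  rw [injective_iff_map_eq_zero]
  intro p hp
  have h2 : grad n p = 0 := by
    ext1 j
    have := grad_apply_hasWeakDeriv p j
    rw [hp, HasWeakDeriv, ← Lp.toTemperedDistributionCLM_apply, map_zero,
      LineDeriv.lineDerivOp_zero] at this
    refine toTemperedDistribution_injective ?_
    rw [← this, PiLp.zero_apply, ← Lp.toTemperedDistributionCLM_apply, map_zero]
  have := norm_sq_eq_toL2_grad p
  rw [hp, h2] at this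
  simpa using this

lemma isClosed_W12 : IsClosed (W12 n : Set (WithLp 2 (L2 n × PiLp 2 (fun _ : Fin n => L2 n)))) := by
  have : (W12 n : Set (WithLp 2 (L2 n × PiLp 2 (fun _ : Fin n => L2 n)))) =
      ⋂ j : Fin n, {p | (∂_{basisVec j} (Lp.toTemperedDistributionCLM ℂ volume 2 p.fst) :
        𝓢'(E n, ℂ)) = Lp.toTemperedDistributionCLM ℂ volume 2 (p.snd j)} := by
    ext p
    simp only [mem_iInter]
    rfl
  rw [this]
  refine isClosed_iInter fun j => isClosed_eq ?_ ?_
  · exact (LineDeriv.continuous_lineDerivOp (basisVec j)).comp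
      ((Lp.toTemperedDistributionCLM ℂ volume 2).continuous.comp
        (WithLp.fstL 2 ℂ (L2 n) (PiLp 2 (fun _ : Fin n => L2 n))).continuous)
  · exact (Lp.toTemperedDistributionCLM ℂ volume 2).continuous.comp
      ((PiLp.continuous_apply 2 _ j).comp
        (WithLp.sndL 2 ℂ (L2 n) (PiLp 2 (fun _ : Fin n => L2 n))).continuous)

instance : CompleteSpace (W12 n) := isClosed_W12.completeSpace_coe

/-- A Schwartz function as an element of `W^{1,2}`. -/
noncomputable def ofSchwartz (φ : 𝓢(E n, ℂ)) : W12 n :=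
  ⟨WithLp.toLp 2 (φ.toLp 2, WithLp.toLp 2 fun j => (dC j φ).toLp 2), fun j => by
    change (∂_{basisVec j} (φ.toLp 2 : 𝓢'(E n, ℂ)) : 𝓢'(E n, ℂ)) =
      ((dC j φ).toLp 2 : 𝓢'(E n, ℂ))
    rw [Lp.toTemperedDistribution_toLp_eq, Lp.toTemperedDistribution_toLp_eq,
      TemperedDistribution.lineDerivOp_toTemperedDistributionCLM_eq]⟩

lemma toL2_ofSchwartz (φ : 𝓢(E n, ℂ)) : toL2 n (ofSchwartz φ) = φ.toLp 2 := rfl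

lemma grad_ofSchwartz (φ : 𝓢(E n, ℂ)) (j : Fin n) :
    grad n (ofSchwartz φ) j = (dC j φ).toLp 2 := rfl

lemma ofSchwartz_add (φ ψ : 𝓢(E n, ℂ)) : ofSchwartz (φ + ψ) = ofSchwartz φ + ofSchwartz ψ := by
  apply toL2_injective
  rw [map_add]
  exact (SchwartzMap.toLpCLM ℂ ℂ 2 volume).map_add φ ψ

lemma ofSchwartz_smul (c : ℂ) (φ : 𝓢(E n, ℂ)) : ofSchwartz (c • φ) = c • ofSchwartz φ := by
  apply toL2_injective
  rw [map_smul]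
  exact (SchwartzMap.toLpCLM ℂ ℂ 2 volume).map_smul c φ

/-- `1 - Δ` is injective on tempered distributions. -/
lemma eq_zero_of_laplacian_eq_self {U : 𝓢'(E n, ℂ)}
    (h : Laplacian.laplacian U = U) : U = 0 := by
  set g : E n → ℂ := fun x => ((1 + ‖(2 * Real.pi) • x‖ ^ 2 : ℝ) : ℂ) with hg
  set g' : E n → ℂ := fun x => (((1 + ‖(2 * Real.pi) • x‖ ^ 2) ^ (-1 : ℝ) : ℝ) : ℂ) with hg'
  have hlin : Function.HasTemperateGrowth (fun x : E n => (2 * Real.pi) • x) :=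
    ((2 * Real.pi) • ContinuousLinearMap.id ℝ (E n)).hasTemperateGrowth
  have hg't : g'.HasTemperateGrowth :=
    Function.HasTemperateGrowth.comp Function.Complex.hasTemperateGrowth_ofReal
      ((Function.hasTemperateGrowth_one_add_norm_sq_rpow (E n) (-1)).comp hlin)
  have hsq : Function.HasTemperateGrowth (fun x : E n => ((‖x‖ ^ 2 : ℝ) : ℂ)) :=
    Function.HasTemperateGrowth.comp Function.Complex.hasTemperateGrowth_ofReal
      (Function.hasTemperateGrowth_norm_sq (E n))
  have hge : g = (fun _ => (1 : ℂ)) + ((2 * Real.pi : ℂ) ^ 2) • fun x : E n => ((‖x‖ ^ 2 : ℝ) : ℂ) := by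
    funext x
    simp only [hg, norm_smul, Pi.add_apply, Pi.smul_apply, smul_eq_mul, mul_pow,
      Real.norm_eq_abs, sq_abs]
    push_cast
    ring
  have hgt : g.HasTemperateGrowth := by
    rw [hge]
    refine (Function.HasTemperateGrowth.const 1).add ?_
    exact (Function.HasTemperateGrowth.const ((2 * Real.pi : ℂ) ^ 2)).mul hsq
  have h1 : TemperedDistribution.fourierMultiplierCLM ℂ g U = 0 := by
    have e := TemperedDistribution.laplacian_eq_fourierMultiplierCLM U
    rw [h] at e
    have : TemperedDistribution.fourierMultiplierCLM ℂ g U =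
        U + ((2 * Real.pi : ℂ) ^ 2) •
          TemperedDistribution.fourierMultiplierCLM ℂ (fun x : E n => ((‖x‖ ^ 2 : ℝ) : ℂ)) U := by
      have hsm : Function.HasTemperateGrowth
          (((2 * Real.pi : ℂ) ^ 2) • fun x : E n => ((‖x‖ ^ 2 : ℝ) : ℂ)) :=
        (Function.HasTemperateGrowth.const ((2 * Real.pi : ℂ) ^ 2)).mul hsq
      rw [hge, TemperedDistribution.fourierMultiplierCLM_apply,
        TemperedDistribution.smulLeftCLM_add (Function.HasTemperateGrowth.const 1) hsm,
        TemperedDistribution.smulLeftCLM_smul hsq]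
      simp [TemperedDistribution.fourierMultiplierCLM_apply, FourierTransform.fourierInv_add,
        FourierTransform.fourierInv_smul]
    rw [this]
    nth_rewrite 1 [e]
    ext φ
    simp
  have h2 := TemperedDistribution.fourierMultiplierCLM_fourierMultiplierCLM_apply hgt hg't U
  have h3 : g * g' = fun _ => 1 := by
    funext x
    simp only [Pi.mul_apply, hg, hg']
    rw [← Complex.ofReal_mul, Real.rpow_neg_one, mul_inv_cancel₀ (by positivity)]
    simp
  rw [h1, h3, map_zero, TemperedDistribution.fourierMultiplierCLM_const] at h2
  simpa using h2.symm

/-- The complex conjugate of a Schwartz function. -/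
noncomputable def conjS (φ : 𝓢(E n, ℂ)) : 𝓢(E n, ℂ) :=
  φ.postcompCLM (Complex.conjCLE : ℂ →L[ℝ] ℂ)

lemma conjS_apply (φ : 𝓢(E n, ℂ)) (x : E n) : conjS φ x = starRingEnd ℂ (φ x) := rfl

lemma dC_conjS (k : Fin n) (u : 𝓢(E n, ℂ)) : dC k (conjS u) = conjS (dC k u) := by
  ext x
  change fderiv ℝ (fun y => (Complex.conjCLE : ℂ →L[ℝ] ℂ) (u y)) x (basisVec k) = _
  have h : HasFDerivAt (fun y => (Complex.conjCLE : ℂ →L[ℝ] ℂ) (u y))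
      ((Complex.conjCLE : ℂ →L[ℝ] ℂ).comp (fderiv ℝ u x)) x :=
    (Complex.conjCLE : ℂ →L[ℝ] ℂ).hasFDerivAt.comp x (u.hasFDerivAt x)
  rw [h.fderiv]
  rfl

lemma inner_toLp_conjS (φ : 𝓢(E n, ℂ)) (g : L2 n) :
    inner ℂ ((conjS φ).toLp 2) g = (g : 𝓢'(E n, ℂ)) φ := by
  rw [L2.inner_def, Lp.toTemperedDistribution_apply]
  refine integral_congr_ae ?_
  filter_upwards [(conjS φ).coeFn_toLp 2 (volume : Measure (E n))] with x hx
  rw [hx, conjS_apply]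
  simp [mul_comm]

lemma laplacian_eq_sum_dC (φ : 𝓢(E n, ℂ)) :
    Laplacian.laplacian φ = ∑ j, dC j (dC j φ) := by
  rw [SchwartzMap.laplacian_eq_sum (EuclideanSpace.basisFun (Fin n) ℝ)]
  simp

theorem denseRange_ofSchwartz : DenseRange (ofSchwartz (n := n)) := by
  let ι : 𝓢(E n, ℂ) →ₗ[ℂ] W12 n :=
    { toFun := ofSchwartz, map_add' := ofSchwartz_add, map_smul' := ofSchwartz_smul }
  have : Submodule.orthogonal (𝕜 := ℂ) (E := W12 n) (LinearMap.range ι) = ⊥ := by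
    rw [Submodule.eq_bot_iff]
    intro p hp
    rw [Submodule.mem_orthogonal] at hp
    apply toL2_injective
    rw [map_zero]
    apply toTemperedDistribution_injective
    rw [← Lp.toTemperedDistributionCLM_apply, ← Lp.toTemperedDistributionCLM_apply, map_zero]
    apply eq_zero_of_laplacian_eq_self
    ext φ
    have h := hp (ofSchwartz (conjS φ)) ⟨conjS φ, rfl⟩
    rw [inner_eq_toL2_grad, toL2_ofSchwartz, inner_toLp_conjS] at h
    simp only [grad_ofSchwartz, dC_conjS, inner_toLp_conjS] at h
    rw [TemperedDistribution.laplacian_apply_apply, laplacian_eq_sum_dC, map_sum]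
    have h2 : ∀ j, (grad n p j : 𝓢'(E n, ℂ)) (dC j φ) =
        - (toL2 n p : 𝓢'(E n, ℂ)) (dC j (dC j φ)) := by
      intro j
      rw [← grad_apply_hasWeakDeriv p j, TemperedDistribution.lineDerivOp_apply_apply, map_neg]
    simp only [h2, Finset.sum_neg_distrib] at h
    exact (add_neg_eq_zero.1 h).symm
  have h2 := (Submodule.topologicalClosure_eq_top_iff).2 this
  intro x
  have : x ∈ (LinearMap.range ι : Submodule ℂ (W12 n)).topologicalClosure := by rw [h2]; trivial
  exact this

lemma denseRange_toL2 : DenseRange (toL2 n) := by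
  have h := SchwartzMap.denseRange_toLpCLM (F := ℂ) (E := E n) (p := 2)
    (μ := (volume : Measure (E n))) (by simp)
  refine h.mono ?_
  rintro _ ⟨φ, rfl⟩
  exact ⟨ofSchwartz φ, rfl⟩

/-! ### Boundedness and coercivity of the form -/

/-- Multiplication by a bounded real function, as an operator on `L²`. -/
lemma exists_mulOp {β : E n → ℝ} {c : ℝ} (hβ : AEStronglyMeasurable β volume)
    (hb : ∀ᵐ x, |β x| ≤ c) :
    ∃ M : L2 n →L[ℂ] L2 n, (∀ f, ‖M f‖ ≤ c * ‖f‖) ∧ ∀ f g : L2 n,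
      Integrable (fun x => (β x : ℂ) * f x * starRingEnd ℂ (g x)) ∧
      ∫ x, (β x : ℂ) * f x * starRingEnd ℂ (g x) = inner ℂ g (M f) := by
  have hβc : AEStronglyMeasurable (fun x => (β x : ℂ)) volume :=
    Complex.continuous_ofReal.comp_aestronglyMeasurable hβ
  have hle : ∀ f : L2 n, ∀ᵐ x, ‖(β x : ℂ) * f x‖ ≤ c * ‖f x‖ := fun f => by
    filter_upwards [hb] with x hx
    rw [norm_mul, Complex.norm_real]
    exact mul_le_mul_of_nonneg_right hx (norm_nonneg _)
  have hmem : ∀ f : L2 n, MemLp (fun x => (β x : ℂ) * f x) 2 volume := fun f =>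
    (Lp.memLp f).of_le_mul (hβc.mul (Lp.aestronglyMeasurable f)) (hle f)
  let M₀ : L2 n →ₗ[ℂ] L2 n :=
    { toFun := fun f => (hmem f).toLp _
      map_add' := fun f g => by
        refine Lp.ext ?_
        filter_upwards [(hmem (f + g)).coeFn_toLp, (hmem f).coeFn_toLp, (hmem g).coeFn_toLp,
          Lp.coeFn_add f g, Lp.coeFn_add ((hmem f).toLp _) ((hmem g).toLp _)] with x h1 h2 h3 h4 h5
        rw [h1, h5, Pi.add_apply, h2, h3, h4, Pi.add_apply, mul_add]
      map_smul' := fun a f => by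
        refine Lp.ext ?_
        filter_upwards [(hmem (a • f)).coeFn_toLp, (hmem f).coeFn_toLp,
          Lp.coeFn_smul a f, Lp.coeFn_smul a ((hmem f).toLp _)] with x h1 h2 h3 h4
        rw [h1, RingHom.id_apply, h4, Pi.smul_apply, h2, h3, Pi.smul_apply, smul_eq_mul,
          smul_eq_mul]
        ring }
  have hM₀ : ∀ f, (M₀ f : E n → ℂ) =ᵐ[volume] fun x => (β x : ℂ) * f x := fun f =>
    (hmem f).coeFn_toLp
  have hnorm : ∀ f, ‖M₀ f‖ ≤ c * ‖f‖ := fun f => by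
    refine Lp.norm_le_mul_norm_of_ae_le_mul ?_
    filter_upwards [hM₀ f, hle f] with x h1 h2
    rw [h1]
    exact h2
  refine ⟨M₀.mkContinuous c hnorm, hnorm, fun f g => ?_⟩
  have hae : (fun x => inner ℂ (g x) ((M₀.mkContinuous c hnorm f : L2 n) x)) =ᵐ[volume]
      fun x => (β x : ℂ) * f x * starRingEnd ℂ (g x) := by
    filter_upwards [hM₀ f] with x hx
    rw [LinearMap.mkContinuous_apply, hx]
    simp
  exact ⟨(L2.integrable_inner g _).congr hae, by rw [L2.inner_def, integral_congr_ae hae]⟩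

/-- A bound by the sum of the squares of two semi-norms is a bound by their product. -/
lemma le_mul_of_le_sq_add_sq {V : Type*} [NormedAddCommGroup V] [InnerProductSpace ℂ V]
    {K : Type*} [NormedAddCommGroup K] [NormedSpace ℂ K] (D : V →L[ℂ] K) (T : V →L[ℂ] V) {M : ℝ}
    (hM0 : 0 ≤ M)
    (h : ∀ u v, ‖inner ℂ v (T u)‖ ≤ M * (‖D u‖ ^ 2 + ‖D v‖ ^ 2)) (u v : V) :
    ‖inner ℂ v (T u)‖ ≤ 2 * M * (‖D u‖ * ‖D v‖) := by
  have key : ∀ ε > 0, ‖inner ℂ v (T u)‖ ≤ 2 * M * ((‖D u‖ + ε) * (‖D v‖ + ε)) := by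
    intro ε hε
    set x := ‖D u‖ + ε
    set y := ‖D v‖ + ε
    have hx : 0 < x := by positivity
    have hy : 0 < y := by positivity
    have := h ((x⁻¹ : ℂ) • u) ((y⁻¹ : ℂ) • v)
    rw [map_smul, inner_smul_left, inner_smul_right, map_smul, map_smul, norm_smul, norm_smul,
      norm_mul, norm_mul] at this
    simp only [RCLike.norm_conj, norm_inv, Complex.norm_real, Real.norm_eq_abs, abs_of_pos hx,
      abs_of_pos hy] at this
    have hu : x⁻¹ * ‖D u‖ ≤ 1 := by
      rw [inv_mul_le_iff₀ hx]; simp only [x]; linarith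
    have hv : y⁻¹ * ‖D v‖ ≤ 1 := by
      rw [inv_mul_le_iff₀ hy]; simp only [y]; linarith
    have hu2 := pow_le_one₀ (n := 2) (by positivity) hu
    have hv2 := pow_le_one₀ (n := 2) (by positivity) hv
    have h3 : y⁻¹ * (x⁻¹ * ‖inner ℂ v (T u)‖) ≤ M * (1 + 1) :=
      this.trans (mul_le_mul_of_nonneg_left (add_le_add hu2 hv2) hM0)
    rw [inv_mul_le_iff₀ hy, inv_mul_le_iff₀ hx] at h3
    linarith
  refine ge_of_tendsto (x := 𝓝[>] (0 : ℝ)) (f := fun ε => 2 * M * ((‖D u‖ + ε) * (‖D v‖ + ε))) ?_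
    (eventually_nhdsWithin_of_forall key)
  have : Continuous fun ε : ℝ => 2 * M * ((‖D u‖ + ε) * (‖D v‖ + ε)) := by fun_prop
  have h0 := (this.tendsto 0).mono_left (nhdsWithin_le_nhds (s := Ioi 0))
  simpa using h0

/-- The set of convergence of an equi-Lipschitz sequence is closed. -/
lemma isClosed_setOf_cauchySeq {X : Type*} [SeminormedAddCommGroup X] {f : ℕ → X → ℂ} {C : ℝ}
    (hf : ∀ N x y, ‖f N x - f N y‖ ≤ C * ‖x - y‖) :
    IsClosed {x | CauchySeq fun N => f N x} := by
  refine isClosed_of_closure_subset fun x hx => ?_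
  rw [mem_ofPred_eq, Metric.cauchySeq_iff']
  intro ε hε
  have hC : 0 < |C| + 1 := by positivity
  obtain ⟨y, hy, hxy⟩ := Metric.mem_closure_iff.1 hx (ε / (3 * (|C| + 1))) (by positivity)
  obtain ⟨N, hN⟩ := Metric.cauchySeq_iff'.1 hy (ε / 3) (by positivity)
  refine ⟨N, fun k hk => ?_⟩
  have h1 : ∀ k, dist (f k x) (f k y) < ε / 3 := fun k => by
    rw [dist_eq_norm]
    rw [dist_eq_norm, lt_div_iff₀ (by positivity)] at hxy
    have a1 := hf k x y
    have a2 := le_abs_self C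
    have a3 := norm_nonneg (x - y)
    rcases a3.eq_or_lt with h0 | h0
    · rw [← h0] at a1; linarith
    · nlinarith
  have h2 := hN k hk
  have h3 := h1 k
  have h4 := h1 N
  rw [dist_comm] at h4
  calc dist (f k x) (f N x) ≤ dist (f k x) (f k y) + dist (f k y) (f N y) + dist (f N y) (f N x) :=
        dist_triangle4 _ _ _ _
    _ < ε := by linarith

/-- The pointwise limit of uniformly bounded sesquilinear forms is represented by a bounded
operator. -/
lemma exists_operator_of_tendsto {V : Type*} [NormedAddCommGroup V] [InnerProductSpace ℂ V]
    [CompleteSpace V] {T : ℕ → V →L[ℂ] V} {B : V → V → ℂ} {C : ℝ}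
    (hT : ∀ N u v, ‖inner ℂ v (T N u)‖ ≤ C * (‖u‖ * ‖v‖))
    (hB : ∀ u v, Tendsto (fun N => inner ℂ v (T N u)) atTop (𝓝 (B u v))) :
    ∃ S : V →L[ℂ] V, ∀ u v, B u v = inner ℂ v (S u) := by
  have hb : ∀ u v, ‖B u v‖ ≤ C * (‖u‖ * ‖v‖) := fun u v =>
    le_of_tendsto (hB u v).norm (Eventually.of_forall fun N => hT N u v)
  let L₀ : V →ₗ⋆[ℂ] V →ₗ[ℂ] ℂ := LinearMap.mk₂'ₛₗ (starRingEnd ℂ) (RingHom.id ℂ) (fun v u => B u v)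
    (fun v v' u => tendsto_nhds_unique (hB u (v + v'))
      (((hB u v).add (hB u v')).congr fun N => (inner_add_left _ _ _).symm))
    (fun c v u => tendsto_nhds_unique (hB u (c • v))
      (((hB u v).const_mul (starRingEnd ℂ c)).congr fun N => (inner_smul_left _ _ _).symm))
    (fun v u u' => tendsto_nhds_unique (hB (u + u') v)
      (((hB u v).add (hB u' v)).congr fun N => by rw [map_add, inner_add_right]))
    (fun c v u => tendsto_nhds_unique (hB (c • u) v)
      (((hB u v).const_mul c).congr fun N => by rw [map_smul, inner_smul_right]))
  let L : V →L⋆[ℂ] V →L[ℂ] ℂ := L₀.mkContinuous₂ C fun v u => by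
    have := hb u v
    rw [mul_assoc, mul_comm ‖v‖]
    exact this
  refine ⟨(InnerProductSpace.continuousLinearMapOfBilin L).adjoint, fun u v => ?_⟩
  rw [ContinuousLinearMap.adjoint_inner_right,
    InnerProductSpace.continuousLinearMapOfBilin_apply]
  rfl

section Pullback

variable {V H : Type*} [NormedAddCommGroup V] [InnerProductSpace ℂ V]
  [NormedAddCommGroup H] [InnerProductSpace ℂ H] {ι : Type*} [Fintype ι]

lemma exists_pullback_operator [CompleteSpace V] [CompleteSpace H]
    (G G' : V →L[ℂ] H) (M : H →L[ℂ] H) :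
    ∃ S : V →L[ℂ] V, ∀ u v, inner ℂ v (S u) = inner ℂ (G' v) (M (G u)) - inner ℂ (G v) (M (G' u)) :=
  ⟨G'.adjoint ∘L M ∘L G - G.adjoint ∘L M ∘L G', fun u v => by
    simp [ContinuousLinearMap.adjoint_inner_right]⟩

lemma exists_pullback_sum_operator [CompleteSpace V] [CompleteSpace H]
    (G : ι → V →L[ℂ] H) (M : ι → ι → H →L[ℂ] H) :
    ∃ S : V →L[ℂ] V, ∀ u v, inner ℂ v (S u) = ∑ i, ∑ j, inner ℂ (G i v) (M i j (G j u)) :=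
  ⟨∑ i, ∑ j, (G i).adjoint ∘L M i j ∘L G j, fun u v => by
    simp [ContinuousLinearMap.adjoint_inner_right]⟩

lemma exists_add_sum_operator (S : V →L[ℂ] V) (c : ℂ) (P : ι → ι → V →L[ℂ] V) :
    ∃ T : V →L[ℂ] V, ∀ u v, inner ℂ v (T u) = inner ℂ v (S u) + c * ∑ i, ∑ j, inner ℂ v (P i j u) :=
  ⟨S + c • ∑ i, ∑ j, P i j, fun u v => by
    simp⟩

variable {α : Type*} {s : α → V}

lemma norm_inner_le_of_denseRange {K : Type*} [NormedAddCommGroup K] [NormedSpace ℂ K]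
    (hs : DenseRange s) (D : V →L[ℂ] K) (T : V →L[ℂ] V) {M : ℝ}
    (h : ∀ a b, ‖inner ℂ (s b) (T (s a))‖ ≤ M * (‖D (s a)‖ ^ 2 + ‖D (s b)‖ ^ 2)) (u v : V) :
    ‖inner ℂ v (T u)‖ ≤ M * (‖D u‖ ^ 2 + ‖D v‖ ^ 2) := by
  have hcl : IsClosed {p : V × V | ‖inner ℂ p.2 (T p.1)‖ ≤ M * (‖D p.1‖ ^ 2 + ‖D p.2‖ ^ 2)} :=
    isClosed_le (by fun_prop) (by fun_prop)
  exact (hs.prodMap hs).induction_on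
    (p := fun p : V × V => ‖inner ℂ p.2 (T p.1)‖ ≤ M * (‖D p.1‖ ^ 2 + ‖D p.2‖ ^ 2)) (u, v) hcl
    fun p => h p.1 p.2

lemma cauchySeq_inner_of_denseRange (hs : DenseRange s) {T : ℕ → V →L[ℂ] V} {C : ℝ}
    (hT : ∀ N u v, ‖inner ℂ v (T N u)‖ ≤ C * (‖u‖ * ‖v‖))
    (h : ∀ a b, CauchySeq fun N => inner ℂ (s b) (T N (s a))) (u v : V) :
    CauchySeq fun N => inner ℂ v (T N u) := by
  refine hs.induction_on (p := fun v => CauchySeq fun N => inner ℂ v (T N u)) v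
    (isClosed_setOf_cauchySeq (C := C * ‖u‖) fun N x y => ?_) fun b => ?_
  · rw [← inner_sub_left, mul_assoc]
    exact hT N u (x - y)
  refine hs.induction_on (p := fun u => CauchySeq fun N => inner ℂ (s b) (T N u)) u
    (isClosed_setOf_cauchySeq (C := C * ‖s b‖) fun N x y => ?_) fun a => h a b
  rw [← inner_sub_right, ← map_sub, mul_assoc, mul_comm ‖s b‖]
  exact hT N (x - y) _

end Pullback

/-- The Hilbert space `W^{1,2}`, with its algebraic and metric structure sealed, so that the
abstract theory of forms applies to it without unfolding the definition of `W^{1,2}`. -/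
def Sob (n : ℕ) : Type := W12 n

noncomputable instance : NormedAddCommGroup (Sob n) := inferInstanceAs (NormedAddCommGroup (W12 n))

noncomputable instance : InnerProductSpace ℂ (Sob n) :=
  inferInstanceAs (InnerProductSpace ℂ (W12 n))

instance : CompleteSpace (Sob n) := inferInstanceAs (CompleteSpace (W12 n))

/-- The identity of `W^{1,2}`, from its sealed version. -/
noncomputable def Sob.val (n : ℕ) : Sob n →L[ℂ] W12 n :=
  { toFun := fun u => u
    map_add' := fun _ _ => rfl
    map_smul' := fun _ _ => rfl
    cont := continuous_id }

/-- The identity of `W^{1,2}`, to its sealed version. -/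
def Sob.mk (u : W12 n) : Sob n := u

/-- The embedding of `W^{1,2}` into `L²`. -/
noncomputable def sobJ (n : ℕ) : Sob n →L[ℂ] L2 n := (toL2 n).comp (Sob.val n)

/-- The gradient on `W^{1,2}`. -/
noncomputable def sobD (n : ℕ) : Sob n →L[ℂ] PiLp 2 (fun _ : Fin n => L2 n) :=
  (grad n).comp (Sob.val n)

/-- The partial derivative on `W^{1,2}`. -/
noncomputable def sobPartial (n : ℕ) (k : Fin n) : Sob n →L[ℂ] L2 n :=
  (PiLp.proj 2 (fun _ : Fin n => L2 n) k).comp (sobD n)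

lemma sobJ_apply (u : Sob n) : sobJ n u = toL2 n (Sob.val n u) := rfl

lemma sobPartial_apply (k : Fin n) (u : Sob n) : sobPartial n k u = sobD n u k := rfl

lemma sobJ_injective : Function.Injective (sobJ n) := fun _ _ h => toL2_injective h

lemma denseRange_sobJ : DenseRange (sobJ n) := denseRange_toL2

lemma sob_norm_sq (u : Sob n) : ‖u‖ ^ 2 = ‖sobJ n u‖ ^ 2 + ‖sobD n u‖ ^ 2 :=
  norm_sq_eq_toL2_grad (Sob.val n u)

/-- A Schwartz function as an element of the sealed Sobolev space. -/
noncomputable def sobS (φ : 𝓢(E n, ℂ)) : Sob n := Sob.mk (ofSchwartz φ)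

lemma denseRange_sobS : DenseRange (sobS (n := n)) := denseRange_ofSchwartz

lemma sobD_sobS (φ : 𝓢(E n, ℂ)) (j : Fin n) : sobD n (sobS φ) j = (dC j φ).toLp 2 := rfl

/-- The function `∂ⱼu ∂ᵢv̄ - ∂ᵢu ∂ⱼv̄` for `u, v ∈ W^{1,2}`. -/
noncomputable def gradNullForm (i j : Fin n) (u v : Sob n) (x : E n) : ℂ :=
  sobD n u j x * starRingEnd ℂ (sobD n v i x) - sobD n u i x * starRingEnd ℂ (sobD n v j x)

lemma gradNullForm_sobS (i j : Fin n) (u v : 𝓢(E n, ℂ)) :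
    gradNullForm i j (sobS u) (sobS v) =ᵐ[volume] nullForm i j u v := by
  filter_upwards [(dC j u).coeFn_toLp 2 (volume : Measure (E n)),
    (dC i u).coeFn_toLp 2 (volume : Measure (E n)), (dC j v).coeFn_toLp 2 (volume : Measure (E n)),
    (dC i v).coeFn_toLp 2 (volume : Measure (E n))] with x h1 h2 h3 h4
  simp only [gradNullForm, sobD_sobS, nullForm, h1, h2, h3, h4]

lemma norm_sq_sobD (u : Sob n) : ‖sobD n u‖ ^ 2 = ∑ k, ‖sobD n u k‖ ^ 2 :=
  PiLp.norm_sq_eq_of_L2 _ _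

lemma norm_sobD_apply_le (u : Sob n) (k : Fin n) : ‖sobD n u k‖ ≤ ‖sobD n u‖ :=
  PiLp.norm_apply_le _ k

lemma norm_sobD_le (u : Sob n) : ‖sobD n u‖ ≤ ‖u‖ := by
  have := sob_norm_sq u
  exact le_of_sq_le_sq (by nlinarith [sq_nonneg ‖sobJ n u‖]) (norm_nonneg _)

lemma norm_sq_sobD_sobS (u : 𝓢(E n, ℂ)) :
    ‖sobD n (sobS u)‖ ^ 2 = ∑ k, ∫ x, ‖dC k u x‖ ^ 2 := by
  rw [norm_sq_sobD]
  refine Finset.sum_congr rfl fun k _ => ?_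
  rw [sobD_sobS, ← inner_self_eq_norm_sq (𝕜 := ℂ), L2.inner_def]
  have : ∫ x, inner ℂ (((dC k u).toLp 2 volume : L2 n) x) (((dC k u).toLp 2 volume : L2 n) x) =
      ∫ x, ((‖dC k u x‖ ^ 2 : ℝ) : ℂ) := by
    refine integral_congr_ae ?_
    filter_upwards [(dC k u).coeFn_toLp 2 (volume : Measure (E n))] with x hx
    rw [hx, inner_self_eq_norm_sq_to_K]
    simp
  rw [this, integral_complex_ofReal]
  simp

/-- The bound of the pairing of a `BMO` function with a null form, relative to the `BMO`
semi-norm. -/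
noncomputable def pairingConst (n : ℕ) (Λ : ℝ) : ℝ := 2 * (8 * divCurlConst n * Λ)

/-- The pairing of a `BMO` function with the null forms is a bounded sesquilinear form on
`W^{1,2}`, whose diagonal is purely imaginary. -/
theorem BMOBound.exists_pairing_operator {b : E n → ℝ} {Λ : ℝ} (hΛ : 0 < Λ) (h : BMOBound b Λ)
    (i j : Fin n) :
    ∃ S : Sob n →L[ℂ] Sob n,
      (∀ u v, bmoPairing b (gradNullForm i j u v) = inner ℂ v (S u)) ∧
      (∀ u v, ‖inner ℂ v (S u)‖ ≤ pairingConst n Λ * (‖sobD n u‖ * ‖sobD n v‖)) ∧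
      ∀ u, (inner ℂ u (S u)).re = 0 := by
  have hM : ∀ N : ℕ, ∃ M : L2 n →L[ℂ] L2 n, (∀ f, ‖M f‖ ≤ N * ‖f‖) ∧ ∀ f g : L2 n,
      Integrable (fun x => (truncate N (b x) : ℂ) * f x * starRingEnd ℂ (g x)) ∧
      ∫ x, (truncate N (b x) : ℂ) * f x * starRingEnd ℂ (g x) = inner ℂ g (M f) := fun N =>
    exists_mulOp ((continuous_truncate N).comp_aestronglyMeasurable h.1.aestronglyMeasurable)
      (Eventually.of_forall fun x => abs_truncate_le (Nat.cast_nonneg N) _)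
  choose M hMn hM using hM
  choose T hTi using fun N =>
    exists_pullback_operator (sobPartial n j) (sobPartial n i) (M N)
  simp only [sobPartial_apply] at hTi
  have hT : ∀ N u v, inner ℂ v (T N u) = ∫ x, (truncate N (b x) : ℂ) * gradNullForm i j u v x := by
    intro N u v
    rw [hTi, ← (hM N _ _).2, ← (hM N _ _).2, ← integral_sub (hM N _ _).1 (hM N _ _).1]
    congr 1; funext x
    simp only [gradNullForm]; ring
  have hS : ∀ N u v, inner ℂ (sobS v) (T N (sobS u)) =
      ∫ x, (truncate N (b x) : ℂ) * nullForm i j u v x := by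
    intro N u v
    rw [hT]
    refine integral_congr_ae ?_
    filter_upwards [gradNullForm_sobS i j u v] with x hx
    rw [hx]
  have hD := divCurlConst_nonneg n
  have hq : ∀ N u v, ‖inner ℂ v (T N u)‖ ≤
      8 * divCurlConst n * Λ * (‖sobD n u‖ ^ 2 + ‖sobD n v‖ ^ 2) := by
    intro N
    refine norm_inner_le_of_denseRange denseRange_sobS (sobD n) (T N)
      fun u v => ?_
    rw [hS, norm_sq_sobD_sobS, norm_sq_sobD_sobS]
    exact h.norm_integral_truncate_nullForm_le hΛ N u v i j
  have hb : ∀ N u v, ‖inner ℂ v (T N u)‖ ≤ pairingConst n Λ * (‖sobD n u‖ * ‖sobD n v‖) :=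
    fun N => le_mul_of_le_sq_add_sq (sobD n) (T N) (by positivity) (hq N)
  have hP : 0 ≤ pairingConst n Λ := by unfold pairingConst; positivity
  have hb' : ∀ N u v, ‖inner ℂ v (T N u)‖ ≤ pairingConst n Λ * (‖u‖ * ‖v‖) := fun N u v =>
    (hb N u v).trans (mul_le_mul_of_nonneg_left
      (mul_le_mul (norm_sobD_le u) (norm_sobD_le v) (norm_nonneg _) (norm_nonneg _)) hP)
  have hc : ∀ u v, CauchySeq fun N => inner ℂ v (T N u) := by
    refine cauchySeq_inner_of_denseRange denseRange_sobS hb' fun u v => ?_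
    simp only [hS]
    obtain ⟨C, hC⟩ := nullForm_decay (2 * n + 2) i j u v
    exact (h.tendsto_truncate_integral (continuous_nullForm i j u v).aestronglyMeasurable
      hC).cauchySeq
  choose B hB using fun u v => cauchySeq_tendsto_of_complete (hc u v)
  obtain ⟨S, hS'⟩ := exists_operator_of_tendsto hb' hB
  refine ⟨S, fun u v => ?_, fun u v => ?_, fun u => ?_⟩
  · rw [← hS']
    refine Tendsto.limUnder_eq ((hB u v).congr fun N => ?_)
    rw [hT]
  · rw [← hS']
    exact le_of_tendsto (hB u v).norm (Eventually.of_forall fun N => hb N u v)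
  · rw [← hS']
    refine tendsto_nhds_unique ((Complex.continuous_re.tendsto _).comp (hB u u)) ?_
    refine tendsto_const_nhds.congr fun N => ?_
    have hconj : inner ℂ (sobD n u j) (M N (sobD n u i)) =
        starRingEnd ℂ (inner ℂ (sobD n u i) (M N (sobD n u j))) := by
      rw [← (hM N _ _).2, ← (hM N _ _).2, ← integral_conj]
      congr 1; funext x
      simp only [map_mul, Complex.conj_conj, Complex.conj_ofReal]
      ring
    simp only [Function.comp_apply]
    rw [hTi, hconj, Complex.sub_re, Complex.conj_re, sub_self]

/-- The bounded symmetric part of the form. -/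
theorem IsCoefficient.exists_symm_operator {lam Lam : ℝ} {A : E n → Matrix (Fin n) (Fin n) ℝ}
    (hlam : 0 < lam) (hA : IsCoefficient lam Lam A) :
    ∃ S : Sob n →L[ℂ] Sob n,
      (∀ u v, (∫ x, ∑ i, ∑ j, (symmPart A x i j : ℂ) * sobD n u j x *
        starRingEnd ℂ (sobD n v i x)) = inner ℂ v (S u)) ∧
      (∀ u v, ‖inner ℂ v (S u)‖ ≤ n * n * lam⁻¹ * (‖sobD n u‖ * ‖sobD n v‖)) ∧
      ∀ u, lam * ‖sobD n u‖ ^ 2 ≤ (inner ℂ u (S u)).re := by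
  have hM : ∀ i j, ∃ M : L2 n →L[ℂ] L2 n, (∀ f, ‖M f‖ ≤ lam⁻¹ * ‖f‖) ∧ ∀ f g : L2 n,
      Integrable (fun x => (symmPart A x i j : ℂ) * f x * starRingEnd ℂ (g x)) ∧
      ∫ x, (symmPart A x i j : ℂ) * f x * starRingEnd ℂ (g x) = inner ℂ g (M f) := fun i j =>
    exists_mulOp (hA.measurable i j) (hA.bounded i j)
  choose M hMn hM using hM
  obtain ⟨S, hS⟩ := exists_pullback_sum_operator (sobPartial n) M
  simp only [sobPartial_apply] at hS
  have hint : ∀ u v : Sob n, Integrable fun x => ∑ i, ∑ j, (symmPart A x i j : ℂ) * sobD n u j x *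
      starRingEnd ℂ (sobD n v i x) := fun u v =>
    integrable_finsetSum _ fun i _ => integrable_finsetSum _ fun j _ => (hM i j _ _).1
  have hI : ∀ u v, (∫ x, ∑ i, ∑ j, (symmPart A x i j : ℂ) * sobD n u j x *
        starRingEnd ℂ (sobD n v i x)) = inner ℂ v (S u) := by
    intro u v
    rw [hS, integral_finsetSum _ fun i _ => integrable_finsetSum _ fun j _ => (hM i j _ _).1]
    refine Finset.sum_congr rfl fun i _ => ?_
    rw [integral_finsetSum _ fun j _ => (hM i j _ _).1]
    exact Finset.sum_congr rfl fun j _ => (hM i j _ _).2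
  refine ⟨S, hI, fun u v => ?_, fun u => ?_⟩
  · rw [hS]
    have hterm : ∀ i j, ‖inner ℂ (sobD n v i) (M i j (sobD n u j))‖ ≤
        lam⁻¹ * (‖sobD n u‖ * ‖sobD n v‖) := fun i j => by
      refine (norm_inner_le_norm _ _).trans ?_
      calc ‖sobD n v i‖ * ‖M i j (sobD n u j)‖ ≤ ‖sobD n v‖ * (lam⁻¹ * ‖sobD n u‖) :=
            mul_le_mul (norm_sobD_apply_le v i) ((hMn i j _).trans (mul_le_mul_of_nonneg_left
              (norm_sobD_apply_le u j) (by positivity))) (norm_nonneg _) (norm_nonneg _)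
        _ = _ := by ring
    refine (norm_sum_le_of_le _ fun i _ => norm_sum_le_of_le _ fun j _ => hterm i j).trans
      (le_of_eq ?_)
    simp
    ring
  · rw [← hI, ← RCLike.re_eq_complex_re, ← integral_re (hint u u), norm_sq_sobD]
    have hsq : ∀ f : L2 n, Integrable (fun x => ‖f x‖ ^ 2) ∧ ∫ x, ‖f x‖ ^ 2 = ‖f‖ ^ 2 := by
      intro f
      have e : (fun x => RCLike.re (inner ℂ (f x) (f x))) = fun x => ‖f x‖ ^ 2 := by
        funext x
        rw [inner_self_eq_norm_sq (𝕜 := ℂ)]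
      rw [← e]
      refine ⟨(L2.integrable_inner f f).re, ?_⟩
      rw [integral_re (L2.integrable_inner f f), ← L2.inner_def, inner_self_eq_norm_sq]
    simp only [← (hsq _).2]
    rw [← integral_finsetSum _ fun k _ => (hsq _).1, ← integral_const_mul]
    refine integral_mono_ae ((integrable_finsetSum _ fun k _ => (hsq _).1).const_mul _)
      (hint u u).re ?_
    filter_upwards [hA.elliptic] with x hx
    have h1 := hx (WithLp.toLp 2 fun k => (sobD n u k x).re)
    have h2 := hx (WithLp.toLp 2 fun k => (sobD n u k x).im)
    simp only [EuclideanSpace.norm_sq_eq, Real.norm_eq_abs, sq_abs] at h1 h2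
    have e1 : ∑ k, ‖sobD n u k x‖ ^ 2 =
        (∑ k, (sobD n u k x).re ^ 2) + ∑ k, (sobD n u k x).im ^ 2 := by
      rw [← Finset.sum_add_distrib]
      refine Finset.sum_congr rfl fun k _ => ?_
      rw [← Complex.normSq_eq_norm_sq, Complex.normSq_apply]; ring
    have e2 : RCLike.re (∑ i, ∑ j, (symmPart A x i j : ℂ) * sobD n u j x *
        starRingEnd ℂ (sobD n u i x)) =
        (∑ i, ∑ j, symmPart A x i j * (sobD n u i x).re * (sobD n u j x).re) +
        ∑ i, ∑ j, symmPart A x i j * (sobD n u i x).im * (sobD n u j x).im := by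
      simp only [RCLike.re_eq_complex_re, Complex.re_sum]
      rw [← Finset.sum_add_distrib]
      refine Finset.sum_congr rfl fun i _ => ?_
      rw [← Finset.sum_add_distrib]
      refine Finset.sum_congr rfl fun j _ => ?_
      simp
      ring
    simp only [e1, e2]
    linarith

/-- The continuity constant of the form with respect to the gradients. -/
noncomputable def formConst (n : ℕ) (lam Lam : ℝ) : ℝ :=
  n * n * lam⁻¹ + n * n * pairingConst n Lam

/-- The form is represented by a bounded operator on `W^{1,2}`, it is bounded by the gradients, and
its real part controls the gradient. -/
theorem IsCoefficient.exists_form_operator {lam Lam : ℝ} {A : E n → Matrix (Fin n) (Fin n) ℝ}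
    (hlam : 0 < lam) (hLam : 0 < Lam) (hA : IsCoefficient lam Lam A) :
    ∃ T : Sob n →L[ℂ] Sob n,
      (∀ u v, form A (Sob.val n u) (Sob.val n v) = inner ℂ v (T u)) ∧
      (∀ u v, ‖form A (Sob.val n u) (Sob.val n v)‖ ≤
        formConst n lam Lam * (‖sobD n u‖ * ‖sobD n v‖)) ∧
      ∀ u, lam * ‖sobD n u‖ ^ 2 ≤ (form A (Sob.val n u) (Sob.val n u)).re := by
  obtain ⟨S, hS, hSb, hSr⟩ := hA.exists_symm_operator hlam
  choose P hP hPb hPr using fun i j => (hA.bmo i j).exists_pairing_operator hLam i j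
  have hform : ∀ u v, form A (Sob.val n u) (Sob.val n v) = inner ℂ v (S u) +
      (1 / 2 : ℂ) * ∑ i, ∑ j, inner ℂ v (P i j u) := fun u v => by
    rw [← hS, form]
    refine congr_arg₂ (· + ·) rfl (congr_arg _ ?_)
    exact Finset.sum_congr rfl fun i _ => Finset.sum_congr rfl fun j _ => hP i j u v
  have hpc : 0 ≤ pairingConst n Lam := by
    have := divCurlConst_nonneg n
    unfold pairingConst; positivity
  obtain ⟨T, hT⟩ := exists_add_sum_operator S (1 / 2) P
  refine ⟨T, fun u v => ?_, fun u v => ?_, fun u => ?_⟩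
  · rw [hform, hT]
  · rw [hform]
    refine (norm_add_le _ _).trans ?_
    rw [norm_mul]
    have h1 : ‖∑ i, ∑ j, inner ℂ v (P i j u)‖ ≤
        n * n * (pairingConst n Lam * (‖sobD n u‖ * ‖sobD n v‖)) := by
      refine (norm_sum_le_of_le _ fun i _ => norm_sum_le_of_le _ fun j _ => hPb i j u v).trans
        (le_of_eq ?_)
      simp
      ring
    have h2 : ‖(1 / 2 : ℂ)‖ ≤ 1 := by norm_num
    have h3 := mul_le_mul h2 h1 (norm_nonneg _) zero_le_one
    calc _ ≤ _ := add_le_add (hSb u v) h3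
      _ = _ := by rw [formConst]; ring
  · rw [hform, Complex.add_re]
    have h0 : ((1 / 2 : ℂ) * ∑ i, ∑ j, inner ℂ u (P i j u)).re = 0 := by
      have : (1 / 2 : ℂ) = ((1 / 2 : ℝ) : ℂ) := by norm_num
      rw [this, Complex.re_ofReal_mul, Complex.re_sum]
      simp only [Complex.re_sum, hPr, Finset.sum_const_zero, mul_zero]
    rw [h0, add_zero]
    exact hSr u

/-! ### Resolvents of sectorial forms -/

lemma le_re_rotate {δ x : ℝ} (h1 : x ≤ Real.pi / 2 - δ) (h2 : -(Real.pi / 2 - δ) ≤ x)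
    (hδ : 0 ≤ δ) : Real.sin δ ≤ Real.cos x := by
  rw [← Real.cos_pi_div_two_sub]
  rw [← Real.cos_abs x]
  exact Real.cos_le_cos_of_nonneg_of_le_pi (abs_nonneg _) (by linarith [Real.pi_pos])
    (abs_le.2 ⟨h2, h1⟩)

lemma re_exp_mul (α : ℝ) (w : ℂ) :
    (Complex.exp (α * Complex.I) * w).re = ‖w‖ * Real.cos (α + Complex.arg w) := by
  conv_lhs => rw [← Complex.norm_mul_exp_arg_mul_I w]
  rw [mul_left_comm, ← Complex.exp_add, ← add_mul, ← Complex.ofReal_add, Complex.re_ofReal_mul,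
    Complex.exp_ofReal_mul_I_re]

/-- A rotation by a suitable angle maps both the sector of the numerical range and the point `z` of
the resolvent sector into a sector strictly inside the right half plane. -/
lemma sector_norm_add_ge {θ θ₁ : ℝ} (h0 : 0 < θ) (h1 : θ < θ₁) (h2 : θ₁ < Real.pi / 2) {w z : ℂ}
    (hw : |Complex.arg w| ≤ θ) (hz : z ∈ sector (Real.pi - θ₁)) {s : ℝ} (hs : 0 ≤ s) :
    Real.sin ((θ₁ - θ) / 2) * (‖w‖ + s * ‖z‖) ≤ ‖w + s * z‖ := by
  obtain ⟨hw1, hw2⟩ := abs_le.1 hw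
  obtain ⟨hz1, hz2⟩ := abs_le.1 hz.2
  have key : ∃ α : ℝ, Real.sin ((θ₁ - θ) / 2) ≤ Real.cos (α + Complex.arg w) ∧
      Real.sin ((θ₁ - θ) / 2) ≤ Real.cos (α + Complex.arg z) := by
    rcases le_total 0 (Complex.arg z) with h | h
    · exact ⟨-(Real.pi / 2 - (θ + θ₁) / 2), le_re_rotate (by linarith) (by linarith) (by linarith),
        le_re_rotate (by linarith) (by linarith) (by linarith)⟩
    · exact ⟨Real.pi / 2 - (θ + θ₁) / 2, le_re_rotate (by linarith) (by linarith) (by linarith),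
        le_re_rotate (by linarith) (by linarith) (by linarith)⟩
  obtain ⟨α, ha, hb⟩ := key
  have hre : (Complex.exp (α * Complex.I) * (w + s * z)).re =
      ‖w‖ * Real.cos (α + Complex.arg w) + s * (‖z‖ * Real.cos (α + Complex.arg z)) := by
    rw [mul_add, Complex.add_re, re_exp_mul, mul_left_comm, Complex.re_ofReal_mul, re_exp_mul]
  have hnorm : ‖Complex.exp (α * Complex.I) * (w + s * z)‖ = ‖w + s * z‖ := by
    rw [norm_mul, Complex.norm_exp_ofReal_mul_I, one_mul]
  rw [← hnorm]
  refine le_trans ?_ (Complex.re_le_norm _)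
  rw [hre]
  have e1 := mul_le_mul_of_nonneg_left ha (norm_nonneg w)
  have e2 := mul_le_mul_of_nonneg_left (mul_le_mul_of_nonneg_left hb (norm_nonneg z)) hs
  linarith

section Resolvent

variable {V H K : Type*} [NormedAddCommGroup V] [InnerProductSpace ℂ V] [CompleteSpace V]
  [NormedAddCommGroup H] [InnerProductSpace ℂ H] [CompleteSpace H]
  [NormedAddCommGroup K] [NormedSpace ℂ K]

/-- The data of a closed sectorial form `t[u,v] = ⟪v, T u⟫` in a Hilbert space `H`. The form domain
`V` is embedded densely by `J`, and `D` is an abstract gradient which the real part of the form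
controls. -/
structure IsSectorialForm (J : V →L[ℂ] H) (D : V →L[ℂ] K) (T : V →L[ℂ] V) (lam θ : ℝ) : Prop where
  injective : Function.Injective J
  dense : DenseRange J
  norm_sq : ∀ u, ‖u‖ ^ 2 = ‖J u‖ ^ 2 + ‖D u‖ ^ 2
  lam_pos : 0 < lam
  coercive : ∀ u, lam * ‖D u‖ ^ 2 ≤ (inner ℂ u (T u)).re
  theta_pos : 0 < θ
  arg_le : ∀ u, |Complex.arg (inner ℂ u (T u))| ≤ θ

/-- The graph of the operator associated with the form `⟪v, T u⟫`. -/
def formGraph (J : V →L[ℂ] H) (T : V →L[ℂ] V) : Set (H × H) :=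
  {p | ∃ u : V, J u = p.1 ∧ T u = J.adjoint p.2}

/-- The operator on the form domain which represents the form `t + z`. -/
noncomputable def formShift (J : V →L[ℂ] H) (T : V →L[ℂ] V) (z : ℂ) : V →L[ℂ] V :=
  T + z • (J.adjoint ∘L J)

/-- The resolvent `(z + L)⁻¹` of the operator `L` associated with a form, as an operator into the
form domain. -/
noncomputable def formRes (J : V →L[ℂ] H) (T : V →L[ℂ] V) (z : ℂ) : H →L[ℂ] V :=
  Ring.inverse (formShift J T z) ∘L J.adjoint

variable {J : V →L[ℂ] H} {D : V →L[ℂ] K} {T : V →L[ℂ] V} {lam θ θ₁ : ℝ}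

lemma inner_formShift (z : ℂ) (u v : V) :
    inner ℂ v (formShift J T z u) = inner ℂ v (T u) + z * inner ℂ (J v) (J u) := by
  simp [formShift, ContinuousLinearMap.adjoint_inner_right]

lemma IsSectorialForm.norm_inner_formShift_ge (h : IsSectorialForm J D T lam θ) (h1 : θ < θ₁)
    (h2 : θ₁ < Real.pi / 2) {z : ℂ} (hz : z ∈ sector (Real.pi - θ₁)) (u : V) :
    Real.sin ((θ₁ - θ) / 2) * (lam * ‖D u‖ ^ 2 + ‖z‖ * ‖J u‖ ^ 2) ≤
      ‖inner ℂ u (formShift J T z u)‖ := by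
  have hσ : 0 ≤ Real.sin ((θ₁ - θ) / 2) :=
    Real.sin_nonneg_of_nonneg_of_le_pi (by linarith) (by linarith [h.theta_pos, Real.pi_pos])
  rw [inner_formShift, inner_self_eq_norm_sq_to_K]
  have := sector_norm_add_ge h.theta_pos h1 h2 (h.arg_le u) hz (sq_nonneg ‖J u‖)
  have e : inner ℂ u (T u) + z * ((‖J u‖ : ℂ)) ^ 2 = inner ℂ u (T u) + ((‖J u‖ ^ 2 : ℝ) : ℂ) * z := by
    push_cast; ring
  refine le_trans (mul_le_mul_of_nonneg_left ?_ hσ) (this.trans (le_of_eq (congr_arg _ e.symm)))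
  have := (h.coercive u).trans (Complex.re_le_norm _)
  linarith

lemma sin_half_pos (h0 : 0 < θ) (h1 : θ < θ₁) (h2 : θ₁ < Real.pi / 2) :
    0 < Real.sin ((θ₁ - θ) / 2) :=
  Real.sin_pos_of_pos_of_lt_pi (by linarith) (by linarith [Real.pi_pos])

lemma IsSectorialForm.isUnit_formShift (h : IsSectorialForm J D T lam θ) (h1 : θ < θ₁)
    (h2 : θ₁ < Real.pi / 2) {z : ℂ} (hz : z ∈ sector (Real.pi - θ₁)) :
    IsUnit (formShift J T z) := by
  have hσ := sin_half_pos h.theta_pos h1 h2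
  have hz0 : 0 < ‖z‖ := norm_pos_iff.2 hz.1
  have hc : 0 < Real.sin ((θ₁ - θ) / 2) * min lam ‖z‖ := mul_pos hσ (lt_min h.lam_pos hz0)
  obtain ⟨c, hc'⟩ : ∃ c : NNReal, (c : ℝ) = Real.sin ((θ₁ - θ) / 2) * min lam ‖z‖ :=
    ⟨Real.toNNReal _, Real.coe_toNNReal _ hc.le⟩
  refine ContinuousLinearMap.isUnit_of_forall_le_norm_inner_map _
    (c := c) (NNReal.coe_pos.1 (hc' ▸ hc)) fun u => ?_
  rw [norm_inner_symm, hc']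
  refine le_trans ?_ (h.norm_inner_formShift_ge h1 h2 hz u)
  rw [h.norm_sq]
  have e1 := mul_le_mul_of_nonneg_right (min_le_left lam ‖z‖) (sq_nonneg ‖D u‖)
  have e2 := mul_le_mul_of_nonneg_right (min_le_right lam ‖z‖) (sq_nonneg ‖J u‖)
  calc _ = Real.sin ((θ₁ - θ) / 2) * (min lam ‖z‖ * ‖D u‖ ^ 2 + min lam ‖z‖ * ‖J u‖ ^ 2) := by ring
    _ ≤ _ := mul_le_mul_of_nonneg_left (add_le_add e1 e2) hσ.le

lemma IsSectorialForm.formShift_formRes (h : IsSectorialForm J D T lam θ) (h1 : θ < θ₁)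
    (h2 : θ₁ < Real.pi / 2) {z : ℂ} (hz : z ∈ sector (Real.pi - θ₁)) (f : H) :
    formShift J T z (formRes J T z f) = J.adjoint f := by
  have := Ring.mul_inverse_cancel _ (h.isUnit_formShift h1 h2 hz)
  exact DFunLike.congr_fun this (J.adjoint f)

lemma IsSectorialForm.formRes_eq (h : IsSectorialForm J D T lam θ) (h1 : θ < θ₁)
    (h2 : θ₁ < Real.pi / 2) {z : ℂ} (hz : z ∈ sector (Real.pi - θ₁)) {u : V} {f : H}
    (hu : formShift J T z u = J.adjoint f) : formRes J T z f = u := by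
  have := Ring.inverse_mul_cancel _ (h.isUnit_formShift h1 h2 hz)
  rw [formRes, ContinuousLinearMap.comp_apply, ← hu]
  exact DFunLike.congr_fun this u

lemma formShift_apply (z : ℂ) (u : V) : formShift J T z u = T u + z • J.adjoint (J u) := rfl

lemma IsSectorialForm.apply_formRes (h : IsSectorialForm J D T lam θ) (h1 : θ < θ₁)
    (h2 : θ₁ < Real.pi / 2) {z : ℂ} (hz : z ∈ sector (Real.pi - θ₁)) (f : H) :
    T (formRes J T z f) = J.adjoint (f - z • J (formRes J T z f)) := by
  have := h.formShift_formRes h1 h2 hz f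
  rw [formShift_apply] at this
  rw [map_sub, map_smul, ← this, add_sub_cancel_right]

/-- `formRes` is a two-sided inverse of `z + L`. -/
lemma IsSectorialForm.formRes_of_mem (h : IsSectorialForm J D T lam θ) (h1 : θ < θ₁)
    (h2 : θ₁ < Real.pi / 2) {z : ℂ} (hz : z ∈ sector (Real.pi - θ₁)) {u : V} {w : H}
    (hu : T u = J.adjoint w) : formRes J T z (z • J u + w) = u := by
  refine h.formRes_eq h1 h2 hz ?_
  rw [formShift_apply, hu, map_add, map_smul, add_comm]

/-- The bounds for the resolvent and its gradient, by testing the equation with the solution. -/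
lemma IsSectorialForm.norm_J_formRes_le (h : IsSectorialForm J D T lam θ) (h1 : θ < θ₁)
    (h2 : θ₁ < Real.pi / 2) {z : ℂ} (hz : z ∈ sector (Real.pi - θ₁)) (f : H) :
    ‖J (formRes J T z f)‖ ≤ (Real.sin ((θ₁ - θ) / 2))⁻¹ * ‖z‖⁻¹ * ‖f‖ ∧
    ‖D (formRes J T z f)‖ ≤
      (Real.sin ((θ₁ - θ) / 2))⁻¹ * (Real.sqrt lam)⁻¹ * (Real.sqrt ‖z‖)⁻¹ * ‖f‖ := by
  have hσ := sin_half_pos h.theta_pos h1 h2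
  have hz0 : 0 < ‖z‖ := norm_pos_iff.2 hz.1
  have hl := h.lam_pos
  set σ := Real.sin ((θ₁ - θ) / 2)
  set u := formRes J T z f with hu
  have key : σ * (lam * ‖D u‖ ^ 2 + ‖z‖ * ‖J u‖ ^ 2) ≤ ‖J u‖ * ‖f‖ := by
    refine (h.norm_inner_formShift_ge h1 h2 hz u).trans ?_
    rw [hu, h.formShift_formRes h1 h2 hz, ContinuousLinearMap.adjoint_inner_right]
    exact norm_inner_le_norm _ _
  have hJ : σ * ‖z‖ * ‖J u‖ ≤ ‖f‖ := by
    rcases (norm_nonneg (J u)).eq_or_lt with h0 | h0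
    · rw [← h0, mul_zero]; exact norm_nonneg _
    · have : 0 ≤ σ * (lam * ‖D u‖ ^ 2) := by positivity
      have h3 : ‖J u‖ * (σ * ‖z‖ * ‖J u‖) ≤ ‖J u‖ * ‖f‖ := by nlinarith
      exact le_of_mul_le_mul_left h3 h0
  have hJ' : ‖J u‖ ≤ σ⁻¹ * ‖z‖⁻¹ * ‖f‖ := by
    rw [← mul_inv, ← div_eq_inv_mul, le_div_iff₀ (by positivity)]
    linarith
  refine ⟨hJ', ?_⟩
  have hD : lam * ‖z‖ * (σ * ‖D u‖) ^ 2 ≤ ‖f‖ ^ 2 := by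
    have h3 : 0 ≤ σ * (‖z‖ * ‖J u‖ ^ 2) := by positivity
    have h4 : σ * (lam * ‖D u‖ ^ 2) ≤ ‖J u‖ * ‖f‖ := by linarith
    have h5 := mul_le_mul_of_nonneg_left h4 (by positivity : 0 ≤ σ * ‖z‖)
    have h6 := mul_le_mul_of_nonneg_right hJ (norm_nonneg f)
    nlinarith
  have hs : (Real.sqrt lam * Real.sqrt ‖z‖ * (σ * ‖D u‖)) ^ 2 ≤ ‖f‖ ^ 2 := by
    rw [mul_pow, mul_pow, Real.sq_sqrt hl.le, Real.sq_sqrt hz0.le]; exact hD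
  have hs' := le_of_sq_le_sq hs (norm_nonneg f)
  have hsl := Real.sqrt_pos.2 hl
  have hsz := Real.sqrt_pos.2 hz0
  rw [← mul_inv, ← mul_inv, ← div_eq_inv_mul, le_div_iff₀ (by positivity)]
  linarith

/-- The resolvent is holomorphic. -/
lemma IsSectorialForm.differentiableAt_formRes (h : IsSectorialForm J D T lam θ) (h1 : θ < θ₁)
    (h2 : θ₁ < Real.pi / 2) {z : ℂ} (hz : z ∈ sector (Real.pi - θ₁)) :
    DifferentiableAt ℂ (formRes J T) z := by
  obtain ⟨x, hx⟩ := h.isUnit_formShift h1 h2 hz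
  have h3 : DifferentiableAt ℂ (formShift J T) z := by
    unfold formShift; fun_prop
  have h4 : DifferentiableAt ℂ (Ring.inverse : (V →L[ℂ] V) → _) (formShift J T z) := by
    rw [← hx]; exact differentiableAt_inverse x.isUnit
  have h5 : DifferentiableAt ℂ (fun z => Ring.inverse (formShift J T z)) z := h4.comp z h3
  exact h5.clm_comp (differentiableAt_const _)

/-- The resolvent is bounded away from the origin. -/
lemma IsSectorialForm.exists_norm_formRes_le (h : IsSectorialForm J D T lam θ) (h1 : θ < θ₁)
    (h2 : θ₁ < Real.pi / 2) {R : ℝ} (hR : 0 < R) :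
    ∃ C, 0 ≤ C ∧ ∀ z ∈ sector (Real.pi - θ₁), R ≤ ‖z‖ → ‖formRes J T z‖ ≤ C := by
  have hσ := sin_half_pos h.theta_pos h1 h2
  have hl := Real.sqrt_pos.2 h.lam_pos
  set σ := Real.sin ((θ₁ - θ) / 2) with hs
  refine ⟨σ⁻¹ * R⁻¹ + σ⁻¹ * (Real.sqrt lam)⁻¹ * (Real.sqrt R)⁻¹, by positivity, fun z hz hzR => ?_⟩
  refine ContinuousLinearMap.opNorm_le_bound _ (by positivity) fun f => ?_
  obtain ⟨hJ, hD⟩ := h.norm_J_formRes_le h1 h2 hz f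
  have hsum : ‖formRes J T z f‖ ≤ ‖J (formRes J T z f)‖ + ‖D (formRes J T z f)‖ := by
    refine le_of_sq_le_sq ?_ (by positivity)
    rw [h.norm_sq]
    nlinarith [norm_nonneg (J (formRes J T z f)), norm_nonneg (D (formRes J T z f))]
  refine hsum.trans ?_
  rw [add_mul]
  refine add_le_add (hJ.trans ?_) (hD.trans ?_)
  · gcongr
  · have := Real.sqrt_pos.2 hR
    gcongr

/-- The domain of the operator is dense. -/
lemma IsSectorialForm.dense_domain (h : IsSectorialForm J D T lam θ) (h1 : θ < θ₁)
    (h2 : θ₁ < Real.pi / 2) : Dense {f : H | ∃ w, (f, w) ∈ formGraph J T} := by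
  have hz : (1 : ℂ) ∈ sector (Real.pi - θ₁) :=
    ⟨one_ne_zero, by simp; linarith [Real.pi_pos]⟩
  set P := J ∘L formRes J T 1 with hP
  have hsub : (LinearMap.range (P : H →ₗ[ℂ] H) : Set H) ⊆ {f : H | ∃ w, (f, w) ∈ formGraph J T} := by
    rintro _ ⟨f, rfl⟩
    exact ⟨_, _, rfl, h.apply_formRes h1 h2 hz f⟩
  refine Dense.mono hsub ?_
  rw [Submodule.dense_iff_topologicalClosure_eq_top, Submodule.topologicalClosure_eq_top_iff,
    Submodule.eq_bot_iff]
  intro g hg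
  rw [Submodule.mem_orthogonal] at hg
  obtain ⟨x, hx⟩ := h.isUnit_formShift h1 h2 hz
  have hadj : P.adjoint g = 0 := by
    refine ext_inner_left ℂ fun f => ?_
    rw [ContinuousLinearMap.adjoint_inner_right, inner_zero_right]
    exact hg _ ⟨f, rfl⟩
  have hPe : P = J ∘L (Ring.inverse (formShift J T 1)) ∘L J.adjoint := rfl
  rw [hPe, ContinuousLinearMap.adjoint_comp, ContinuousLinearMap.adjoint_comp,
    ContinuousLinearMap.adjoint_adjoint] at hadj
  have h3 : (Ring.inverse (formShift J T 1)).adjoint (J.adjoint g) = 0 := by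
    apply h.injective
    rw [map_zero]; exact hadj
  have h4 : J.adjoint g = 0 := by
    have e : (formShift J T 1).adjoint ∘L (Ring.inverse (formShift J T 1)).adjoint =
        ContinuousLinearMap.id ℂ V := by
      rw [← ContinuousLinearMap.adjoint_comp]
      have : Ring.inverse (formShift J T 1) ∘L formShift J T 1 = ContinuousLinearMap.id ℂ V :=
        Ring.inverse_mul_cancel _ (h.isUnit_formShift h1 h2 hz)
      rw [this]
      exact ContinuousLinearMap.adjoint_id
    have := DFunLike.congr_fun e (J.adjoint g)
    rw [ContinuousLinearMap.comp_apply, h3, map_zero] at this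
    exact this.symm
  have h5 : ∀ y : H, inner ℂ y g = 0 := by
    intro y
    refine h.dense.induction_on (p := fun y => inner ℂ y g = 0) y
      (isClosed_eq (by fun_prop) continuous_const) fun u => ?_
    rw [← ContinuousLinearMap.adjoint_inner_right, h4, inner_zero_right]
  exact inner_self_eq_zero.1 (h5 g)

end Resolvent

/-! ### Contour integrals in polar coordinates -/

section Contour

variable {X Y : Type*} [NormedAddCommGroup X] [NormedSpace ℂ X] [NormedAddCommGroup Y]
  [NormedSpace ℂ Y]

/-- The unit complex number `e^{iα}`. -/
noncomputable def cis (α : ℝ) : ℂ := Complex.exp (α * Complex.I)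

lemma norm_cis (α : ℝ) : ‖cis α‖ = 1 := Complex.norm_exp_ofReal_mul_I α

lemma continuous_cis : Continuous cis := by unfold cis; fun_prop

lemma re_mul_cis (r α : ℝ) : ((r : ℂ) * cis α).re = r * Real.cos α := by
  rw [cis, Complex.re_ofReal_mul, Complex.exp_ofReal_mul_I_re]

lemma norm_mul_cis {r : ℝ} (hr : 0 ≤ r) (α : ℝ) : ‖(r : ℂ) * cis α‖ = r := by
  rw [norm_mul, norm_cis, mul_one, Complex.norm_of_nonneg hr]

lemma mul_cis_mem_sector {r α φ : ℝ} (hr : 0 < r) (hα : |α| ≤ φ) (hφ : φ < Real.pi) :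
    (r : ℂ) * cis α ∈ sector φ := by
  obtain ⟨h1, h2⟩ := abs_le.1 hα
  refine ⟨?_, ?_⟩
  · rw [← norm_pos_iff, norm_mul_cis hr.le]; exact hr
  · rw [cis, Complex.exp_mul_I, Complex.arg_mul_cos_add_sin_mul_I hr ⟨by linarith, by linarith⟩]
    exact hα

lemma norm_exp_mul_cis (r α t : ℝ) :
    ‖Complex.exp ((r : ℂ) * cis α * t)‖ = Real.exp (t * r * Real.cos α) := by
  rw [Complex.norm_exp, mul_comm _ (t : ℂ), Complex.re_ofReal_mul, re_mul_cis, mul_assoc]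

/-- The integral along the ray `{s e^{iα} : s ≥ R}`. -/
noncomputable def rayInt (α R : ℝ) (F : ℂ → X) : X := ∫ r in Ioi R, cis α • F (r * cis α)

/-- The integral along the arc `{R e^{iθ} : α ≤ θ ≤ β}`. -/
noncomputable def arcInt (α β R : ℝ) (F : ℂ → X) : X :=
  ∫ θ in α..β, (Complex.I * R * cis θ) • F (R * cis θ)

/-- The integral along the contour `Γ`. -/
noncomputable def contourInt (φ R : ℝ) (F : ℂ → X) : X :=
  rayInt φ R F - rayInt (-φ) R F + arcInt (-φ) φ R F

/-- Absolute convergence of the integral along the contour `Γ`. -/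
structure ContourIntegrable (φ R : ℝ) (F : ℂ → X) : Prop where
  ray : IntegrableOn (fun r : ℝ => F (r * cis φ)) (Ioi R)
  ray_neg : IntegrableOn (fun r : ℝ => F (r * cis (-φ))) (Ioi R)
  arc : IntervalIntegrable (fun θ : ℝ => F (R * cis θ)) volume (-φ) φ

lemma ContourIntegrable.hasContourIntegral {φ R : ℝ} {F : ℂ → X} (h : ContourIntegrable φ R F) :
    HasContourIntegral φ R F (contourInt φ R F) := by
  have e : cis (-φ) = Complex.exp (-φ * Complex.I) := by rw [cis, Complex.ofReal_neg]
  refine ⟨h.ray, ?_, h.arc, ?_⟩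
  · have := h.ray_neg
    rwa [e] at this
  · rw [contourInt, rayInt, rayInt, e]
    rfl

lemma ContourIntegrable.map {φ R : ℝ} {F : ℂ → X} (h : ContourIntegrable φ R F) (L : X →L[ℂ] Y) :
    ContourIntegrable φ R fun z => L (F z) :=
  ⟨L.integrable_comp h.ray, L.integrable_comp h.ray_neg,
    ⟨L.integrable_comp h.arc.1, L.integrable_comp h.arc.2⟩⟩

lemma ContourIntegrable.ray_smul {φ R : ℝ} {F : ℂ → X} (h : ContourIntegrable φ R F) :
    IntegrableOn (fun r : ℝ => cis φ • F (r * cis φ)) (Ioi R) :=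
  Integrable.smul (cis φ) h.ray

lemma ContourIntegrable.ray_neg_smul {φ R : ℝ} {F : ℂ → X} (h : ContourIntegrable φ R F) :
    IntegrableOn (fun r : ℝ => cis (-φ) • F (r * cis (-φ))) (Ioi R) :=
  Integrable.smul (cis (-φ)) h.ray_neg

lemma ContourIntegrable.arc_smul {φ R : ℝ} {F : ℂ → X} (h : ContourIntegrable φ R F) :
    IntervalIntegrable (fun θ : ℝ => (Complex.I * R * cis θ) • F (R * cis θ)) volume (-φ) φ :=
  h.arc.continuousOn_smul (Continuous.continuousOn (by have := continuous_cis; fun_prop))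

lemma ContourIntegrable.contourInt_map [CompleteSpace X] [CompleteSpace Y] {φ R : ℝ} {F : ℂ → X}
    (h : ContourIntegrable φ R F) (L : X →L[ℂ] Y) :
    contourInt φ R (fun z => L (F z)) = L (contourInt φ R F) := by
  simp only [contourInt, rayInt, arcInt, map_add, map_sub]
  congr 2
  · rw [← L.integral_comp_comm h.ray_smul]
    simp
  · rw [← L.integral_comp_comm h.ray_neg_smul]
    simp
  · rw [← L.intervalIntegral_comp_comm h.arc_smul]
    simp

lemma ContourIntegrable.contourInt_sub {φ R : ℝ} {F G : ℂ → X} (h : ContourIntegrable φ R F)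
    (h' : ContourIntegrable φ R G) :
    contourInt φ R (fun z => F z - G z) = contourInt φ R F - contourInt φ R G := by
  simp only [contourInt, rayInt, arcInt, smul_sub]
  rw [integral_sub h.ray_smul h'.ray_smul, integral_sub h.ray_neg_smul
    h'.ray_neg_smul, intervalIntegral.integral_sub h.arc_smul h'.arc_smul]
  abel

lemma contourInt_congr {φ R : ℝ} {F G : ℂ → X} (hφ : 0 ≤ φ) (hφ' : φ < Real.pi) (hR : 0 < R)
    (h : ∀ z ∈ sector φ, F z = G z) : contourInt φ R F = contourInt φ R G := by
  have hray : ∀ α, |α| ≤ φ → rayInt α R F = rayInt α R G := fun α hα =>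
    setIntegral_congr_fun measurableSet_Ioi fun r hr => by
      rw [h _ (mul_cis_mem_sector (hR.trans hr) hα hφ')]
  rw [contourInt, contourInt, hray _ (abs_of_nonneg hφ).le,
    hray _ (by rw [abs_neg, abs_of_nonneg hφ])]
  congr 1
  refine intervalIntegral.integral_congr fun θ hθ => ?_
  rw [uIcc_of_le (by linarith)] at hθ
  rw [h _ (mul_cis_mem_sector hR (abs_le.2 hθ) hφ')]

/-- Cauchy's theorem for a sector of an annulus, via the logarithm. -/
lemma polar_cauchy [CompleteSpace X] {F : ℂ → X} {R R' α β : ℝ} (hR : 0 < R) (hR' : 0 < R')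
    (hF : ∀ r : ℝ, 0 < r → ∀ y ∈ uIcc α β, DifferentiableAt ℂ F (r * cis y)) :
    (∫ r in R..R', cis β • F (r * cis β)) - (∫ r in R..R', cis α • F (r * cis α)) =
      arcInt α β R' F - arcInt α β R F := by
  set G : ℂ → X := fun w => Complex.exp w • F (Complex.exp w) with hG
  have hexp : ∀ x y : ℝ, Complex.exp (x + y * Complex.I) = (Real.exp x : ℂ) * cis y := fun x y => by
    rw [Complex.exp_add, cis, Complex.ofReal_exp]
  have hcb := Complex.integral_boundary_rect_eq_zero_of_differentiableOn G
    ⟨Real.log R, α⟩ ⟨Real.log R', β⟩ (by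
      rintro w ⟨-, hw⟩
      have hw' : Complex.exp w = (Real.exp w.re : ℂ) * cis w.im := by
        rw [← hexp, Complex.re_add_im]
      refine DifferentiableAt.differentiableWithinAt ?_
      refine Complex.differentiable_exp.differentiableAt.smul ?_
      refine DifferentiableAt.comp w ?_ Complex.differentiable_exp.differentiableAt
      rw [hw']
      exact hF _ (Real.exp_pos _) _ hw)
  have hsub : ∀ y ∈ uIcc α β, (∫ x in Real.log R..Real.log R', G (x + y * Complex.I)) =
      ∫ r in R..R', cis y • F (r * cis y) := by
    intro y hy
    have h1 := intervalIntegral.integral_deriv_smul_comp' (a := Real.log R) (b := Real.log R')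
      (f := Real.exp) (f' := Real.exp) (g := fun r : ℝ => cis y • F (r * cis y))
      (fun x _ => Real.hasDerivAt_exp x) Real.continuous_exp.continuousOn (by
        rintro _ ⟨x, -, rfl⟩
        refine ContinuousAt.continuousWithinAt ?_
        have hc : ContinuousAt (fun r : ℝ => (r : ℂ) * cis y) (Real.exp x) := by fun_prop
        exact (ContinuousAt.comp (f := fun r : ℝ => (r : ℂ) * cis y) (g := F)
          (hF _ (Real.exp_pos x) y hy).continuousAt hc).const_smul _)
    rw [Real.exp_log hR, Real.exp_log hR'] at h1
    rw [← h1]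
    refine intervalIntegral.integral_congr fun x _ => ?_
    simp only [hG, Function.comp_apply]
    rw [hexp, mul_smul]
    exact (RCLike.real_smul_eq_coe_smul (K := ℂ) _ _).symm
  have harc : ∀ ρ : ℝ, 0 < ρ → Complex.I • (∫ y in α..β, G (Real.log ρ + y * Complex.I)) =
      arcInt α β ρ F := by
    intro ρ hρ
    rw [← intervalIntegral.integral_smul, arcInt]
    refine intervalIntegral.integral_congr fun y _ => ?_
    simp only [hG]
    rw [hexp, Real.exp_log hρ, smul_smul, mul_assoc]
  simp only at hcb
  rw [hsub α left_mem_uIcc, hsub β right_mem_uIcc, harc R' hR', harc R hR] at hcb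
  rw [← sub_eq_zero, ← neg_eq_zero, ← hcb]
  abel

/-- A holomorphic function on a closed sector which grows at most polynomially at infinity. -/
structure Tame (φ : ℝ) (Φ : ℂ → X) : Prop where
  differentiableAt : ∀ z ∈ sector φ, DifferentiableAt ℂ Φ z
  growth : ∃ m : ℕ, ∀ R : ℝ, 0 < R → ∃ C : ℝ, 0 ≤ C ∧ ∀ z ∈ sector φ, R ≤ ‖z‖ →
    ‖Φ z‖ ≤ C * ‖z‖ ^ m

lemma Tame.id_smul {φ : ℝ} {Φ : ℂ → X} (h : Tame φ Φ) : Tame φ fun z => z • Φ z := by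
  refine ⟨fun z hz => differentiableAt_id.smul (h.differentiableAt z hz), ?_⟩
  obtain ⟨m, hm⟩ := h.growth
  refine ⟨m + 1, fun R hR => ?_⟩
  obtain ⟨C, hC0, hC⟩ := hm R hR
  refine ⟨C, hC0, fun z hz hzR => ?_⟩
  rw [norm_smul, pow_succ, ← mul_assoc, mul_comm ‖z‖]
  exact mul_le_mul_of_nonneg_right (hC z hz hzR) (norm_nonneg _)

lemma Tame.pow_smul {φ : ℝ} {Φ : ℂ → X} (h : Tame φ Φ) (l : ℕ) : Tame φ fun z => z ^ l • Φ z := by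
  induction l with
  | zero => simpa using h
  | succ l ih =>
    have := ih.id_smul
    refine ⟨fun z hz => ?_, ?_⟩
    · have h2 := this.differentiableAt z hz
      refine h2.congr_of_eventuallyEq (Eventually.of_forall fun w => ?_)
      simp only [pow_succ', mul_smul]
    · obtain ⟨m, hm⟩ := this.growth
      refine ⟨m, fun R hR => ?_⟩
      obtain ⟨C, hC0, hC⟩ := hm R hR
      refine ⟨C, hC0, fun z hz hzR => ?_⟩
      rw [pow_succ', mul_smul]
      exact hC z hz hzR

lemma tame_inv {φ : ℝ} : Tame φ fun z : ℂ => z⁻¹ := by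
  refine ⟨fun z hz => differentiableAt_inv hz.1, 0, fun R hR => ⟨R⁻¹, by positivity, ?_⟩⟩
  intro z _ hzR
  rw [norm_inv, pow_zero, mul_one]
  exact inv_anti₀ hR hzR

lemma integrableOn_pow_mul_exp (m : ℕ) {b : ℝ} (hb : b < 0) {R : ℝ} (hR : 0 ≤ R) :
    IntegrableOn (fun r : ℝ => r ^ m * Real.exp (r * b)) (Ioi R) := by
  have := integrableOn_rpow_mul_exp_neg_mul_rpow (p := 1) (s := m) (b := -b)
    (by linarith [Nat.cast_nonneg (α := ℝ) m]) one_pos (by linarith)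
  refine (this.mono_set (Ioi_subset_Ioi hR)).congr_fun (fun r hr => ?_) measurableSet_Ioi
  simp only [Real.rpow_natCast, Real.rpow_one]
  congr 2; ring

lemma Tame.continuousOn_ray {φ α : ℝ} {Φ : ℂ → X} (h : Tame φ Φ) (hα : |α| ≤ φ) (hφ : φ < Real.pi)
    (t : ℝ) :
    ContinuousOn (fun r : ℝ => Complex.exp (r * cis α * t) • Φ (r * cis α)) (Ioi 0) := by
  intro r hr
  refine ContinuousAt.continuousWithinAt ?_
  have h1 : ContinuousAt (fun r : ℝ => (r : ℂ) * cis α) r := by fun_prop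
  have h2 := (h.differentiableAt _ (mul_cis_mem_sector hr hα hφ)).continuousAt
  have h3 : ContinuousAt (fun r : ℝ => Φ (r * cis α)) r :=
    ContinuousAt.comp (f := fun r : ℝ => (r : ℂ) * cis α) (g := Φ) h2 h1
  have h4 : ContinuousAt (fun r : ℝ => Complex.exp (r * cis α * t)) r := by fun_prop
  exact h4.smul h3

lemma Tame.integrableOn_ray {φ α : ℝ} {Φ : ℂ → X} (h : Tame φ Φ) (hα : |α| ≤ φ) (hφ : φ < Real.pi)
    (hcos : Real.cos α < 0) {t R : ℝ} (ht : 0 < t) (hR : 0 < R) :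
    IntegrableOn (fun r : ℝ => Complex.exp (r * cis α * t) • Φ (r * cis α)) (Ioi R) := by
  obtain ⟨m, hm⟩ := h.growth
  obtain ⟨C, hC0, hC⟩ := hm R hR
  have hb : t * Real.cos α < 0 := mul_neg_of_pos_of_neg ht hcos
  refine Integrable.mono' ((integrableOn_pow_mul_exp m hb hR.le).const_mul C)
    (((h.continuousOn_ray hα hφ t).mono (Ioi_subset_Ioi hR.le)).aestronglyMeasurable
      measurableSet_Ioi) ?_
  refine (ae_restrict_iff' measurableSet_Ioi).2 (Eventually.of_forall fun r hr => ?_)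
  have hr0 : 0 < r := hR.trans hr
  have h1 := hC _ (mul_cis_mem_sector hr0 hα hφ) (by rw [norm_mul_cis hr0.le]; exact (le_of_lt hr))
  rw [norm_mul_cis hr0.le] at h1
  rw [norm_smul, norm_exp_mul_cis]
  have e : t * r * Real.cos α = r * (t * Real.cos α) := by ring
  rw [e]
  calc _ ≤ Real.exp (r * (t * Real.cos α)) * (C * r ^ m) :=
        mul_le_mul_of_nonneg_left h1 (Real.exp_pos _).le
    _ = _ := by ring

lemma Tame.continuousOn_arc {φ : ℝ} {Φ : ℂ → X} (h : Tame φ Φ) (hφ : φ < Real.pi)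
    (t : ℝ) {R : ℝ} (hR : 0 < R) :
    ContinuousOn (fun θ : ℝ => Complex.exp (R * cis θ * t) • Φ (R * cis θ)) (Icc (-φ) φ) := by
  intro θ hθ
  refine ContinuousAt.continuousWithinAt ?_
  have hc := continuous_cis
  have h1 : ContinuousAt (fun θ : ℝ => (R : ℂ) * cis θ) θ := by fun_prop
  have h2 := (h.differentiableAt _ (mul_cis_mem_sector hR (abs_le.2 hθ) hφ)).continuousAt
  have h3 : ContinuousAt (fun θ : ℝ => Φ (R * cis θ)) θ :=
    ContinuousAt.comp (f := fun θ : ℝ => (R : ℂ) * cis θ) (g := Φ) h2 h1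
  have h4 : ContinuousAt (fun θ : ℝ => Complex.exp (R * cis θ * t)) θ := by fun_prop
  exact h4.smul h3

lemma Tame.contourIntegrable {φ : ℝ} {Φ : ℂ → X} (h : Tame φ Φ) (hφ0 : Real.pi / 2 < φ)
    (hφ : φ < Real.pi) {t R : ℝ} (ht : 0 < t) (hR : 0 < R) :
    ContourIntegrable φ R fun z => Complex.exp (z * t) • Φ z := by
  have hφ1 : 0 ≤ φ := by linarith [Real.pi_pos]
  have hcos : Real.cos φ < 0 := Real.cos_neg_of_pi_div_two_lt_of_lt hφ0 (by linarith [Real.pi_pos])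
  refine ⟨h.integrableOn_ray (abs_of_nonneg hφ1).le hφ hcos ht hR,
    h.integrableOn_ray (by rw [abs_neg, abs_of_nonneg hφ1]) hφ (by rwa [Real.cos_neg]) ht hR, ?_⟩
  refine ContinuousOn.intervalIntegrable ?_
  rw [uIcc_of_le (by linarith)]
  exact h.continuousOn_arc hφ t hR

/-- The contour integral does not depend on the radius of the arc. -/
lemma Tame.contourInt_eq [CompleteSpace X] {φ : ℝ} {Φ : ℂ → X} (h : Tame φ Φ)
    (hφ0 : Real.pi / 2 < φ) (hφ : φ < Real.pi) {t R R' : ℝ} (ht : 0 < t) (hR : 0 < R)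
    (hR' : 0 < R') :
    contourInt φ R (fun z => Complex.exp (z * t) • Φ z) =
      contourInt φ R' (fun z => Complex.exp (z * t) • Φ z) := by
  have hφ1 : 0 ≤ φ := by linarith [Real.pi_pos]
  have h1 := h.contourIntegrable hφ0 hφ ht hR
  have h2 := h.contourIntegrable hφ0 hφ ht hR'
  have hc := polar_cauchy (F := fun z => Complex.exp (z * t) • Φ z) (α := -φ) (β := φ) hR hR'
    (fun r hr y hy => by
      rw [uIcc_of_le (by linarith)] at hy
      have h3 := h.differentiableAt _ (mul_cis_mem_sector hr (abs_le.2 hy) hφ)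
      have h4 : DifferentiableAt ℂ (fun z : ℂ => Complex.exp (z * t)) (r * cis y) := by fun_prop
      exact h4.smul h3)
  rw [← intervalIntegral.integral_Ioi_sub_Ioi' h1.ray_smul h2.ray_smul,
    ← intervalIntegral.integral_Ioi_sub_Ioi' h1.ray_neg_smul h2.ray_neg_smul] at hc
  simp only [contourInt, rayInt]
  rw [← sub_eq_zero]
  rw [← sub_eq_zero] at hc
  rw [← hc]
  abel

/-- The constant in the bound of contour integrals by the decay of the exponential. -/
noncomputable def contourConst (m : ℕ) (φ : ℝ) : ℝ :=
  2 * (∫ s in Ioi (1 : ℝ), s ^ m * Real.exp (s * Real.cos φ)) + 2 * φ * Real.exp 1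

lemma contourConst_nonneg (m : ℕ) {φ : ℝ} (hφ : 0 ≤ φ) : 0 ≤ contourConst m φ := by
  have : 0 ≤ ∫ s in Ioi (1 : ℝ), s ^ m * Real.exp (s * Real.cos φ) :=
    setIntegral_nonneg measurableSet_Ioi fun s hs => by
      have : (0 : ℝ) < s := one_pos.trans hs
      positivity
  unfold contourConst
  positivity

/-- On the contour with radius `1 / t`, the exponential `e^{zt}` has size of order one on the arc
and decays at scale `1 / t` along the rays. -/
lemma norm_contourInt_le {φ : ℝ} (hφ0 : Real.pi / 2 < φ) (hφ : φ < Real.pi) {t : ℝ} (ht : 0 < t)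
    {F : ℂ → X} {K : ℝ} (hK : 0 ≤ K) (m : ℕ)
    (hF : ∀ z ∈ sector φ, 1 ≤ t * ‖z‖ → ‖F z‖ ≤ K * (t * ‖z‖) ^ m * ‖Complex.exp (z * t)‖) :
    ‖contourInt φ t⁻¹ F‖ ≤ K * contourConst m φ * t⁻¹ := by
  have hφ1 : 0 ≤ φ := by linarith [Real.pi_pos]
  have hti : 0 < t⁻¹ := inv_pos.2 ht
  have hcos : Real.cos φ < 0 := Real.cos_neg_of_pi_div_two_lt_of_lt hφ0 (by linarith [Real.pi_pos])
  set S := ∫ s in Ioi (1 : ℝ), s ^ m * Real.exp (s * Real.cos φ) with hS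
  have hray : ∀ α, |α| ≤ φ → Real.cos α = Real.cos φ → ‖rayInt α t⁻¹ F‖ ≤ K * S * t⁻¹ := by
    intro α hα hαc
    have hint : IntegrableOn (fun r : ℝ => K * ((t * r) ^ m * Real.exp ((t * r) * Real.cos φ)))
        (Ioi t⁻¹) := by
      have h1 : IntegrableOn (fun r : ℝ => K * t ^ m * (r ^ m * Real.exp (r * (t * Real.cos φ))))
          (Ioi t⁻¹) := (integrableOn_pow_mul_exp m
        (mul_neg_of_pos_of_neg ht hcos) hti.le).const_mul (K * t ^ m)
      refine IntegrableOn.congr_fun h1 (fun r _ => ?_) measurableSet_Ioi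
      rw [mul_pow, show r * (t * Real.cos φ) = t * r * Real.cos φ by ring]; ring
    have h2 : ‖rayInt α t⁻¹ F‖ ≤
        ∫ r in Ioi t⁻¹, K * ((t * r) ^ m * Real.exp ((t * r) * Real.cos φ)) := by
      refine norm_integral_le_of_norm_le hint ?_
      refine (ae_restrict_iff' measurableSet_Ioi).2 (Eventually.of_forall fun r hr => ?_)
      have hr0 : 0 < r := hti.trans hr
      have hr1 : 1 ≤ t * r := by
        have := mul_le_mul_of_nonneg_left (le_of_lt hr) ht.le
        rwa [mul_inv_cancel₀ ht.ne'] at this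
      have := hF _ (mul_cis_mem_sector hr0 hα hφ) (by rw [norm_mul_cis hr0.le]; exact hr1)
      rw [norm_mul_cis hr0.le, norm_exp_mul_cis, hαc] at this
      rw [norm_smul, norm_cis, one_mul, ← mul_assoc]
      exact this
    refine h2.trans (le_of_eq ?_)
    rw [integral_const_mul, integral_comp_mul_left_Ioi
      (fun s => s ^ m * Real.exp (s * Real.cos φ)) t⁻¹ ht, mul_inv_cancel₀ ht.ne', ← hS,
      smul_eq_mul]
    ring
  have harc : ‖arcInt (-φ) φ t⁻¹ F‖ ≤ (t⁻¹ * (K * Real.exp 1)) * |φ - -φ| := by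
    refine intervalIntegral.norm_integral_le_of_norm_le_const fun θ hθ => ?_
    rw [uIoc_of_le (by linarith)] at hθ
    have hn : ‖((t⁻¹ : ℝ) : ℂ) * cis θ‖ = t⁻¹ := norm_mul_cis hti.le θ
    have := hF _ (mul_cis_mem_sector hti (abs_le.2 ⟨hθ.1.le, hθ.2⟩) hφ)
      (by rw [hn, mul_inv_cancel₀ ht.ne'])
    rw [hn, mul_inv_cancel₀ ht.ne', one_pow, mul_one, norm_exp_mul_cis, mul_inv_cancel₀ ht.ne',
      one_mul] at this
    rw [norm_smul, mul_assoc, norm_mul, Complex.norm_I, one_mul, hn]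
    refine mul_le_mul_of_nonneg_left (this.trans ?_) hti.le
    exact mul_le_mul_of_nonneg_left (Real.exp_le_exp.2 (Real.cos_le_one θ)) hK
  have e : |φ - -φ| = 2 * φ := by rw [abs_of_nonneg (by linarith)]; ring
  rw [e] at harc
  have r1 := hray φ (abs_of_nonneg hφ1).le rfl
  have r2 := hray (-φ) (by rw [abs_neg, abs_of_nonneg hφ1]) (Real.cos_neg φ)
  refine (norm_add_le _ _).trans ((add_le_add ((norm_sub_le _ _).trans (add_le_add r1 r2))
    harc).trans (le_of_eq ?_))
  rw [contourConst, ← hS]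
  ring

/-- Differentiation under the integral sign along a curve. -/
lemma hasDerivAt_integral_exp {ν : Measure ℝ} {γ : ℝ → ℂ} {Φ : ℝ → X} {t : ℝ} (ht : 0 < t)
    (h0 : ∀ t : ℝ, 0 < t → Integrable (fun s => Complex.exp (γ s * t) • Φ s) ν)
    (h1 : ∀ t : ℝ, 0 < t → Integrable (fun s => Complex.exp (γ s * t) • γ s • Φ s) ν) :
    HasDerivAt (fun t : ℝ => ∫ s, Complex.exp (γ s * t) • Φ s ∂ν)
      (∫ s, Complex.exp (γ s * t) • γ s • Φ s ∂ν) t := by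
  refine (hasDerivAt_integral_of_dominated_loc_of_deriv_le (s := Ioo (t / 2) (2 * t))
    (F := fun (t : ℝ) s => Complex.exp (γ s * t) • Φ s)
    (F' := fun (t : ℝ) s => Complex.exp (γ s * t) • γ s • Φ s)
    (bound := fun s => ‖Complex.exp (γ s * ((t / 2 : ℝ) : ℂ)) • γ s • Φ s‖ +
      ‖Complex.exp (γ s * ((2 * t : ℝ) : ℂ)) • γ s • Φ s‖)
    (Ioo_mem_nhds (by linarith) (by linarith)) ?_ (h0 t ht) (h1 t ht).aestronglyMeasurable
    (Eventually.of_forall fun s x hx => ?_)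
    ((h1 _ (by positivity)).norm.add (h1 _ (by positivity)).norm)
    (Eventually.of_forall fun s x hx => ?_)).2
  · filter_upwards [Ioi_mem_nhds ht] with x hx
    exact (h0 x hx).aestronglyMeasurable
  · simp only [norm_smul, Complex.norm_exp, mul_comm (γ s) _, Complex.re_ofReal_mul]
    rw [← add_mul]
    refine mul_le_mul_of_nonneg_right ?_ (by positivity)
    rcases le_total 0 (γ s).re with h | h
    · have : Real.exp (x * (γ s).re) ≤ Real.exp (2 * t * (γ s).re) :=
        Real.exp_le_exp.2 (mul_le_mul_of_nonneg_right hx.2.le h)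
      exact this.trans (le_add_of_nonneg_left (Real.exp_pos _).le)
    · have : Real.exp (x * (γ s).re) ≤ Real.exp (t / 2 * (γ s).re) :=
        Real.exp_le_exp.2 (mul_le_mul_of_nonpos_right hx.1.le h)
      exact this.trans (le_add_of_nonneg_right (Real.exp_pos _).le)
  · have e1 : HasDerivAt (fun x : ℝ => γ s * (x : ℂ)) (γ s) x := by
      simpa using (Complex.ofRealCLM.hasDerivAt (x := x)).const_mul (γ s)
    have e2 := e1.cexp.smul_const (Φ s)
    simpa only [mul_smul] using e2

/-- Differentiation under the contour integral brings down a factor `z`. -/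
lemma Tame.hasDerivAt_contourInt {φ : ℝ} {Φ : ℂ → X} (h : Tame φ Φ) (hφ0 : Real.pi / 2 < φ)
    (hφ : φ < Real.pi) {t R : ℝ} (ht : 0 < t) (hR : 0 < R) :
    HasDerivAt (fun t : ℝ => contourInt φ R fun z => Complex.exp (z * t) • Φ z)
      (contourInt φ R fun z => Complex.exp (z * t) • (z • Φ z)) t := by
  have i0 := fun (t : ℝ) (ht : 0 < t) => h.contourIntegrable hφ0 hφ ht hR
  have i1 := fun (t : ℝ) (ht : 0 < t) => h.id_smul.contourIntegrable hφ0 hφ ht hR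
  have hray : ∀ α : ℝ, (∀ t : ℝ, 0 < t → IntegrableOn
      (fun r : ℝ => Complex.exp (r * cis α * t) • Φ (r * cis α)) (Ioi R)) →
      (∀ t : ℝ, 0 < t → IntegrableOn
      (fun r : ℝ => Complex.exp (r * cis α * t) • (r * cis α) • Φ (r * cis α)) (Ioi R)) →
      HasDerivAt (fun t : ℝ => rayInt α R fun z => Complex.exp (z * t) • Φ z)
        (rayInt α R fun z => Complex.exp (z * t) • (z • Φ z)) t := by
    intro α h0 h1
    have := hasDerivAt_integral_exp (ν := volume.restrict (Ioi R)) (γ := fun r => r * cis α)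
      (Φ := fun r => cis α • Φ (r * cis α)) ht
      (fun t ht => ((h0 t ht).smul (cis α)).congr (Eventually.of_forall fun r => smul_comm _ _ _))
      (fun t ht => ((h1 t ht).smul (cis α)).congr (Eventually.of_forall fun r => by
        simp only [Pi.smul_apply]
        rw [smul_comm (cis α), smul_comm (cis α)]))
    refine (this.congr_deriv ?_).congr_of_eventuallyEq (Eventually.of_forall fun t => ?_)
    · unfold rayInt
      congr 1; funext r
      rw [smul_comm (cis α), smul_comm (cis α)]
    · unfold rayInt
      simp only
      congr 1; funext r
      rw [smul_comm (cis α)]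
  have harc : HasDerivAt (fun t : ℝ => arcInt (-φ) φ R fun z => Complex.exp (z * t) • Φ z)
        (arcInt (-φ) φ R fun z => Complex.exp (z * t) • (z • Φ z)) t := by
    have hle : -φ ≤ φ := by linarith [Real.pi_pos]
    have := hasDerivAt_integral_exp (ν := volume.restrict (Ioc (-φ) φ)) (γ := fun θ => R * cis θ)
      (Φ := fun θ => (Complex.I * R * cis θ) • Φ (R * cis θ)) ht
      (fun t ht => ((intervalIntegrable_iff_integrableOn_Ioc_of_le hle).1 (i0 t ht).arc_smul).congr
        (Eventually.of_forall fun r => smul_comm _ _ _))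
      (fun t ht => ((intervalIntegrable_iff_integrableOn_Ioc_of_le hle).1 (i1 t ht).arc_smul).congr
        (Eventually.of_forall fun r => by
          simp only
          rw [smul_comm (Complex.I * R * cis r), smul_comm (Complex.I * R * cis r)]))
    refine (this.congr_deriv ?_).congr_of_eventuallyEq (Eventually.of_forall fun t => ?_)
    · unfold arcInt
      rw [intervalIntegral.integral_of_le hle]
      congr 1; funext r
      rw [smul_comm (Complex.I * R * cis r), smul_comm (Complex.I * R * cis r)]
    · unfold arcInt
      simp only
      rw [intervalIntegral.integral_of_le hle]
      congr 1; funext r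
      rw [smul_comm (Complex.I * R * cis r)]
  exact ((hray φ (fun t ht => (i0 t ht).ray) fun t ht => (i1 t ht).ray).sub
    (hray (-φ) (fun t ht => (i0 t ht).ray_neg) fun t ht => (i1 t ht).ray_neg)).add harc

end Contour

/-! ### The contour integrals of `e^{zt} / z` and `e^{zt}` -/

/-- The mean value property of `z ↦ e^{zt}` at the origin. -/
lemma integral_exp_circle (t R : ℝ) (hR : 0 < R) :
    ∫ θ in (-Real.pi)..Real.pi, Complex.exp (R * cis θ * t) = 2 * Real.pi := by
  have h1 := DifferentiableOn.circleIntegral_sub_inv_smul (c := 0) (w := 0) (R := R)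
    (f := fun z : ℂ => Complex.exp (z * t)) (by fun_prop) (by simpa using hR)
  rw [circleIntegral] at h1
  have h2 : ∫ θ in (0 : ℝ)..2 * Real.pi, deriv (circleMap 0 R) θ •
      ((circleMap 0 R θ - 0)⁻¹ • Complex.exp (circleMap 0 R θ * t)) =
      Complex.I * ∫ θ in (0 : ℝ)..2 * Real.pi, Complex.exp (R * cis θ * t) := by
    rw [← intervalIntegral.integral_const_mul]
    refine intervalIntegral.integral_congr fun θ _ => ?_
    have hne : circleMap 0 R θ ≠ 0 := circleMap_ne_center hR.ne'
    simp only [deriv_circleMap, sub_zero, smul_eq_mul]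
    rw [← mul_assoc, mul_right_comm _ Complex.I, mul_inv_cancel₀ hne, one_mul, circleMap_zero]
    rfl
  rw [h2] at h1
  have hper : Function.Periodic (fun θ : ℝ => Complex.exp (R * cis θ * t)) (2 * Real.pi) := by
    intro θ
    simp only [cis]
    push_cast
    rw [add_mul, Complex.exp_add, Complex.exp_two_pi_mul_I, mul_one]
  have h3 := hper.intervalIntegral_add_eq (-Real.pi) 0
  rw [show -Real.pi + 2 * Real.pi = Real.pi by ring, zero_add] at h3
  rw [h3]
  have hI : Complex.I ≠ 0 := Complex.I_ne_zero
  apply mul_left_cancel₀ hI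
  rw [h1]
  simp
  ring

/-- The rays are rotated to the negative real axis, where they cancel; there remains the mean value
of `e^{zt}` on a circle. -/
theorem contourInt_exp_mul_inv {φ : ℝ} (hφ0 : Real.pi / 2 < φ) (hφ : φ < Real.pi) {t R : ℝ}
    (ht : 0 < t) (hR : 0 < R) :
    contourInt φ R (fun z => Complex.exp (z * t) • z⁻¹) = 2 * Real.pi * Complex.I := by
  have hφ1 : 0 ≤ φ := by linarith [Real.pi_pos]
  have hcos : Real.cos φ < 0 := Real.cos_neg_of_pi_div_two_lt_of_lt hφ0 (by linarith [Real.pi_pos])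
  set F : ℂ → ℂ := fun z => Complex.exp (z * t) • z⁻¹ with hF
  have hint : ContourIntegrable φ R F := tame_inv.contourIntegrable hφ0 hφ ht hR
  have hd : ∀ r : ℝ, 0 < r → ∀ y : ℝ, DifferentiableAt ℂ F (r * cis y) := by
    intro r hr y
    have hne : (r : ℂ) * cis y ≠ 0 := by rw [← norm_pos_iff, norm_mul_cis hr.le]; exact hr
    have h1 : DifferentiableAt ℂ (fun z : ℂ => Complex.exp (z * t)) (r * cis y) := by fun_prop
    exact h1.smul (differentiableAt_inv hne)
  have harc : ∀ α β ρ : ℝ, 0 < ρ → arcInt α β ρ F =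
      Complex.I * ∫ θ in α..β, Complex.exp (ρ * cis θ * t) := by
    intro α β ρ hρ
    rw [← intervalIntegral.integral_const_mul]
    refine intervalIntegral.integral_congr fun θ _ => ?_
    have hne : (ρ : ℂ) * cis θ ≠ 0 := by rw [← norm_pos_iff, norm_mul_cis hρ.le]; exact hρ
    simp only [hF, smul_eq_mul]
    rw [mul_comm (Complex.exp _), ← mul_assoc, mul_assoc Complex.I, mul_inv_cancel_right₀ hne]
  have hII : ∀ ρ a b : ℝ, IntervalIntegrable (fun θ : ℝ => Complex.exp (ρ * cis θ * t)) volume a b :=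
    fun ρ a b => Continuous.intervalIntegrable (by have := continuous_cis; fun_prop) _ _
  have hpi : cis (-Real.pi) = cis Real.pi := by
    simp only [cis, Complex.ofReal_neg, neg_mul]
    rw [Complex.exp_neg, Complex.exp_pi_mul_I]; norm_num
  -- the truncated contour integral, up to the contribution of the far arcs
  have key : ∀ ρ : ℝ, 0 < ρ → (∫ r in R..ρ, cis φ • F (r * cis φ)) -
      (∫ r in R..ρ, cis (-φ) • F (r * cis (-φ))) + arcInt (-φ) φ R F =
      2 * Real.pi * Complex.I - Complex.I * ((∫ θ in φ..Real.pi, Complex.exp (ρ * cis θ * t)) +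
        ∫ θ in (-Real.pi)..(-φ), Complex.exp (ρ * cis θ * t)) := by
    intro ρ hρ
    have p1 := polar_cauchy (F := F) (α := φ) (β := Real.pi) hR hρ fun r hr y _ => hd r hr y
    have p2 := polar_cauchy (F := F) (α := -Real.pi) (β := -φ) hR hρ fun r hr y _ => hd r hr y
    rw [hpi] at p2
    have hfull := integral_exp_circle t R hR
    rw [← intervalIntegral.integral_add_adjacent_intervals (hII R _ (-φ)) (hII R _ _),
      ← intervalIntegral.integral_add_adjacent_intervals (hII R (-φ) φ) (hII R _ _)] at hfull
    rw [harc _ _ _ hρ, harc _ _ _ hR] at p1 p2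
    rw [harc _ _ _ hR]
    linear_combination -p1 + -p2 + Complex.I * hfull
  have hdecay : ∀ a b : ℝ, (∀ θ ∈ uIoc a b, Real.cos θ ≤ Real.cos φ) →
      Tendsto (fun ρ : ℝ => ∫ θ in a..b, Complex.exp (ρ * cis θ * t)) atTop (𝓝 0) := by
    intro a b hab
    have h1 : Tendsto (fun ρ : ℝ => Real.exp (ρ * (t * Real.cos φ)) * |b - a|) atTop
        (𝓝 (0 * |b - a|)) := by
      refine Tendsto.mul_const _ (Real.tendsto_exp_atBot.comp ?_)
      exact tendsto_id.atTop_mul_const_of_neg (mul_neg_of_pos_of_neg ht hcos)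
    rw [zero_mul] at h1
    refine squeeze_zero_norm' ?_ h1
    filter_upwards [eventually_gt_atTop 0] with ρ hρ
    refine intervalIntegral.norm_integral_le_of_norm_le_const fun θ hθ => ?_
    rw [norm_exp_mul_cis]
    refine Real.exp_le_exp.2 ?_
    have := mul_le_mul_of_nonneg_left (hab θ hθ) (by positivity : 0 ≤ t * ρ)
    linarith
  have hd1 := hdecay φ Real.pi fun θ hθ => by
    rw [uIoc_of_le hφ.le] at hθ
    exact Real.cos_le_cos_of_nonneg_of_le_pi hφ1 hθ.2 hθ.1.le
  have hd2 := hdecay (-Real.pi) (-φ) fun θ hθ => by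
    rw [uIoc_of_le (by linarith)] at hθ
    rw [← Real.cos_neg θ]
    exact Real.cos_le_cos_of_nonneg_of_le_pi hφ1 (by linarith [hθ.1]) (by linarith [hθ.2])
  have l1 := intervalIntegral_tendsto_integral_Ioi R hint.ray_smul tendsto_id
  have l2 := intervalIntegral_tendsto_integral_Ioi R hint.ray_neg_smul tendsto_id
  have lhs := (l1.sub l2).add_const (arcInt (-φ) φ R F)
  have rhs := ((hd1.add hd2).const_mul Complex.I).const_sub (2 * Real.pi * Complex.I)
  rw [add_zero, mul_zero, sub_zero] at rhs
  refine tendsto_nhds_unique lhs (rhs.congr' ?_)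
  filter_upwards [eventually_gt_atTop 0] with ρ hρ
  exact (key ρ hρ).symm

/-- The previous integral does not depend on `t`, so its derivative vanishes. -/
theorem contourInt_exp {φ : ℝ} (hφ0 : Real.pi / 2 < φ) (hφ : φ < Real.pi) {t R : ℝ}
    (ht : 0 < t) (hR : 0 < R) :
    contourInt φ R (fun z => Complex.exp (z * t)) = 0 := by
  have h1 := tame_inv.hasDerivAt_contourInt hφ0 hφ ht hR
  have h2 : HasDerivAt (fun t : ℝ => contourInt φ R fun z => Complex.exp (z * t) • z⁻¹) 0 t := by
    refine (hasDerivAt_const t (2 * Real.pi * Complex.I)).congr_of_eventuallyEq ?_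
    filter_upwards [Ioi_mem_nhds ht] with s hs
    exact contourInt_exp_mul_inv hφ0 hφ hs hR
  refine Eq.trans ?_ (h2.unique h1).symm
  refine contourInt_congr (by linarith [Real.pi_pos]) hφ hR fun z hz => ?_
  rw [smul_eq_mul, smul_eq_mul, mul_inv_cancel₀ hz.1, mul_one]

lemma tame_one {φ : ℝ} : Tame φ fun _ : ℂ => (1 : ℂ) :=
  ⟨fun _ _ => differentiableAt_const _, 0, fun _ _ => ⟨1, zero_le_one, fun _ _ _ => by simp⟩⟩

lemma contourInt_smul_const {X : Type*} [NormedAddCommGroup X] [NormedSpace ℂ X] [CompleteSpace X]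
    {φ R : ℝ} {c : ℂ → ℂ} (hc : ContourIntegrable φ R c) (x : X) :
    contourInt φ R (fun z => c z • x) = contourInt φ R c • x := by
  have := hc.contourInt_map (ContinuousLinearMap.toSpanSingleton ℂ x)
  simpa using this

lemma contourInt_exp_smul {X : Type*} [NormedAddCommGroup X] [NormedSpace ℂ X] [CompleteSpace X]
    {φ : ℝ} (hφ0 : Real.pi / 2 < φ) (hφ : φ < Real.pi) (x : X) {t : ℝ} (ht : 0 < t) :
    contourInt φ 1 (fun z => Complex.exp (z * t) • x) = 0 := by
  have hi : ContourIntegrable φ 1 fun z => Complex.exp (z * t) := by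
    simpa using tame_one.contourIntegrable hφ0 hφ ht one_pos
  rw [contourInt_smul_const hi, contourInt_exp hφ0 hφ ht one_pos, zero_smul]

/-! ### The semigroup as a contour integral of the resolvent -/

lemma angle_gt {θ₁ : ℝ} (h2 : θ₁ < Real.pi / 2) : Real.pi / 2 < Real.pi - θ₁ := by linarith

lemma angle_lt {θ θ₁ : ℝ} (h0 : 0 < θ) (h1 : θ < θ₁) : Real.pi - θ₁ < Real.pi := by linarith

section HeatOp

variable {V H K : Type*} [NormedAddCommGroup V] [InnerProductSpace ℂ V] [CompleteSpace V]
  [NormedAddCommGroup H] [InnerProductSpace ℂ H] [CompleteSpace H]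
  [NormedAddCommGroup K] [NormedSpace ℂ K]
  {J : V →L[ℂ] H} {D : V →L[ℂ] K} {T : V →L[ℂ] V} {lam θ θ₁ : ℝ}

/-- The operator `∂ₜˡ e^{-tL}`, with values in the form domain, given by the contour integral
`(2πi)⁻¹ ∫_Γ zˡ e^{zt} (z + L)⁻¹ dz`. -/
noncomputable def heatOp (J : V →L[ℂ] H) (T : V →L[ℂ] V) (φ : ℝ) (l : ℕ) (t : ℝ) : H →L[ℂ] V :=
  (2 * Real.pi * Complex.I)⁻¹ •
    contourInt φ 1 fun z => Complex.exp (z * t) • (z ^ l • formRes J T z)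

lemma two_pi_I_ne_zero : (2 * Real.pi * Complex.I : ℂ) ≠ 0 := Complex.two_pi_I_ne_zero

lemma norm_two_pi_I_inv : ‖(2 * Real.pi * Complex.I : ℂ)⁻¹‖ = (2 * Real.pi)⁻¹ := by
  simp [abs_of_pos Real.pi_pos]

lemma IsSectorialForm.tame_formRes (h : IsSectorialForm J D T lam θ) (h1 : θ < θ₁)
    (h2 : θ₁ < Real.pi / 2) : Tame (Real.pi - θ₁) (formRes J T) := by
  refine ⟨fun z hz => h.differentiableAt_formRes h1 h2 hz, 0, fun R hR => ?_⟩
  obtain ⟨C, hC0, hC⟩ := h.exists_norm_formRes_le h1 h2 hR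
  exact ⟨C, hC0, fun z hz hzR => by simpa using hC z hz hzR⟩

/-- Evaluation of an operator at `f`, as a bounded linear map. -/
noncomputable def evalAt {H : Type*} [NormedAddCommGroup H] [NormedSpace ℂ H] (V : Type*)
    [NormedAddCommGroup V] [NormedSpace ℂ V] (f : H) :
    (H →L[ℂ] V) →L[ℂ] V := ContinuousLinearMap.apply ℂ V f

lemma evalAt_apply {V H : Type*} [NormedAddCommGroup H] [NormedSpace ℂ H] [NormedAddCommGroup V]
    [NormedSpace ℂ V] (f : H) (A : H →L[ℂ] V) : evalAt V f A = A f := rfl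

lemma IsSectorialForm.contourIntegrable_res (h : IsSectorialForm J D T lam θ) (h1 : θ < θ₁)
    (h2 : θ₁ < Real.pi / 2)
    (l : ℕ) {t R : ℝ} (ht : 0 < t) (hR : 0 < R) :
    ContourIntegrable (Real.pi - θ₁) R
      fun z => Complex.exp (z * t) • (z ^ l • formRes J T z) :=
  ((h.tame_formRes h1 h2).pow_smul l).contourIntegrable (angle_gt h2)
    (angle_lt h.theta_pos h1) ht hR

lemma IsSectorialForm.contourInt_res (h : IsSectorialForm J D T lam θ) (h1 : θ < θ₁)
    (h2 : θ₁ < Real.pi / 2)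
    (l : ℕ) {t R : ℝ} (ht : 0 < t) (hR : 0 < R) :
    contourInt (Real.pi - θ₁) R (fun z => Complex.exp (z * t) • (z ^ l • formRes J T z)) =
      (2 * Real.pi * Complex.I : ℂ) • heatOp J T (Real.pi - θ₁) l t := by
  rw [heatOp, smul_inv_smul₀ two_pi_I_ne_zero]
  exact ((h.tame_formRes h1 h2).pow_smul l).contourInt_eq (angle_gt h2) (angle_lt h.theta_pos h1)
    ht hR one_pos

lemma IsSectorialForm.contourIntegrable_map (h : IsSectorialForm J D T lam θ) (h1 : θ < θ₁)
    (h2 : θ₁ < Real.pi / 2)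
    {Y : Type*} [NormedAddCommGroup Y] [NormedSpace ℂ Y]
    (L : V →L[ℂ] Y) (l : ℕ) (f : H) {t R : ℝ} (ht : 0 < t) (hR : 0 < R) :
    ContourIntegrable (Real.pi - θ₁) R
      fun z => (z ^ l * Complex.exp (z * t)) • L (formRes J T z f) := by
  have := (h.contourIntegrable_res h1 h2 l ht hR).map (L ∘L evalAt V f)
  refine (congr_arg _ (funext fun z => ?_)).mp this
  simp [evalAt_apply, smul_smul, mul_comm]

lemma IsSectorialForm.contourInt_map (h : IsSectorialForm J D T lam θ) (h1 : θ < θ₁)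
    (h2 : θ₁ < Real.pi / 2)
    {Y : Type*} [NormedAddCommGroup Y] [NormedSpace ℂ Y]
    [CompleteSpace Y] (L : V →L[ℂ] Y) (l : ℕ) (f : H) {t R : ℝ} (ht : 0 < t) (hR : 0 < R) :
    contourInt (Real.pi - θ₁) R
      (fun z => (z ^ l * Complex.exp (z * t)) • L (formRes J T z f)) =
      (2 * Real.pi * Complex.I : ℂ) • L (heatOp J T (Real.pi - θ₁) l t f) := by
  have := (h.contourIntegrable_res h1 h2 l ht hR).contourInt_map (L ∘L evalAt V f)
  rw [h.contourInt_res h1 h2 l ht hR] at this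
  refine Eq.trans (congr_arg _ (funext fun z => ?_)) (this.trans ?_)
  · simp [evalAt_apply, smul_smul, mul_comm]
  · simp [evalAt_apply]

lemma IsSectorialForm.hasDerivAt_heatOp (h : IsSectorialForm J D T lam θ) (h1 : θ < θ₁)
    (h2 : θ₁ < Real.pi / 2)
    (l : ℕ) {t : ℝ} (ht : 0 < t) :
    HasDerivAt (heatOp J T (Real.pi - θ₁) l) (heatOp J T (Real.pi - θ₁) (l + 1) t) t := by
  have := ((h.tame_formRes h1 h2).pow_smul l).hasDerivAt_contourInt (angle_gt h2)
    (angle_lt h.theta_pos h1) ht one_pos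
  have h3 := this.const_smul (2 * Real.pi * Complex.I : ℂ)⁻¹
  refine h3.congr_deriv ?_
  rw [heatOp]
  simp only [pow_succ', mul_smul]

lemma IsSectorialForm.hasDerivAt_heatOp_apply (h : IsSectorialForm J D T lam θ) (h1 : θ < θ₁)
    (h2 : θ₁ < Real.pi / 2)
    {Y : Type*} [NormedAddCommGroup Y] [NormedSpace ℂ Y]
    (L : V →L[ℂ] Y) (l : ℕ) (f : H) {t : ℝ} (ht : 0 < t) :
    HasDerivAt (fun t => L (heatOp J T (Real.pi - θ₁) l t f))
      (L (heatOp J T (Real.pi - θ₁) (l + 1) t f)) t :=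
  ((L ∘L evalAt V f).restrictScalars ℝ).hasFDerivAt.comp_hasDerivAt t
    (h.hasDerivAt_heatOp h1 h2 l ht)

lemma IsSectorialForm.norm_map_heatOp_le (h : IsSectorialForm J D T lam θ) (h1 : θ < θ₁)
    (h2 : θ₁ < Real.pi / 2)
    {Y : Type*} [NormedAddCommGroup Y] [NormedSpace ℂ Y]
    [CompleteSpace Y] (L : V →L[ℂ] Y) (l m : ℕ) (f : H) {t C : ℝ} (ht : 0 < t) (hC : 0 ≤ C)
    (hL : ∀ z ∈ sector (Real.pi - θ₁), 1 ≤ t * ‖z‖ →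
      ‖z‖ ^ l * ‖L (formRes J T z f)‖ ≤ C * (t * ‖z‖) ^ m) :
    ‖L (heatOp J T (Real.pi - θ₁) l t f)‖ ≤
      (2 * Real.pi)⁻¹ * (C * contourConst m (Real.pi - θ₁) * t⁻¹) := by
  have e := h.contourInt_map h1 h2 L l f ht (inv_pos.2 ht)
  have e2 : L (heatOp J T (Real.pi - θ₁) l t f) = (2 * Real.pi * Complex.I : ℂ)⁻¹ •
      contourInt (Real.pi - θ₁) t⁻¹
        (fun z => (z ^ l * Complex.exp (z * t)) • L (formRes J T z f)) := by
    rw [e, inv_smul_smul₀ two_pi_I_ne_zero]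
  rw [e2, norm_smul, norm_two_pi_I_inv]
  refine mul_le_mul_of_nonneg_left ?_ (by positivity)
  refine norm_contourInt_le (angle_gt h2) (angle_lt h.theta_pos h1) ht hC m fun z hz hzt => ?_
  rw [norm_smul, norm_mul, norm_pow]
  have := mul_le_mul_of_nonneg_right (hL z hz hzt) (norm_nonneg (Complex.exp (z * t)))
  linarith

/-- The parabolic bounds of the time derivatives. -/
lemma IsSectorialForm.norm_J_heatOp_le (h : IsSectorialForm J D T lam θ) (h1 : θ < θ₁)
    (h2 : θ₁ < Real.pi / 2)
    (l : ℕ) (f : H) {t : ℝ} (ht : 0 < t) :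
    ‖J (heatOp J T (Real.pi - θ₁) l t f)‖ ≤
      (2 * Real.pi)⁻¹ * (Real.sin ((θ₁ - θ) / 2))⁻¹ * contourConst l (Real.pi - θ₁) *
        (t ^ l)⁻¹ * ‖f‖ := by
  have hσ := sin_half_pos h.theta_pos h1 h2
  set σ := Real.sin ((θ₁ - θ) / 2) with hs
  refine (h.norm_map_heatOp_le h1 h2 J l l f (C := σ⁻¹ * ‖f‖ * t * (t ^ l)⁻¹) ht (by positivity)
    fun z hz hzt => ?_).trans (le_of_eq ?_)
  · have hz0 : 0 < ‖z‖ := norm_pos_iff.2 hz.1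
    have hb := (h.norm_J_formRes_le h1 h2 hz f).1
    rw [← hs] at hb
    have hz1 : ‖z‖⁻¹ ≤ t := by
      rw [inv_le_iff_one_le_mul₀ hz0]; exact hzt
    calc ‖z‖ ^ l * ‖J (formRes J T z f)‖ ≤ ‖z‖ ^ l * (σ⁻¹ * t * ‖f‖) := by
          refine mul_le_mul_of_nonneg_left (hb.trans ?_) (by positivity)
          gcongr
      _ = σ⁻¹ * ‖f‖ * t * (t ^ l)⁻¹ * (t * ‖z‖) ^ l := by
          rw [mul_pow]; field_simp
  · field_simp

lemma IsSectorialForm.norm_D_heatOp_le [CompleteSpace K]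
    (h : IsSectorialForm J D T lam θ) (h1 : θ < θ₁)
    (h2 : θ₁ < Real.pi / 2)
    (f : H) {t : ℝ} (ht : 0 < t) :
    ‖D (heatOp J T (Real.pi - θ₁) 0 t f)‖ ≤
      (2 * Real.pi)⁻¹ * (Real.sin ((θ₁ - θ) / 2))⁻¹ * (Real.sqrt lam)⁻¹ *
        contourConst 0 (Real.pi - θ₁) * (Real.sqrt t)⁻¹ * ‖f‖ := by
  have hσ := sin_half_pos h.theta_pos h1 h2
  set σ := Real.sin ((θ₁ - θ) / 2) with hs
  have hst := Real.sqrt_pos.2 ht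
  refine (h.norm_map_heatOp_le h1 h2 D 0 0 f (C := σ⁻¹ * (Real.sqrt lam)⁻¹ * Real.sqrt t * ‖f‖) ht
    (by positivity) fun z hz hzt => ?_).trans (le_of_eq ?_)
  · have hz0 : 0 < ‖z‖ := norm_pos_iff.2 hz.1
    have hb := (h.norm_J_formRes_le h1 h2 hz f).2
    rw [← hs] at hb
    have hz1 : (Real.sqrt ‖z‖)⁻¹ ≤ Real.sqrt t := by
      rw [inv_le_iff_one_le_mul₀ (Real.sqrt_pos.2 hz0), ← Real.sqrt_mul ht.le]
      exact Real.one_le_sqrt.2 hzt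
    rw [pow_zero, one_mul, pow_zero, mul_one]
    refine hb.trans ?_
    gcongr
  · have : t = Real.sqrt t * Real.sqrt t := (Real.mul_self_sqrt ht.le).symm
    rw [this, Real.sqrt_mul_self hst.le]
    field_simp

/-- For `t > 0` the function `e^{-tL}f` solves the evolution equation. -/
lemma IsSectorialForm.apply_heatOp (h : IsSectorialForm J D T lam θ) (h1 : θ < θ₁)
    (h2 : θ₁ < Real.pi / 2)
    (f : H) {t : ℝ} (ht : 0 < t) :
    T (heatOp J T (Real.pi - θ₁) 0 t f) =
      J.adjoint (-J (heatOp J T (Real.pi - θ₁) 1 t f)) := by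
  have hφ := angle_gt h2
  have e0 := h.contourInt_map h1 h2 T 0 f ht one_pos
  have e1 := h.contourInt_map h1 h2 (J.adjoint ∘L J) 1 f ht one_pos
  have i1 := h.contourIntegrable_map h1 h2 (J.adjoint ∘L J) 1 f ht one_pos
  have i2 : ContourIntegrable (Real.pi - θ₁) 1 fun z => Complex.exp (z * t) • J.adjoint f := by
    have := (tame_one.contourIntegrable hφ (angle_lt h.theta_pos h1) ht one_pos).map
      (ContinuousLinearMap.toSpanSingleton ℂ (J.adjoint f))
    simpa using this
  have e2 : contourInt (Real.pi - θ₁) 1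
      (fun z => (z ^ 0 * Complex.exp (z * t)) • T (formRes J T z f)) =
      contourInt (Real.pi - θ₁) 1 (fun z => Complex.exp (z * t) • J.adjoint f -
        (z ^ 1 * Complex.exp (z * t)) • (J.adjoint ∘L J) (formRes J T z f)) := by
    refine contourInt_congr (by linarith [Real.pi_pos]) (angle_lt h.theta_pos h1) one_pos
      fun z hz => ?_
    rw [h.apply_formRes h1 h2 hz, map_sub, map_smul, smul_sub, pow_zero, one_mul, pow_one,
      smul_smul, mul_comm (Complex.exp _) z]
    rfl
  rw [i2.contourInt_sub i1, contourInt_exp_smul (angle_gt h2) (angle_lt h.theta_pos h1) _ ht,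
    zero_sub, e0, e1, ← smul_neg] at e2
  have e3 := smul_right_injective V two_pi_I_ne_zero e2
  rw [e3, map_neg]
  rfl

lemma IsSectorialForm.heatOp_one_of_mem (h : IsSectorialForm J D T lam θ) (h1 : θ < θ₁)
    (h2 : θ₁ < Real.pi / 2)
    {u : V} {w : H} (hu : T u = J.adjoint w) {t : ℝ}
    (ht : 0 < t) :
    heatOp J T (Real.pi - θ₁) 1 t (J u) = -heatOp J T (Real.pi - θ₁) 0 t w := by
  have hφ := angle_gt h2
  have e1 := h.contourInt_map h1 h2 (ContinuousLinearMap.id ℂ V) 1 (J u) ht one_pos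
  have e0 := h.contourInt_map h1 h2 (ContinuousLinearMap.id ℂ V) 0 w ht one_pos
  have i0 := h.contourIntegrable_map h1 h2 (ContinuousLinearMap.id ℂ V) 0 w ht one_pos
  have i2 : ContourIntegrable (Real.pi - θ₁) 1 fun z => Complex.exp (z * t) • u := by
    have := (tame_one.contourIntegrable hφ (angle_lt h.theta_pos h1) ht one_pos).map
      (ContinuousLinearMap.toSpanSingleton ℂ u)
    simpa using this
  have e2 : contourInt (Real.pi - θ₁) 1 (fun z => (z ^ 1 * Complex.exp (z * t)) •
        ContinuousLinearMap.id ℂ V (formRes J T z (J u))) =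
      contourInt (Real.pi - θ₁) 1 (fun z => Complex.exp (z * t) • u -
        (z ^ 0 * Complex.exp (z * t)) • ContinuousLinearMap.id ℂ V (formRes J T z w)) := by
    refine contourInt_congr (by linarith [Real.pi_pos]) (angle_lt h.theta_pos h1) one_pos
      fun z hz => ?_
    have := h.formRes_of_mem h1 h2 hz hu
    rw [map_add, map_smul] at this
    simp only [pow_zero, one_mul, pow_one, ContinuousLinearMap.id_apply]
    rw [← smul_sub, ← this, add_sub_cancel_right, mul_comm, mul_smul, this]
  rw [i2.contourInt_sub i0, contourInt_exp_smul (angle_gt h2) (angle_lt h.theta_pos h1) _ ht,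
    zero_sub, e0, e1, ← smul_neg] at e2
  exact smul_right_injective V two_pi_I_ne_zero e2

/-- On the domain of `L`, the semigroup converges to the identity at a linear rate. -/
lemma IsSectorialForm.norm_heatOp_sub_le (h : IsSectorialForm J D T lam θ) (h1 : θ < θ₁)
    (h2 : θ₁ < Real.pi / 2)
    {u : V} {w : H} (hu : T u = J.adjoint w) {t : ℝ}
    (ht : 0 < t) :
    ‖J (heatOp J T (Real.pi - θ₁) 0 t (J u)) - J u‖ ≤
      (2 * Real.pi)⁻¹ * (Real.sin ((θ₁ - θ) / 2))⁻¹ * contourConst 0 (Real.pi - θ₁) * ‖w‖ * t := by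
  have hσ := sin_half_pos h.theta_pos h1 h2
  set σ := Real.sin ((θ₁ - θ) / 2) with hs
  have hφ := angle_gt h2
  have hti := inv_pos.2 ht
  have i1 := h.contourIntegrable_map h1 h2 J 0 (J u) ht hti
  have e1 := h.contourInt_map h1 h2 J 0 (J u) ht hti
  have i2 := tame_inv.contourIntegrable hφ (angle_lt h.theta_pos h1) ht hti
  have i3 : ContourIntegrable (Real.pi - θ₁) t⁻¹ fun z => (Complex.exp (z * t) • z⁻¹) • J u := by
    have := i2.map (ContinuousLinearMap.toSpanSingleton ℂ (J u))
    simpa using this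
  have e3 : contourInt (Real.pi - θ₁) t⁻¹ (fun z => (Complex.exp (z * t) • z⁻¹) • J u) =
      (2 * Real.pi * Complex.I : ℂ) • J u := by
    rw [contourInt_smul_const i2, contourInt_exp_mul_inv hφ (angle_lt h.theta_pos h1) ht hti]
  have e4 : J (heatOp J T (Real.pi - θ₁) 0 t (J u)) - J u = (2 * Real.pi * Complex.I : ℂ)⁻¹ •
      contourInt (Real.pi - θ₁) t⁻¹ (fun z => (z ^ 0 * Complex.exp (z * t)) •
        J (formRes J T z (J u)) - (Complex.exp (z * t) • z⁻¹) • J u) := by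
    rw [i1.contourInt_sub i3, e1, e3, ← smul_sub, inv_smul_smul₀ two_pi_I_ne_zero]
  rw [e4, norm_smul, norm_two_pi_I_inv]
  have hb := norm_contourInt_le hφ (angle_lt h.theta_pos h1) ht (K := σ⁻¹ * t ^ 2 * ‖w‖)
    (F := fun z => (z ^ 0 * Complex.exp (z * t)) •
        J (formRes J T z (J u)) - (Complex.exp (z * t) • z⁻¹) • J u) (by positivity) 0
    fun z hz hzt => by
      have hz0 : 0 < ‖z‖ := norm_pos_iff.2 hz.1
      have hr := h.formRes_of_mem h1 h2 hz hu
      rw [map_add, map_smul] at hr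
      have e5 : J (formRes J T z (J u)) - z⁻¹ • J u = -(z⁻¹ • J (formRes J T z w)) := by
        have : J u = z • J (formRes J T z (J u)) + J (formRes J T z w) := by
          rw [← map_smul, ← map_add, hr]
        nth_rewrite 2 [this]
        rw [smul_add, inv_smul_smul₀ hz.1]
        abel
      have hb := (h.norm_J_formRes_le h1 h2 hz w).1
      rw [← hs] at hb
      have hz1 : ‖z‖⁻¹ ≤ t := by
        rw [inv_le_iff_one_le_mul₀ hz0]; exact hzt
      rw [pow_zero, one_mul, smul_assoc, ← smul_sub, e5, norm_smul, norm_neg, norm_smul, norm_inv,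
        pow_zero, mul_one, mul_comm]
      refine mul_le_mul_of_nonneg_right ?_ (norm_nonneg _)
      calc ‖z‖⁻¹ * ‖J (formRes J T z w)‖ ≤ t * (σ⁻¹ * t * ‖w‖) := by
            refine mul_le_mul hz1 (hb.trans ?_) (norm_nonneg _) ht.le
            gcongr
        _ = σ⁻¹ * t ^ 2 * ‖w‖ := by ring
  refine (mul_le_mul_of_nonneg_left hb (by positivity)).trans (le_of_eq ?_)
  field_simp

end HeatOp

/-! ### Generation and uniqueness of the semigroup -/

section Semigroup

variable {H : Type*} [NormedAddCommGroup H] [InnerProductSpace ℂ H]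

/-- The strongly continuous semigroup on a Hilbert space whose generator is minus the operator with
the graph `G`. -/
structure IsC0Semigroup (G : Set (H × H)) (S : ℝ → H →L[ℂ] H) : Prop where
  zero : S 0 = ContinuousLinearMap.id ℂ H
  add : ∀ s t : ℝ, 0 ≤ s → 0 ≤ t → S (s + t) = (S s).comp (S t)
  continuous : ∀ f : H, ContinuousOn (fun t => S t f) (Ici 0)
  generator : ∀ u w : H,
    Tendsto (fun t : ℝ => t⁻¹ • (S t u - u)) (𝓝[>] 0) (𝓝 (-w)) ↔ (u, w) ∈ G

lemma hasDerivWithinAt_norm_sq {u : ℝ → H} {w : H} {s : Set ℝ} {t : ℝ}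
    (hu : HasDerivWithinAt u (-w) s t) :
    HasDerivWithinAt (fun t => ‖u t‖ ^ 2) (-(2 * (inner ℂ (u t) w).re)) s t := by
  let _ := InnerProductSpace.rclikeToReal ℂ H
  have := hu.norm_sq
  refine this.congr_deriv ?_
  rw [inner_neg_right, real_inner_eq_re_inner ℂ]
  simp

/-- A solution of `u' = -w` with `Re (u, w) ≥ 0` has nonincreasing norm. -/
lemma norm_le_norm_zero {u w : ℝ → H} (hc : ContinuousOn u (Ici 0))
    (hd : ∀ t, 0 < t → HasDerivWithinAt u (-w t) (Ici t) t)
    (hdis : ∀ t, 0 < t → 0 ≤ (inner ℂ (u t) (w t)).re) {t : ℝ} (ht : 0 ≤ t) : ‖u t‖ ≤ ‖u 0‖ := by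
  rcases ht.eq_or_lt with rfl | ht
  · exact le_rfl
  have key : ∀ ε ∈ Ioc 0 t, ‖u t‖ ≤ ‖u ε‖ := by
    intro ε hε
    have := image_le_of_deriv_right_le_deriv_boundary (f := fun s => ‖u s‖ ^ 2)
      (f' := fun s => -(2 * (inner ℂ (u s) (w s)).re)) (a := ε) (b := t)
      (B := fun _ => ‖u ε‖ ^ 2) (B' := fun _ => 0)
      ((hc.mono fun s hs => hε.1.le.trans hs.1).norm.pow 2)
      (fun s hs => hasDerivWithinAt_norm_sq (hd s (hε.1.trans_le hs.1))) le_rfl continuousOn_const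
      (fun s _ => hasDerivWithinAt_const _ _ _)
      (fun s hs => by linarith [hdis s (hε.1.trans_le hs.1)]) (right_mem_Icc.2 hε.2)
    exact le_of_sq_le_sq this (norm_nonneg _)
  have hlim : Tendsto (fun ε => ‖u ε‖) (𝓝[>] 0) (𝓝 ‖u 0‖) :=
    ((hc 0 self_mem_Ici).mono Ioi_subset_Ici_self).norm
  exact ge_of_tendsto hlim (by
    filter_upwards [Ioc_mem_nhdsGT ht] with ε hε using key ε hε)

/-- A semigroup maps the domain of its generator into itself and is differentiable there. -/
lemma IsC0Semigroup.mem_and_hasDerivWithinAt {G : Set (H × H)} {S : ℝ → H →L[ℂ] H}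
    (hS : IsC0Semigroup G S) {u w : H} (hu : (u, w) ∈ G) {t : ℝ} (ht : 0 ≤ t) :
    (S t u, S t w) ∈ G ∧ HasDerivWithinAt (fun t => S t u) (-S t w) (Ici t) t := by
  have h0 := (hS.generator u w).2 hu
  have h1 : Tendsto (fun s : ℝ => S t (s⁻¹ • (S s u - u))) (𝓝[>] 0) (𝓝 (-S t w)) := by
    rw [← map_neg]
    exact ((S t).continuous.tendsto _).comp h0
  constructor
  · refine (hS.generator _ _).1 (h1.congr' ?_)
    filter_upwards [self_mem_nhdsWithin] with s hs
    have hs0 : (0 : ℝ) ≤ s := le_of_lt hs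
    have e : S t (S s u) = S s (S t u) := by
      have e1 := DFunLike.congr_fun (hS.add t s ht hs0) u
      have e2 := DFunLike.congr_fun (hS.add s t hs0 ht) u
      rw [add_comm] at e2
      exact e1.symm.trans e2
    rw [ContinuousLinearMap.map_smul_of_tower, map_sub, e]
  · rw [← hasDerivWithinAt_Ioi_iff_Ici, hasDerivWithinAt_iff_tendsto_slope' (by simp)]
    have hmap : Tendsto (fun y : ℝ => y - t) (𝓝[>] t) (𝓝[>] 0) := by
      refine tendsto_nhdsWithin_iff.2 ⟨?_, ?_⟩
      · have : Tendsto (fun y : ℝ => y - t) (𝓝 t) (𝓝 (t - t)) := by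
          exact tendsto_id.sub_const t
        rw [sub_self] at this
        exact this.mono_left nhdsWithin_le_nhds
      · filter_upwards [self_mem_nhdsWithin] with y hy
        exact sub_pos.2 (show t < y from hy)
    refine (h1.comp hmap).congr' ?_
    filter_upwards [self_mem_nhdsWithin] with y hy
    have hy0 : 0 ≤ y - t := (sub_pos.2 (show t < y from hy)).le
    have e1 := DFunLike.congr_fun (hS.add t (y - t) ht hy0) u
    rw [add_sub_cancel] at e1
    simp only [Function.comp_apply, slope_def_module]
    rw [e1, ContinuousLinearMap.map_smul_of_tower, map_sub]
    rfl

/-- Two semigroups with the same accretive, densely defined operator coincide. -/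
lemma IsC0Semigroup.eq_of_accretive {G : Set (H × H)} {S S' : ℝ → H →L[ℂ] H}
    (hS : IsC0Semigroup G S) (hS' : IsC0Semigroup G S')
    (hsub : ∀ p ∈ G, ∀ q ∈ G, p - q ∈ G) (hacc : ∀ p ∈ G, 0 ≤ (inner ℂ p.1 p.2).re)
    (hdense : Dense {f : H | ∃ w, (f, w) ∈ G}) {t : ℝ} (ht : 0 ≤ t) : S t = S' t := by
  have key : ∀ f ∈ {f : H | ∃ w, (f, w) ∈ G}, S t f = S' t f := by
    rintro f ⟨w, hf⟩
    have := norm_le_norm_zero (u := fun s => S s f - S' s f) (w := fun s => S s w - S' s w)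
      ((hS.continuous f).sub (hS'.continuous f))
      (fun s hs => (((hS.mem_and_hasDerivWithinAt hf hs.le).2).sub
        ((hS'.mem_and_hasDerivWithinAt hf hs.le).2)).congr_deriv (by abel))
      (fun s hs => hacc _ (hsub _ (hS.mem_and_hasDerivWithinAt hf hs.le).1 _
        (hS'.mem_and_hasDerivWithinAt hf hs.le).1)) ht
    simp only [hS.zero, hS'.zero, sub_self, norm_zero] at this
    exact sub_eq_zero.1 (norm_le_zero_iff.1 this)
  exact DFunLike.coe_injective (Continuous.ext_on hdense (S t).continuous (S' t).continuous key)

/-- Uniformly bounded operators which converge to the identity on a dense set converge to the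
identity. -/
lemma tendsto_id_of_dense {A : ℝ → H →L[ℂ] H} {C : ℝ} (hC : 0 ≤ C) {s : Set H} (hs : Dense s)
    (hA : ∀ t, 0 < t → ∀ f, ‖A t f‖ ≤ C * ‖f‖)
    (h : ∀ f ∈ s, Tendsto (fun t => A t f) (𝓝[>] 0) (𝓝 f)) (f : H) :
    Tendsto (fun t => A t f) (𝓝[>] 0) (𝓝 f) := by
  rw [Metric.tendsto_nhds]
  intro ε hε
  obtain ⟨g, hg, hfg⟩ := Metric.mem_closure_iff.1 (hs f) (ε / (2 * (C + 1))) (by positivity)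
  filter_upwards [Metric.tendsto_nhds.1 (h g hg) (ε / 2) (by positivity), self_mem_nhdsWithin]
    with t h1 h2
  have h3 := hA t h2 (f - g)
  rw [map_sub, ← dist_eq_norm, ← dist_eq_norm] at h3
  rw [lt_div_iff₀ (by positivity)] at hfg
  rw [dist_comm] at hfg
  have h4 := dist_triangle4 (A t f) (A t g) g f
  rw [dist_comm g f] at h4 hfg
  linarith

end Semigroup

section Generation

variable {V H K : Type*} [NormedAddCommGroup V] [InnerProductSpace ℂ V] [CompleteSpace V]
  [NormedAddCommGroup H] [InnerProductSpace ℂ H] [CompleteSpace H]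
  [NormedAddCommGroup K] [NormedSpace ℂ K]
  {J : V →L[ℂ] H} {D : V →L[ℂ] K} {T : V →L[ℂ] V} {lam θ θ₁ : ℝ}

lemma formGraph_sub {p q : H × H} (hp : p ∈ formGraph J T) (hq : q ∈ formGraph J T) :
    p - q ∈ formGraph J T := by
  obtain ⟨u, hu, hu'⟩ := hp
  obtain ⟨v, hv, hv'⟩ := hq
  exact ⟨u - v, by rw [map_sub, hu, hv]; rfl, by rw [map_sub, hu', hv', ← map_sub]; rfl⟩

lemma IsSectorialForm.accretive (h : IsSectorialForm J D T lam θ) {p : H × H}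
    (hp : p ∈ formGraph J T) : 0 ≤ (inner ℂ p.1 p.2).re := by
  obtain ⟨u, hu, hu'⟩ := hp
  rw [← hu, ← ContinuousLinearMap.adjoint_inner_right, ← hu']
  exact le_trans (mul_nonneg h.lam_pos.le (sq_nonneg _)) (h.coercive u)

open Classical in
/-- The semigroup `e^{-tL}` on the Hilbert space `H`. The contour integral represents it for
`t > 0` only; for `t ≤ 0` the value is set to be the identity. -/
noncomputable def heatSemigroup (J : V →L[ℂ] H) (T : V →L[ℂ] V) (φ : ℝ) (t : ℝ) : H →L[ℂ] H :=
  if 0 < t then J ∘L heatOp J T φ 0 t else ContinuousLinearMap.id ℂ H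

lemma heatSemigroup_of_pos (φ : ℝ) {t : ℝ} (ht : 0 < t) (f : H) :
    heatSemigroup J T φ t f = J (heatOp J T φ 0 t f) := by
  rw [heatSemigroup, if_pos ht]; rfl

lemma heatSemigroup_zero (φ : ℝ) : heatSemigroup J T φ 0 = ContinuousLinearMap.id ℂ H := by
  rw [heatSemigroup, if_neg (lt_irrefl _)]

lemma IsSectorialForm.hasDerivAt_heatSemigroup (h : IsSectorialForm J D T lam θ) (h1 : θ < θ₁)
    (h2 : θ₁ < Real.pi / 2) (f : H) {t : ℝ} (ht : 0 < t) :
    HasDerivAt (fun t => heatSemigroup J T (Real.pi - θ₁) t f)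
      (J (heatOp J T (Real.pi - θ₁) 1 t f)) t := by
  refine (h.hasDerivAt_heatOp_apply h1 h2 J 0 f ht).congr_of_eventuallyEq ?_
  filter_upwards [Ioi_mem_nhds ht] with s hs
  exact heatSemigroup_of_pos _ hs f

lemma IsSectorialForm.heatSemigroup_mem (h : IsSectorialForm J D T lam θ) (h1 : θ < θ₁)
    (h2 : θ₁ < Real.pi / 2) (f : H) {t : ℝ} (ht : 0 < t) :
    (heatSemigroup J T (Real.pi - θ₁) t f, -J (heatOp J T (Real.pi - θ₁) 1 t f)) ∈
      formGraph J T :=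
  ⟨_, (heatSemigroup_of_pos _ ht f).symm, h.apply_heatOp h1 h2 f ht⟩

lemma IsSectorialForm.tendsto_heatSemigroup_zero (h : IsSectorialForm J D T lam θ) (h1 : θ < θ₁)
    (h2 : θ₁ < Real.pi / 2) (f : H) :
    Tendsto (fun t => heatSemigroup J T (Real.pi - θ₁) t f) (𝓝[>] 0) (𝓝 f) := by
  have hσ := sin_half_pos h.theta_pos h1 h2
  have hcc := contourConst_nonneg 0 (by linarith [Real.pi_pos] : (0 : ℝ) ≤ Real.pi - θ₁)
  refine tendsto_id_of_dense (C := (2 * Real.pi)⁻¹ * (Real.sin ((θ₁ - θ) / 2))⁻¹ *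
    contourConst 0 (Real.pi - θ₁)) (by positivity) (h.dense_domain h1 h2) (fun t ht f => ?_)
    (fun f hf => ?_) f
  · rw [heatSemigroup_of_pos _ ht]
    simpa using h.norm_J_heatOp_le h1 h2 0 f ht
  · obtain ⟨w, u, hu, hw⟩ := hf
    simp only at hu hw
    rw [tendsto_iff_norm_sub_tendsto_zero]
    have hlim : Tendsto (fun t : ℝ => (2 * Real.pi)⁻¹ * (Real.sin ((θ₁ - θ) / 2))⁻¹ *
        contourConst 0 (Real.pi - θ₁) * ‖w‖ * t) (𝓝[>] 0) (𝓝 0) := by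
      have := (tendsto_id (α := ℝ) (x := 𝓝 0)).const_mul ((2 * Real.pi)⁻¹ *
        (Real.sin ((θ₁ - θ) / 2))⁻¹ * contourConst 0 (Real.pi - θ₁) * ‖w‖)
      rw [mul_zero] at this
      exact this.mono_left nhdsWithin_le_nhds
    refine squeeze_zero' (Eventually.of_forall fun _ => norm_nonneg _) ?_ hlim
    filter_upwards [self_mem_nhdsWithin] with t ht
    rw [heatSemigroup_of_pos _ ht, ← hu]
    exact h.norm_heatOp_sub_le h1 h2 hw ht

lemma IsSectorialForm.continuousOn_heatSemigroup (h : IsSectorialForm J D T lam θ) (h1 : θ < θ₁)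
    (h2 : θ₁ < Real.pi / 2) (f : H) :
    ContinuousOn (fun t => heatSemigroup J T (Real.pi - θ₁) t f) (Ici 0) := by
  intro t ht
  rcases (show (0 : ℝ) ≤ t from ht).eq_or_lt with rfl | ht
  · rw [← continuousWithinAt_Ioi_iff_Ici, ContinuousWithinAt, heatSemigroup_zero]
    exact h.tendsto_heatSemigroup_zero h1 h2 f
  · exact (h.hasDerivAt_heatSemigroup h1 h2 f ht).continuousAt.continuousWithinAt

lemma IsSectorialForm.norm_heatSemigroup_le (h : IsSectorialForm J D T lam θ) (h1 : θ < θ₁)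
    (h2 : θ₁ < Real.pi / 2) (f : H) {t : ℝ} (ht : 0 ≤ t) :
    ‖heatSemigroup J T (Real.pi - θ₁) t f‖ ≤ ‖f‖ := by
  have := norm_le_norm_zero (u := fun s => heatSemigroup J T (Real.pi - θ₁) s f)
    (w := fun s => -J (heatOp J T (Real.pi - θ₁) 1 s f)) (h.continuousOn_heatSemigroup h1 h2 f)
    (fun s hs => by
      rw [neg_neg]; exact (h.hasDerivAt_heatSemigroup h1 h2 f hs).hasDerivWithinAt)
    (fun s hs => h.accretive (h.heatSemigroup_mem h1 h2 f hs)) ht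
  simpa [heatSemigroup_zero] using this

/-- Both sides solve `h' = -Lh` in `s` with the same initial value. -/
lemma IsSectorialForm.heatSemigroup_add (h : IsSectorialForm J D T lam θ) (h1 : θ < θ₁)
    (h2 : θ₁ < Real.pi / 2) {s t : ℝ} (hs : 0 ≤ s) (ht : 0 ≤ t) :
    heatSemigroup J T (Real.pi - θ₁) (s + t) =
      (heatSemigroup J T (Real.pi - θ₁) s).comp (heatSemigroup J T (Real.pi - θ₁) t) := by
  rcases ht.eq_or_lt with rfl | ht
  · rw [add_zero, heatSemigroup_zero]; rfl
  ext f
  set S := heatSemigroup J T (Real.pi - θ₁) with hS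
  have hshift : ∀ x : ℝ, 0 ≤ x → HasDerivAt (fun x => S (x + t) f)
      (J (heatOp J T (Real.pi - θ₁) 1 (x + t) f)) x := fun x hx =>
    (h.hasDerivAt_heatSemigroup h1 h2 f (by positivity : 0 < x + t)).comp_add_const x t
  have := norm_le_norm_zero (u := fun x => S (x + t) f - S x (S t f))
    (w := fun x => -J (heatOp J T (Real.pi - θ₁) 1 (x + t) f) -
      -J (heatOp J T (Real.pi - θ₁) 1 x (S t f)))
    (ContinuousOn.sub (fun x hx => (hshift x hx).continuousAt.continuousWithinAt)
      (h.continuousOn_heatSemigroup h1 h2 _))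
    (fun x hx => (((hshift x hx.le).sub
      (h.hasDerivAt_heatSemigroup h1 h2 (S t f) hx)).congr_deriv (by abel)).hasDerivWithinAt)
    (fun x hx => h.accretive (formGraph_sub (h.heatSemigroup_mem h1 h2 f (by positivity))
      (h.heatSemigroup_mem h1 h2 (S t f) hx))) hs
  have e0 : S (0 + t) f - S 0 (S t f) = 0 := by
    rw [zero_add, hS, heatSemigroup_zero]; simp
  rw [e0, norm_zero] at this
  exact sub_eq_zero.1 (norm_le_zero_iff.1 this)

lemma IsSectorialForm.tendsto_generator (h : IsSectorialForm J D T lam θ) (h1 : θ < θ₁)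
    (h2 : θ₁ < Real.pi / 2) {f w : H} (hf : (f, w) ∈ formGraph J T) :
    Tendsto (fun t : ℝ => t⁻¹ • (heatSemigroup J T (Real.pi - θ₁) t f - f)) (𝓝[>] 0)
      (𝓝 (-w)) := by
  obtain ⟨u, hu, hw⟩ := hf
  simp only at hu hw
  set S := heatSemigroup J T (Real.pi - θ₁) with hS
  have hd : ∀ t : ℝ, 0 < t → HasDerivAt (fun t => S t f) (-S t w) t := fun t ht =>
    (h.hasDerivAt_heatSemigroup h1 h2 f ht).congr_deriv (by
      rw [hS, heatSemigroup_of_pos _ ht, ← hu, h.heatOp_one_of_mem h1 h2 hw ht, map_neg])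
  have h0 : HasDerivWithinAt (fun t => S t f) (-w) (Ici 0) 0 := by
    refine hasDerivWithinAt_Ici_of_tendsto_deriv (s := Ioi 0)
      (fun t ht => (hd t ht).differentiableAt.differentiableWithinAt)
      ((h.continuousOn_heatSemigroup h1 h2 f 0 self_mem_Ici).mono Ioi_subset_Ici_self)
      self_mem_nhdsWithin ?_
    refine (h.tendsto_heatSemigroup_zero h1 h2 w).neg.congr' ?_
    filter_upwards [self_mem_nhdsWithin] with t ht
    exact (hd t ht).deriv.symm
  rw [← hasDerivWithinAt_Ioi_iff_Ici, hasDerivWithinAt_iff_tendsto_slope' (by simp)] at h0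
  refine h0.congr fun t => ?_
  rw [slope_def_module, sub_zero, hS, heatSemigroup_zero]
  rfl

/-- The semigroup given by the contour integral is generated by `-L`. That no larger domain is
possible follows from the surjectivity of `1 + L` and the contractivity of the semigroup. -/
theorem IsSectorialForm.isC0Semigroup (h : IsSectorialForm J D T lam θ) (h1 : θ < θ₁)
    (h2 : θ₁ < Real.pi / 2) :
    IsC0Semigroup (formGraph J T) (heatSemigroup J T (Real.pi - θ₁)) := by
  refine ⟨heatSemigroup_zero _, fun s t hs ht => h.heatSemigroup_add h1 h2 hs ht,
    h.continuousOn_heatSemigroup h1 h2, fun u w => ⟨fun hu => ?_, h.tendsto_generator h1 h2⟩⟩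
  have hz : (1 : ℂ) ∈ sector (Real.pi - θ₁) :=
    ⟨one_ne_zero, by simp; linarith [Real.pi_pos]⟩
  set S := heatSemigroup J T (Real.pi - θ₁) with hS
  set g := formRes J T 1 (u + w) with hg
  have hgG : (J g, u + w - J g) ∈ formGraph J T :=
    ⟨g, rfl, by
      have := h.apply_formRes h1 h2 hz (u + w)
      rwa [one_smul] at this⟩
  have hlim := hu.sub (h.tendsto_generator h1 h2 hgG)
  set e := u - J g with he
  have hlim' : Tendsto (fun t : ℝ => t⁻¹ • (S t e - e)) (𝓝[>] 0) (𝓝 e) := by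
    have e1 : -w - -(u + w - J g) = e := by rw [he]; abel
    rw [e1] at hlim
    refine hlim.congr fun t => ?_
    rw [← smul_sub, he, map_sub]
    congr 1
    abel
  have hin : Tendsto (fun t : ℝ => (inner ℂ e (t⁻¹ • (S t e - e))).re) (𝓝[>] 0)
      (𝓝 (inner ℂ e e).re) :=
    (Complex.continuous_re.tendsto _).comp (tendsto_const_nhds.inner hlim')
  have hle : (inner ℂ e e).re ≤ 0 := by
    refine le_of_tendsto hin ?_
    filter_upwards [self_mem_nhdsWithin] with t ht
    have ht0 : (0 : ℝ) < t := ht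
    have hsm : (t⁻¹ : ℝ) • (S t e - e) = ((t⁻¹ : ℝ) : ℂ) • (S t e - e) :=
      RCLike.real_smul_eq_coe_smul (K := ℂ) _ _
    rw [hsm, inner_smul_right, Complex.re_ofReal_mul, inner_sub_right, Complex.sub_re]
    refine mul_nonpos_of_nonneg_of_nonpos (by positivity) ?_
    have a1 := (Complex.re_le_norm _).trans (norm_inner_le_norm (𝕜 := ℂ) e (S t e))
    have a2 := mul_le_mul_of_nonneg_left (h.norm_heatSemigroup_le h1 h2 e ht0.le) (norm_nonneg e)
    have a3 : (inner ℂ e e).re = ‖e‖ * ‖e‖ := inner_self_eq_norm_mul_norm (𝕜 := ℂ) e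
    rw [a3]
    linarith
  have he0 : e = 0 := by
    have a3 : (inner ℂ e e).re = ‖e‖ * ‖e‖ := inner_self_eq_norm_mul_norm (𝕜 := ℂ) e
    rw [a3] at hle
    have := mul_self_eq_zero.1 (le_antisymm hle (mul_self_nonneg ‖e‖))
    exact norm_eq_zero.1 this
  have hug : J g = u := (sub_eq_zero.1 he0).symm
  rw [hug] at hgG
  simpa using hgG

/-- Every semigroup generated by `-L` is the contour integral, for each admissible angle `θ₁`. -/
lemma IsSectorialForm.semigroup_eq (h : IsSectorialForm J D T lam θ) (h1 : θ < θ₁)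
    (h2 : θ₁ < Real.pi / 2) {S : ℝ → H →L[ℂ] H} (hS : IsC0Semigroup (formGraph J T) S) {t : ℝ}
    (ht : 0 < t) (f : H) : S t f = J (heatOp J T (Real.pi - θ₁) 0 t f) := by
  rw [hS.eq_of_accretive (h.isC0Semigroup h1 h2) (fun p hp q hq => formGraph_sub hp hq)
    (fun p hp => h.accretive hp) (h.dense_domain h1 h2) ht.le, heatSemigroup_of_pos _ ht]

end Generation

/-- A sequence of functions each of which is the derivative of the preceding one consists of smooth
functions. -/
lemma contDiffOn_of_hasDerivAt_succ {X : Type*} [NormedAddCommGroup X] [NormedSpace ℝ X]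
    {F : ℕ → ℝ → X} (hF : ∀ l t, 0 < t → HasDerivAt (F l) (F (l + 1) t) t) (k l : ℕ) :
    ContDiffOn ℝ k (F l) (Ioi 0) := by
  induction k generalizing l with
  | zero =>
    rw [Nat.cast_zero, contDiffOn_zero]
    exact fun t ht => (hF l t ht).continuousAt.continuousWithinAt
  | succ k ih =>
    rw [Nat.cast_succ, contDiffOn_succ_iff_deriv_of_isOpen isOpen_Ioi]
    refine ⟨fun t ht => (hF l t ht).differentiableAt.differentiableWithinAt, by simp, ?_⟩
    exact (ih (l + 1)).congr fun t ht => (hF l t ht).deriv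

lemma iteratedDeriv_eq_of_hasDerivAt_succ {X : Type*} [NormedAddCommGroup X] [NormedSpace ℝ X]
    {F : ℕ → ℝ → X} (hF : ∀ l t, 0 < t → HasDerivAt (F l) (F (l + 1) t) t) {f : ℝ → X}
    (hf : ∀ t, 0 < t → f t = F 0 t) (l : ℕ) {t : ℝ} (ht : 0 < t) :
    iteratedDeriv l f t = F l t := by
  induction l generalizing t with
  | zero => rw [iteratedDeriv_zero, hf t ht]
  | succ l ih =>
    rw [iteratedDeriv_succ]
    have : iteratedDeriv l f =ᶠ[𝓝 t] F l := by
      filter_upwards [Ioi_mem_nhds ht] with s hs using ih hs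
    rw [this.deriv_eq, (hF l t ht).deriv]

/-! ### The semigroup of the elliptic operator -/

/-- If `|w| ≤ K d` and `Re w ≥ l d`, then `|Im w| ≤ (K / l) Re w`. -/
lemma abs_arg_le_arctan {w : ℂ} {K l d : ℝ} (hl : 0 < l) (hK : 0 < K) (h1 : ‖w‖ ≤ K * d)
    (h2 : l * d ≤ w.re) : |Complex.arg w| ≤ Real.arctan (K / l) := by
  have hd : 0 ≤ d := by
    by_contra! hd
    exact absurd (norm_nonneg w) (not_le.2 (h1.trans_lt (mul_neg_of_pos_of_neg hK hd)))
  have hre : 0 ≤ w.re := (mul_nonneg hl.le hd).trans h2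
  rcases hre.eq_or_lt with h0 | h0
  · have hd0 : d = 0 := by nlinarith
    have : w = 0 := norm_le_zero_iff.1 (by simpa [hd0] using h1)
    rw [this, Complex.arg_zero, abs_zero]
    exact Real.arctan_nonneg.2 (by positivity)
  · have hpi : |Complex.arg w| < Real.pi / 2 := Complex.abs_arg_lt_pi_div_two_iff.2 (Or.inl h0)
    have htan : |w.im / w.re| ≤ K / l := by
      rw [abs_div, abs_of_pos h0, div_le_div_iff₀ h0 hl]
      calc |w.im| * l ≤ K * d * l :=
            mul_le_mul_of_nonneg_right ((Complex.abs_im_le_norm w).trans h1) hl.le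
        _ = K * (l * d) := by ring
        _ ≤ K * w.re := mul_le_mul_of_nonneg_left h2 hK.le
    have harg : Complex.arg w = Real.arctan (w.im / w.re) := by
      rw [← Complex.tan_arg, Real.arctan_tan (abs_lt.1 hpi).1 (abs_lt.1 hpi).2]
    rw [harg, abs_le, ← Real.arctan_neg]
    exact ⟨Real.arctan_mono (abs_le.1 htan).1, Real.arctan_mono (abs_le.1 htan).2⟩

/-- The half-angle of a sector which contains the numerical ranges of all the forms. The summand `1`
makes it positive for sure. -/
noncomputable def sectorAngle (n : ℕ) (lam Lam : ℝ) : ℝ :=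
  Real.arctan ((formConst n lam Lam + 1) / lam)

lemma formConst_nonneg {lam Lam : ℝ} (hlam : 0 < lam) (hLam : 0 < Lam) :
    0 ≤ formConst n lam Lam := by
  have := divCurlConst_nonneg n
  unfold formConst pairingConst
  positivity

lemma sectorAngle_pos {lam Lam : ℝ} (hlam : 0 < lam) (hLam : 0 < Lam) :
    0 < sectorAngle n lam Lam := by
  have := formConst_nonneg (n := n) hlam hLam
  exact Real.arctan_pos.2 (by positivity)

lemma sectorAngle_lt (n : ℕ) (lam Lam : ℝ) : sectorAngle n lam Lam < Real.pi / 2 :=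
  Real.arctan_lt_pi_div_two _

section

variable {A : E n → Matrix (Fin n) (Fin n) ℝ} {T : Sob n →L[ℂ] Sob n} {lam : ℝ}

/-- Both the modulus and the real part of `t[u,u]` are comparable to `‖∇u‖²`. -/
lemma numericalRangeInSector_of_bounds {Lam : ℝ} (hlam : 0 < lam) (hLam : 0 < Lam)
    (hb : ∀ u v, ‖form A (Sob.val n u) (Sob.val n v)‖ ≤
      formConst n lam Lam * (‖sobD n u‖ * ‖sobD n v‖))
    (hre : ∀ u, lam * ‖sobD n u‖ ^ 2 ≤ (form A (Sob.val n u) (Sob.val n u)).re) :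
    NumericalRangeInSector A (sectorAngle n lam Lam) := by
  have hK := formConst_nonneg (n := n) hlam hLam
  rintro _ ⟨u, -, rfl⟩
  have h1 := hb (Sob.mk u) (Sob.mk u)
  rw [← sq] at h1
  refine abs_arg_le_arctan hlam (by linarith) (h1.trans ?_) (hre (Sob.mk u))
  exact mul_le_mul_of_nonneg_right (by linarith) (sq_nonneg _)

/-- The sector condition on the numerical range extends to all `u` by homogeneity. -/
lemma isSectorialForm_of_numericalRange
    (hT : ∀ u v, form A (Sob.val n u) (Sob.val n v) = inner ℂ v (T u)) (hlam : 0 < lam)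
    (hre : ∀ u, lam * ‖sobD n u‖ ^ 2 ≤ (form A (Sob.val n u) (Sob.val n u)).re) {θ : ℝ}
    (hθ : 0 < θ) (hnum : NumericalRangeInSector A θ) :
    IsSectorialForm (sobJ n) (sobD n) T lam θ where
  injective := sobJ_injective
  dense := denseRange_sobJ
  norm_sq := sob_norm_sq
  lam_pos := hlam
  coercive u := by rw [← hT]; exact hre u
  theta_pos := hθ
  arg_le u := by
    by_cases hu : sobJ n u = 0
    · rw [sobJ_injective (hu.trans (map_zero _).symm), inner_zero_left, Complex.arg_zero, abs_zero]
      exact hθ.le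
    set r : ℝ := ‖sobJ n u‖⁻¹ with hr
    have hr0 : 0 < r := inv_pos.2 (norm_pos_iff.2 hu)
    have h1 : inner ℂ ((r : ℂ) • u) (T ((r : ℂ) • u)) = ((r * r : ℝ) : ℂ) * inner ℂ u (T u) := by
      rw [map_smul, inner_smul_left, inner_smul_right, Complex.conj_ofReal]
      push_cast
      ring
    have h2 := hnum (form A (Sob.val n ((r : ℂ) • u)) (Sob.val n ((r : ℂ) • u)))
      ⟨_, by
        rw [← sobJ_apply, map_smul, norm_smul, Complex.norm_real, Real.norm_of_nonneg hr0.le, hr,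
          inv_mul_cancel₀ (norm_ne_zero_iff.2 hu)], rfl⟩
    rwa [hT, h1, Complex.arg_real_mul _ (mul_pos hr0 hr0)] at h2

lemma opGraph_eq_formGraph
    (hT : ∀ u v, form A (Sob.val n u) (Sob.val n v) = inner ℂ v (T u)) :
    opGraph A = formGraph (sobJ n) T := by
  ext ⟨f, w⟩
  constructor
  · rintro ⟨u, hu, hv⟩
    refine ⟨Sob.mk u, hu, ext_inner_left ℂ fun v => ?_⟩
    rw [← hT, ContinuousLinearMap.adjoint_inner_right]
    exact hv (Sob.val n v)
  · rintro ⟨u, hu, hv⟩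
    refine ⟨Sob.val n u, hu, fun v => ?_⟩
    have := hT u (Sob.mk v)
    rw [hv, ContinuousLinearMap.adjoint_inner_right] at this
    exact this

end

lemma isSemigroup_iff {G : Set (L2 n × L2 n)} {S : ℝ → L2 n →L[ℂ] L2 n} :
    IsSemigroup G S ↔ IsC0Semigroup G S :=
  ⟨fun h => ⟨h.zero, h.add, h.continuous, h.generator⟩,
    fun h => ⟨h.zero, h.add, h.continuous, h.generator⟩⟩

section

variable {T : Sob n →L[ℂ] Sob n} {lam θ θ₁ : ℝ}

lemma IsSectorialForm.isResolvent (h : IsSectorialForm (sobJ n) (sobD n) T lam θ) (h1 : θ < θ₁)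
    (h2 : θ₁ < Real.pi / 2) {z : ℂ} (hz : z ∈ sector (Real.pi - θ₁)) :
    IsResolvent (formGraph (sobJ n) T) z
      ((toL2 n).comp ((Sob.val n).comp (formRes (sobJ n) T z))) := by
  refine ⟨fun f => ⟨formRes (sobJ n) T z f, rfl, h.apply_formRes h1 h2 hz f⟩, ?_⟩
  rintro _ w ⟨u, rfl, hu⟩
  exact congr_arg (sobJ n) (h.formRes_of_mem h1 h2 hz hu)

lemma IsSectorialForm.hasContourIntegral_heatOp (h : IsSectorialForm (sobJ n) (sobD n) T lam θ)
    (h1 : θ < θ₁) (h2 : θ₁ < Real.pi / 2) (l : ℕ) (f : L2 n) {t R : ℝ} (ht : 0 < t) (hR : 0 < R) :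
    HasContourIntegral (Real.pi - θ₁) R
      (fun z => (z ^ l * Complex.exp (z * t)) • sobJ n (formRes (sobJ n) T z f))
      ((2 * Real.pi * Complex.I : ℂ) • sobJ n (heatOp (sobJ n) T (Real.pi - θ₁) l t f)) := by
  rw [← h.contourInt_map h1 h2 (sobJ n) l f ht hR]
  exact (h.contourIntegrable_map h1 h2 (sobJ n) l f ht hR).hasContourIntegral

lemma IsSectorialForm.hasContourIntegral_partial_heatOp
    (h : IsSectorialForm (sobJ n) (sobD n) T lam θ)
    (h1 : θ < θ₁) (h2 : θ₁ < Real.pi / 2) (j : Fin n) (f : L2 n) {t R : ℝ} (ht : 0 < t)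
    (hR : 0 < R) :
    HasContourIntegral (Real.pi - θ₁) R
      (fun z => Complex.exp (z * t) • sobPartial n j (formRes (sobJ n) T z f))
      ((2 * Real.pi * Complex.I : ℂ) •
        sobPartial n j (heatOp (sobJ n) T (Real.pi - θ₁) 0 t f)) := by
  rw [← h.contourInt_map h1 h2 (sobPartial n j) 0 f ht hR]
  have := (h.contourIntegrable_map h1 h2 (sobPartial n j) 0 f ht hR).hasContourIntegral
  simp only [pow_zero, one_mul] at this ⊢
  exact this

end

end BMOElliptic

open BMOElliptic
theorem mainTheorem10 (n : ℕ) (hn : 2 ≤ n) (lam0 Lam0 : ℝ)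
    (hlam0 : 0 < lam0) (hlam0' : lam0 ≤ 1) (hLam0 : 0 < Lam0) :
    ∃ (θ₀ : ℝ) (c : ℕ → ℝ) (C : ℝ), 0 < θ₀ ∧ θ₀ < Real.pi / 2 ∧
      ∀ A : E n → Matrix (Fin n) (Fin n) ℝ, IsCoefficient lam0 Lam0 A →
        NumericalRangeInSector A θ₀ ∧
        (∃ S : ℝ → L2 n →L[ℂ] L2 n, IsSemigroup (opGraph A) S) ∧
        ∀ S : ℝ → L2 n →L[ℂ] L2 n, IsSemigroup (opGraph A) S →
          ∃ H : ℝ → L2 n →L[ℂ] W12 n,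
            (∀ t : ℝ, 0 < t → ∀ f : L2 n, toL2 n (H t f) = S t f) ∧
            (∀ f : L2 n, ContinuousOn (fun t => H t f) (Ioi 0)) ∧
            (∀ (f : L2 n) (l : ℕ), ContDiffOn ℝ l (fun t => S t f) (Ioi 0)) ∧
            (∀ θ θ₁ : ℝ, 0 < θ → θ < θ₁ → θ₁ < Real.pi / 2 → NumericalRangeInSector A θ →
              ∃ Res : ℂ → L2 n →L[ℂ] W12 n,
                (∀ z ∈ sector (Real.pi - θ₁),
                  IsResolvent (opGraph A) z ((toL2 n).comp (Res z))) ∧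
                ∀ R : ℝ, 0 < R → ∀ f : L2 n, ∀ t : ℝ, 0 < t →
                  (∀ l : ℕ, HasContourIntegral (Real.pi - θ₁) R
                    (fun z => (z ^ l * Complex.exp (z * t)) • toL2 n (Res z f))
                    ((2 * Real.pi * Complex.I) • iteratedDeriv l (fun s => S s f) t)) ∧
                  (∀ j : Fin n, HasContourIntegral (Real.pi - θ₁) R
                    (fun z => Complex.exp (z * t) • grad n (Res z f) j)
                    ((2 * Real.pi * Complex.I) • grad n (H t f) j))) ∧
            (∀ t : ℝ, 0 < t → ∀ f : L2 n,
              (∀ l : ℕ, ‖iteratedDeriv l (fun s => S s f) t‖ ≤ c l * t ^ (-(l : ℝ)) * ‖f‖) ∧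
              ‖grad n (H t f)‖ ≤ C * t ^ (-(1 / 2) : ℝ) * ‖f‖) := by
  set θ₀ := sectorAngle n lam0 Lam0 with hθ₀
  have hpos : 0 < θ₀ := sectorAngle_pos hlam0 hLam0
  have hlt : θ₀ < Real.pi / 2 := sectorAngle_lt n lam0 Lam0
  -- The constants come from the contour whose angle is halfway between `θ₀` and `π / 2`.
  set ψ := (θ₀ + Real.pi / 2) / 2 with hψ
  have h1 : θ₀ < ψ := by rw [hψ]; linarith
  have h2 : ψ < Real.pi / 2 := by rw [hψ]; linarith
  refine ⟨θ₀,
    fun l => (2 * Real.pi)⁻¹ * (Real.sin ((ψ - θ₀) / 2))⁻¹ * contourConst l (Real.pi - ψ),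
    (2 * Real.pi)⁻¹ * (Real.sin ((ψ - θ₀) / 2))⁻¹ * (Real.sqrt lam0)⁻¹ *
      contourConst 0 (Real.pi - ψ), hpos, hlt, fun A hA => ?_⟩
  obtain ⟨T, hT, hb, hre⟩ := hA.exists_form_operator hlam0 hLam0
  have hnum : NumericalRangeInSector A θ₀ := numericalRangeInSector_of_bounds hlam0 hLam0 hb hre
  have h := isSectorialForm_of_numericalRange hT hlam0 hre hpos hnum
  rw [opGraph_eq_formGraph hT]
  refine ⟨hnum, ⟨_, isSemigroup_iff.2 (h.isC0Semigroup h1 h2)⟩, fun S hS => ?_⟩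
  have hS' := isSemigroup_iff.1 hS
  refine ⟨fun t => (Sob.val n).comp (heatOp (sobJ n) T (Real.pi - ψ) 0 t),
    fun t ht f => (h.semigroup_eq h1 h2 hS' ht f).symm, fun f t ht => ?_, fun f l => ?_,
    fun θ θ₁ hθ hθ1 hθ2 hnum' => ?_, fun t ht f => ⟨fun l => ?_, ?_⟩⟩
  · exact (h.hasDerivAt_heatOp_apply h1 h2 (Sob.val n) 0 f ht).continuousAt.continuousWithinAt
  · exact (contDiffOn_of_hasDerivAt_succ
      (F := fun l t => sobJ n (heatOp (sobJ n) T (Real.pi - ψ) l t f))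
      (fun l t ht => h.hasDerivAt_heatOp_apply h1 h2 (sobJ n) l f ht) l 0).congr
      fun t ht => h.semigroup_eq h1 h2 hS' ht f
  · have h' := isSectorialForm_of_numericalRange hT hlam0 hre hθ hnum'
    refine ⟨fun z => (Sob.val n).comp (formRes (sobJ n) T z),
      fun z hz => h'.isResolvent hθ1 hθ2 hz, fun R hR f t ht => ⟨fun l => ?_, fun j => ?_⟩⟩
    · rw [iteratedDeriv_eq_of_hasDerivAt_succ
        (F := fun l t => sobJ n (heatOp (sobJ n) T (Real.pi - θ₁) l t f))
        (fun l t ht => h'.hasDerivAt_heatOp_apply hθ1 hθ2 (sobJ n) l f ht)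
        (fun t ht => h'.semigroup_eq hθ1 hθ2 hS' ht f) l ht]
      exact h'.hasContourIntegral_heatOp hθ1 hθ2 l f ht hR
    · -- By uniqueness of the semigroup its contour integrals for the two angles agree.
      have e : heatOp (sobJ n) T (Real.pi - ψ) 0 t f = heatOp (sobJ n) T (Real.pi - θ₁) 0 t f :=
        sobJ_injective
          ((h.semigroup_eq h1 h2 hS' ht f).symm.trans (h'.semigroup_eq hθ1 hθ2 hS' ht f))
      have := h'.hasContourIntegral_partial_heatOp hθ1 hθ2 j f ht hR
      rw [← e] at this
      exact this
  · rw [iteratedDeriv_eq_of_hasDerivAt_succ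
      (F := fun l t => sobJ n (heatOp (sobJ n) T (Real.pi - ψ) l t f))
      (fun l t ht => h.hasDerivAt_heatOp_apply h1 h2 (sobJ n) l f ht)
      (fun t ht => h.semigroup_eq h1 h2 hS' ht f) l ht, Real.rpow_neg ht.le, Real.rpow_natCast]
    exact h.norm_J_heatOp_le h1 h2 l f ht
  · rw [Real.rpow_neg ht.le, ← Real.sqrt_eq_rpow]
    exact h.norm_D_heatOp_le h1 h2 f ht
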